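/- Let $\ell,T>0$, let $\rho,\mu\in L^\infty(0,\ell)$ and $r,\kappa\in H^2(0,\ell)$ satisfy, a.e. on $(0,\ell)$, $0<\rho_0\le\rho\le\rho_1$, $0\le\mu_0\le\mu\le\mu_1$, $0<r_0\le r\le r_1$, $0<\kappa_0\le\kappa\le\kappa_1$. Let $\mathcal V=\{v\in H^2(0,\ell): v(0)=v_x(0)=0\}$ with the $H^2$ norm. For $g\in H^1(0,T)$ with $g(0)=0$ consider the beam problem $$\rho u_{tt}+\mu u_t+(ru_{xx})_{xx}+(\kappa u_{xxt})_{xx}=0\ \text{ in }(0,\ell)\times(0,T),$$ $$u|_{t=0}=u_t|_{t=0}=0,\quad u|_{x=0}=u_x|_{x=0}=0,\quad [ru_{xx}+\kappa u_{xxt}]_{x=\ell}=0,\quad -[(ru_{xx}+\kappa u_{xxt})_x]_{x=\ell}=g.$$ A weak solution is a function $u\in L^2(0,T;\mathcal V)$ with $u_t\in L^2(0,T;\mathcal V)$, $u_{tt}\in L^2(0,T;L^2(0,\ell))$, $u(0)=0$, $u_t(0)=0$, such that for every $v\in\mathcal V$ and a.e. $t\in(0,T)$, $$(\rho u_{tt}(t),v)+(\mu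 u_t(t),v)+(ru_{xx}(t),v_{xx})+(\kappa u_{xxt}(t),v_{xx})=g(t)\,v(\ell),$$ where $(\cdot,\cdot)$ is the inner product of $L^2(0,\ell)$. For $C_g,\bar C_g>0$ let $$\mathcal G_1=\{g\in H^1(0,T): g(0)=0,\ \|g\|_{H^1(0,T)}\le C_g\},$$ $$\mathcal G_2=\{g\in H^2(0,T): g(0)=g'(0)=0,\ \|g\|_{H^2(0,T)}\le\bar C_g\}.$$ Then for every $g\in\mathcal G_1$, and likewise for every $g\in\mathcal G_2$, there is a unique weak solution $u=u(\cdot,\cdot;g)$, and the functions $$(\Phi g)(t)=u(\ell,t;g),\qquad (\Psi g)(t)=-\big(r(0)u_{xx}(0,t;g)+\kappa(0)u_{xxt}(0,t;g)\big)$$ are well defined for a.e. $t\in(0,T)$ and belong to $L^2(0,T)$ (point values in $x$ are those of continuous representatives). Moreover: 1. The Neumann-to-Dirichlet operator $\Phi:\mathcal G_1\subset H^1(0,T)\to L^2(0,T)$ and the Neumann-to-Neumann operator $\Psi:\mathcal G_2\subset H^2(0,T)\to L^2(0,T)$ are compact, i.e. continuous and mapping bounded subsets of their domains to relatively compact subsets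 of $L^2(0,T)$. 2. For all $g_1,g_2\in\mathcal G_1$, $$\|\Phi(g_1)-\Phi(g_2)\|_{L^2(0,T)}\le L_0\|g_1-g_2\|_{H^1(0,T)},\qquad \|\Psi(g_1)-\Psi(g_2)\|_{L^2(0,T)}\le L_1\|g_1-g_2\|_{H^1(0,T)},$$ where $L_0,L_1\ge 0$ are given by $$L_0^2=\frac{4\ell^6(1+T)C_0^2}{9r_0^2},\qquad L_1^2=C_7^2\left[1+\left(\frac{C^*(C_0^2+1)}{3\kappa_0r_0}+\frac{C_1^2}{2\rho_0}\right)(1+T)\ell^3\right],$$ $$C_0^2=e^T-1,\quad C^*=4\ell^2(1+4\ell^2)+1,\quad C_7^2=2\ell^2\max\Big\{1,\tfrac{2\ell}{3}(\rho_1^2+\mu_1^2)\Big\},$$ $$C_1^2=\max\{R_2,\ R_1\rho_1+\mu_1,\ R_1r_1+r_1^2,\ \kappa_1+1\},\qquad R_2=\frac{2R_1}{3r_0}+\frac{2(\ell^3+3)}{3\ell^3\kappa_0},$$ $$R_1=\left(\frac{4r_1^2(\ell^3+3)}{3r_0}+\frac{\kappa_0\ell^3}{4(\ell^3+3)}+r_1\right)\frac{C_0^2+1}{\kappa_0}.$$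 -/

import Mathlib

open MeasureTheory Set Filter
open scoped ENNReal ContDiff

noncomputable section

namespace Beam

/-! ### Weak derivatives and point values on an interval -/

section General

variable {E : Type*} [NormedAddCommGroup E]

/-- `f'` is the weak derivative of `f` on the open interval `(a, b)`: integration by parts against
every `φ ∈ C_c^∞(a, b)`.  It is only used for square integrable `f`, `f'` with values in a Banach
space (either `ℝ` or `L²(0, ℓ)`). -/
def HasWeakDeriv [NormedSpace ℝ E] (a b : ℝ) (f f' : ℝ → E) : Prop :=
  ∀ φ : ℝ → ℝ, ContDiff ℝ ∞ φ → HasCompactSupport φ → tsupport φ ⊆ Ioo a b →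
    ∫ s in Ioo a b, deriv φ s • f s = - ∫ s in Ioo a b, φ s • f' s

/-- The (class of the) function `f` on `(a, b)` has a representative that is continuous on `[a, b]`,
and the value of that representative at `x` is `e`. -/
def HasTrace (a b : ℝ) (f : ℝ → E) (x : ℝ) (e : E) : Prop :=
  ∃ F : ℝ → E, ContinuousOn F (Icc a b) ∧ F =ᵐ[volume.restrict (Ioo a b)] f ∧ F x = e

theorem HasTrace.unique {a b : ℝ} (hab : a < b) {f : ℝ → E} {x : ℝ} (hx : x ∈ Icc a b) {e e' : E}
    (h : HasTrace a b f x e) (h' : HasTrace a b f x e') : e = e' := by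
  obtain ⟨F, hF, hFf, rfl⟩ := h
  obtain ⟨G, hG, hGf, rfl⟩ := h'
  have hae : F =ᵐ[volume.restrict (Icc a b)] G := by
    rw [restrict_Ioo_eq_restrict_Icc] at hFf hGf
    exact hFf.trans hGf.symm
  exact Measure.eqOn_Icc_of_ae_eq volume hab.ne hae hF hG hx

open Classical in
/-- The value at `x` of the continuous representative of `f` (`0` if there is none). -/
def traceAt (a b : ℝ) (f : ℝ → E) (x : ℝ) : E :=
  if h : ∃ e, HasTrace a b f x e then h.choose else 0

theorem HasTrace.traceAt_eq {a b : ℝ} (hab : a < b) {f : ℝ → E} {x : ℝ} (hx : x ∈ Icc a b) {e : E}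
    (h : HasTrace a b f x e) : traceAt a b f x = e := by
  have hex : ∃ e, HasTrace a b f x e := ⟨e, h⟩
  rw [traceAt, dif_pos hex]
  exact hex.choose_spec.unique hab hx h

end General

/-! ### Lebesgue and Sobolev spaces on an interval -/

/-- The Hilbert space `L²(a, b)`. -/
abbrev L2 (a b : ℝ) : Type := Lp ℝ 2 (volume.restrict (Ioo a b))

/-- The space `L^∞(a, b)`. -/
abbrev LInf (a b : ℝ) : Type := Lp ℝ ∞ (volume.restrict (Ioo a b))

theorem integrable_smul_L2 {a b : ℝ} {φ : ℝ → ℝ} (hφ : Continuous φ) (hc : HasCompactSupport φ)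
    (f : L2 a b) : Integrable (fun s => φ s • f s) (volume.restrict (Ioo a b)) := by
  obtain ⟨C, hC⟩ := hc.exists_bound_of_continuous hφ
  have hf : Integrable (f : ℝ → ℝ) (volume.restrict (Ioo a b)) :=
    (Lp.memLp f).integrable (by norm_num)
  exact hf.bdd_mul hφ.aestronglyMeasurable (Eventually.of_forall hC)

theorem HasWeakDeriv.zero_L2 (a b : ℝ) :
    HasWeakDeriv a b ((0 : L2 a b) : ℝ → ℝ) ((0 : L2 a b) : ℝ → ℝ) := by
  intro φ _ _ _
  have h0 := Lp.coeFn_zero ℝ 2 (volume.restrict (Ioo a b))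
  have h1 : ∀ ψ : ℝ → ℝ, ∫ s in Ioo a b, ψ s • ((0 : L2 a b) : ℝ → ℝ) s = 0 := by
    intro ψ
    apply integral_eq_zero_of_ae
    filter_upwards [h0] with s hs
    rw [hs]
    simp
  rw [h1, h1, neg_zero]

theorem HasWeakDeriv.add_L2 {a b : ℝ} {f f' g g' : L2 a b}
    (hf : HasWeakDeriv a b f f') (hg : HasWeakDeriv a b g g') :
    HasWeakDeriv a b ((f + g : L2 a b) : ℝ → ℝ) ((f' + g' : L2 a b) : ℝ → ℝ) := by
  intro φ h1 h2 h3
  have key : ∀ ψ : ℝ → ℝ, Continuous ψ → HasCompactSupport ψ → ∀ p q : L2 a b,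
      ∫ s in Ioo a b, ψ s • ((p + q : L2 a b) : ℝ → ℝ) s
        = (∫ s in Ioo a b, ψ s • p s) + ∫ s in Ioo a b, ψ s • q s := by
    intro ψ hψ hψc p q
    rw [← integral_add (integrable_smul_L2 hψ hψc p) (integrable_smul_L2 hψ hψc q)]
    apply integral_congr_ae
    filter_upwards [Lp.coeFn_add p q] with s hs
    rw [hs, Pi.add_apply, smul_add]
  rw [key _ (h1.continuous_deriv (by simp)) h2.deriv, key _ h1.continuous h2,
    hf φ h1 h2 h3, hg φ h1 h2 h3]
  ring

theorem HasWeakDeriv.smul_L2 {a b : ℝ} (c : ℝ) {f f' : L2 a b} (hf : HasWeakDeriv a b f f') :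
    HasWeakDeriv a b ((c • f : L2 a b) : ℝ → ℝ) ((c • f' : L2 a b) : ℝ → ℝ) := by
  intro φ h1 h2 h3
  have key : ∀ ψ : ℝ → ℝ, ∀ p : L2 a b,
      ∫ s in Ioo a b, ψ s • ((c • p : L2 a b) : ℝ → ℝ) s = c * ∫ s in Ioo a b, ψ s • p s := by
    intro ψ p
    rw [← integral_const_mul]
    apply integral_congr_ae
    filter_upwards [Lp.coeFn_smul c p] with s hs
    rw [hs, Pi.smul_apply, smul_eq_mul, smul_eq_mul, smul_eq_mul]
    ring
  rw [key, key, hf φ h1 h2 h3]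
  ring

/-- The Sobolev space `H^k(a, b)`.  An element is the tuple `(f, f', …, f^{(k)})` of a function
`f ∈ L²(a, b)` and its weak derivatives up to order `k`, all in `L²(a, b)`; the inherited norm is the
standard one, `‖f‖² = ∑_{j ≤ k} ‖f^{(j)}‖²_{L²(a, b)}`. -/
def Sobolev (k : ℕ) (a b : ℝ) : Submodule ℝ (PiLp 2 fun _ : Fin (k + 1) => L2 a b) where
  carrier := {f | ∀ i : Fin k, HasWeakDeriv a b (f i.castSucc) (f i.succ)}
  zero_mem' := fun _ => HasWeakDeriv.zero_L2 a b
  add_mem' := fun hf hg i => (hf i).add_L2 (hg i)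
  smul_mem' := fun c _ hf i => (hf i).smul_L2 c

/-- The weak derivative of order `i ≤ k` of `f ∈ H^k(a, b)`; `wd f 0` is `f` itself. -/
def wd {k : ℕ} {a b : ℝ} (f : Sobolev k a b) (i : Fin (k + 1)) : L2 a b :=
  (f : PiLp 2 fun _ : Fin (k + 1) => L2 a b) i

theorem HasTrace.zero_L2 (a b x : ℝ) : HasTrace a b ((0 : L2 a b) : ℝ → ℝ) x 0 :=
  ⟨fun _ => 0, continuousOn_const, (Lp.coeFn_zero ℝ 2 (volume.restrict (Ioo a b))).symm, rfl⟩

theorem HasTrace.add_L2 {a b x : ℝ} {f g : L2 a b} (hf : HasTrace a b f x 0)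
    (hg : HasTrace a b g x 0) : HasTrace a b ((f + g : L2 a b) : ℝ → ℝ) x 0 := by
  obtain ⟨F, h1, h2, h3⟩ := hf
  obtain ⟨G, k1, k2, k3⟩ := hg
  refine ⟨F + G, h1.add k1, (h2.add k2).trans (Lp.coeFn_add f g).symm, ?_⟩
  simp [h3, k3]

theorem HasTrace.smul_L2 {a b x : ℝ} (c : ℝ) {f : L2 a b} (hf : HasTrace a b f x 0) :
    HasTrace a b ((c • f : L2 a b) : ℝ → ℝ) x 0 := by
  obtain ⟨F, h1, h2, h3⟩ := hf
  refine ⟨c • F, h1.const_smul c, (h2.const_smul c).trans (Lp.coeFn_smul c f).symm, ?_⟩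
  simp [h3]

/-- The energy space `{v ∈ H²(0, ℓ) : v(0) = v'(0) = 0}` with the norm of `H²(0, ℓ)`. -/
def V (ℓ : ℝ) : Submodule ℝ (Sobolev 2 0 ℓ) where
  carrier := {v | HasTrace 0 ℓ (wd v 0) 0 0 ∧ HasTrace 0 ℓ (wd v 1) 0 0}
  zero_mem' := ⟨HasTrace.zero_L2 0 ℓ 0, HasTrace.zero_L2 0 ℓ 0⟩
  add_mem' := fun hf hg => ⟨hf.1.add_L2 hg.1, hf.2.add_L2 hg.2⟩
  smul_mem' := fun c _ hf => ⟨hf.1.smul_L2 c, hf.2.smul_L2 c⟩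

/-- The weak `x`-derivative of order `i ≤ 2` of an element of the energy space. -/
def dx {ℓ : ℝ} (i : Fin 3) (v : V ℓ) : L2 0 ℓ := wd (v : Sobolev 2 0 ℓ) i

/-- The Bochner space `L²(0, T; E)`. -/
abbrev L2t (T : ℝ) (E : Type*) [NormedAddCommGroup E] : Type _ :=
  Lp E 2 (volume.restrict (Ioo 0 T))

/-! ### The damped Euler–Bernoulli beam -/

/-- The coefficients of the beam: density `rho`, external damping `mu`, flexural rigidity `r` and
Kelvin–Voigt damping `kappa`. -/
structure Coeffs (ℓ : ℝ) where
  rho : LInf 0 ℓ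
  mu : LInf 0 ℓ
  r : Sobolev 2 0 ℓ
  kappa : Sobolev 2 0 ℓ

variable {ℓ T : ℝ}

/-- `u ∈ L²(0,T;V)`, with `u_t = ut ∈ L²(0,T;V)` and `u_tt = utt ∈ L²(0,T;L²(0,ℓ))`, is a weak
solution of the beam equation
`ρ u_tt + μ u_t + (r u_xx)_xx + (κ u_xxt)_xx = 0` on `(0,ℓ) × (0,T)` with `u = u_t = 0` at `t = 0`,
`u = u_x = 0` at `x = 0`, and `r u_xx + κ u_xxt = 0`, `-(r u_xx + κ u_xxt)_x = g` at `x = ℓ`. -/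
structure IsWeakSolutionWith (B : Coeffs ℓ) (g : L2 0 T) (u ut : L2t T (V ℓ))
    (utt : L2t T (L2 0 ℓ)) : Prop where
  deriv_u : HasWeakDeriv 0 T (fun t => dx 0 ((u : ℝ → V ℓ) t)) (fun t => dx 0 ((ut : ℝ → V ℓ) t))
  deriv_ut : HasWeakDeriv 0 T (fun t => dx 0 ((ut : ℝ → V ℓ) t)) (fun t => utt t)
  equation : ∀ v : V ℓ, ∀ᵐ t ∂(volume.restrict (Ioo 0 T)),
    (∫ x in Ioo 0 ℓ, B.rho x * utt t x * dx 0 v x)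
      + (∫ x in Ioo 0 ℓ, B.mu x * dx 0 ((ut : ℝ → V ℓ) t) x * dx 0 v x)
      + (∫ x in Ioo 0 ℓ, wd B.r 0 x * dx 2 ((u : ℝ → V ℓ) t) x * dx 2 v x)
      + (∫ x in Ioo 0 ℓ, wd B.kappa 0 x * dx 2 ((ut : ℝ → V ℓ) t) x * dx 2 v x)
      = g t * traceAt 0 ℓ (dx 0 v) ℓ
  init_u : HasTrace 0 T (u : ℝ → V ℓ) 0 0
  init_ut : HasTrace 0 T (fun t => dx 0 ((ut : ℝ → V ℓ) t)) 0 0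

/-- `u` is a weak solution of the direct problem with shear force `g`. -/
def IsWeakSolution (B : Coeffs ℓ) (g : L2 0 T) (u : L2t T (V ℓ)) : Prop :=
  ∃ (ut : L2t T (V ℓ)) (utt : L2t T (L2 0 ℓ)), IsWeakSolutionWith B g u ut utt

/-- `ν ∈ L²(0,T)` is the deflection `ν(t) = u(ℓ, t)` of a weak solution with shear force `g`. -/
def IsDeflection (B : Coeffs ℓ) (g ν : L2 0 T) : Prop :=
  ∃ u : L2t T (V ℓ), IsWeakSolution B g u ∧
    ∀ᵐ t ∂(volume.restrict (Ioo 0 T)), HasTrace 0 ℓ (dx 0 ((u : ℝ → V ℓ) t)) ℓ (ν t)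

/-- `m ∈ L²(0,T)` is the bending moment `m(t) = -(r(0) u_xx(0,t) + κ(0) u_xxt(0,t))` of a weak
solution with shear force `g`. -/
def IsMoment (B : Coeffs ℓ) (g m : L2 0 T) : Prop :=
  ∃ (u ut : L2t T (V ℓ)) (utt : L2t T (L2 0 ℓ)), IsWeakSolutionWith B g u ut utt ∧
    ∀ᵐ t ∂(volume.restrict (Ioo 0 T)), ∃ a b : ℝ,
      HasTrace 0 ℓ (dx 2 ((u : ℝ → V ℓ) t)) 0 a ∧ HasTrace 0 ℓ (dx 2 ((ut : ℝ → V ℓ) t)) 0 b ∧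
      m t = -(traceAt 0 ℓ (wd B.r 0) 0 * a + traceAt 0 ℓ (wd B.kappa 0) 0 * b)

/-- The Neumann-to-Dirichlet operator `(Φ g)(t) = u(ℓ, t; g)`.  (Arbitrary value where the
deflection is not defined.) -/
def Phi (B : Coeffs ℓ) (g : L2 0 T) : L2 0 T := Classical.epsilon (IsDeflection B g)

/-- The Neumann-to-Neumann operator `(Ψ g)(t) = -(r(0) u_xx(0,t;g) + κ(0) u_xxt(0,t;g))`.
(Arbitrary value where the moment is not defined.) -/
def Psi (B : Coeffs ℓ) (g : L2 0 T) : L2 0 T := Classical.epsilon (IsMoment B g)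

/-- The admissible set `{g ∈ H¹(0,T) : g(0) = 0, ‖g‖ ≤ C}`. -/
def G1 (T C : ℝ) : Set (Sobolev 1 0 T) :=
  {g | HasTrace 0 T (wd g 0) 0 0 ∧ ‖g‖ ≤ C}

/-- The admissible set `{g ∈ H²(0,T) : g(0) = g'(0) = 0, ‖g‖ ≤ C}`. -/
def G2 (T C : ℝ) : Set (Sobolev 2 0 T) :=
  {g | HasTrace 0 T (wd g 0) 0 0 ∧ HasTrace 0 T (wd g 1) 0 0 ∧ ‖g‖ ≤ C}

/-- A (possibly nonlinear) map is a compact operator on `D` if it is continuous on `D` and maps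
bounded subsets of `D` to relatively compact sets. -/
def IsCompactMapOn {X Y : Type*} [NormedAddCommGroup X] [NormedAddCommGroup Y]
    (F : X → Y) (D : Set X) : Prop :=
  ContinuousOn F D ∧ ∀ S ⊆ D, Bornology.IsBounded S → IsCompact (closure (F '' S))

/-! ### The constants -/

/-- `C₀² = e^T - 1`. -/
def C0sq (T : ℝ) : ℝ := Real.exp T - 1

/-- `C* = 4ℓ²(1 + 4ℓ²) + 1`. -/
def Cstar (ℓ : ℝ) : ℝ := 4 * ℓ ^ 2 * (1 + 4 * ℓ ^ 2) + 1

/-- The auxiliary constant `R₁`. -/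
def R1 (ℓ T r0 r1 kappa0 : ℝ) : ℝ :=
  (4 * r1 ^ 2 * (ℓ ^ 3 + 3) / (3 * r0) + kappa0 * ℓ ^ 3 / (4 * (ℓ ^ 3 + 3)) + r1)
    * ((C0sq T + 1) / kappa0)

/-- The auxiliary constant `R₂`. -/
def R2 (ℓ T r0 r1 kappa0 : ℝ) : ℝ :=
  R1 ℓ T r0 r1 kappa0 * (2 / (3 * r0)) + 2 * (ℓ ^ 3 + 3) / (3 * ℓ ^ 3 * kappa0)

/-- `C₁² = max {R₂, R₃, R₄, κ₁ + 1}` with `R₃ = R₁ ρ₁ + μ₁`, `R₄ = R₁ r₁ + r₁²`. -/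
def C1sq (ℓ T rho1 mu1 r0 r1 kappa0 kappa1 : ℝ) : ℝ :=
  max (max (R2 ℓ T r0 r1 kappa0) (R1 ℓ T r0 r1 kappa0 * rho1 + mu1))
    (max (R1 ℓ T r0 r1 kappa0 * r1 + r1 ^ 2) (kappa1 + 1))

/-- `C₇² = 2ℓ² max {1, (2ℓ/3)(ρ₁² + μ₁²)}`. -/
def C7sq (ℓ rho1 mu1 : ℝ) : ℝ :=
  2 * ℓ ^ 2 * max 1 (2 * ℓ / 3 * (rho1 ^ 2 + mu1 ^ 2))

/-- The Lipschitz constant of `Φ`: `L₀² = 4ℓ⁶(1 + T)C₀² / (9 r₀²)`. -/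
def L0 (ℓ T r0 : ℝ) : ℝ :=
  Real.sqrt (4 * ℓ ^ 6 * (1 + T) * C0sq T / (9 * r0 ^ 2))

/-- The Lipschitz constant of `Ψ`:
`L₁² = C₇² [1 + (C*(C₀² + 1)/(3κ₀r₀) + C₁²/(2ρ₀)) (1 + T) ℓ³]`. -/
def L1 (ℓ T rho0 rho1 mu1 r0 r1 kappa0 kappa1 : ℝ) : ℝ :=
  Real.sqrt (C7sq ℓ rho1 mu1 *
    (1 + (Cstar ℓ * (C0sq T + 1) / (3 * kappa0 * r0)
        + C1sq ℓ T rho1 mu1 r0 r1 kappa0 kappa1 / (2 * rho0)) * (1 + T) * ℓ ^ 3))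

end Beam

end

/-! The map v ↦ v_xx identifies the energy space with L²(0,ℓ): its inverse is twofold integration P
(`potential`), and v(ℓ) = ⟨ℓ - x, v_xx⟩. Testing against every curvature turns the weak formulation
into one equation in L²(0,ℓ) for the acceleration q = u_tt and the curvature w = u_xxt of the
velocity, P*(ρq) + P*(μPw) + κw + r∫w = g·(ℓ - x), coupled by Pw = ∫q (`IsReduced`, `weakForm_eq`).
Every operator in it is bounded, and time enters only through the Volterra operator J = ∫₀ᵗ, which
commutes with the operators in x.

Well-posedness rests on one positivity: ⟨Af, Jf⟩ = ½⟨A∫f, ∫f⟩(T) ≥ 0 for A ≥ 0. Pairing the equation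
with w gives κ₀‖w‖² ≤ 0 when g = 0, hence uniqueness (`IsReduced.eq_zero`). For existence with g =
Jh, put q = Pf and w = Jf. The same positivity yields ‖J*ψ‖ ≤ κ₀⁻¹‖S*ψ‖ for the operator S = M + KJ
+ RJ² to be inverted, so the range of S contains that of J (`exists_apply_eq_of_norm_adjoint_le`,
`exists_evolution`).

Testing with the velocity, with the force integrated by parts in time, and Grönwall bound u_xx and
u_xxt (`energy_le`, `prim_potential_le`); testing with the acceleration bounds u_tt
(`prim_acceleration_le`). The estimate for Φ follows from u(ℓ) = ⟨ℓ - x, u_xx⟩. For Ψ, P* takes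
values in C[0,ℓ], so r u_xx + κ u_xxt = g·(ℓ - x) - P*(ρu_tt + μu_t) can be evaluated at x = 0,
giving Ψg = ∫x(ρu_tt + μu_t)dx - ℓg. That u_xx and u_xxt are separately continuous in x comes from
solving this relation as an ODE in t (`exists_embed_eq_prim`).

Compactness: J sends bounded sets of L²(0,T) to relatively compact ones by Arzelà–Ascoli. One has Φg
= J⟨ℓ - x, u_xxt⟩, and, the coefficients being independent of time, Ψg = JΨ(g'). -/

noncomputable section

set_option linter.unusedSectionVars false

namespace Beam

section

/-! ### Primitives -/

section Prim

variable {E F G : Type*} [NormedAddCommGroup E] [NormedSpace ℝ E]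
  [NormedAddCommGroup F] [NormedSpace ℝ F] [NormedAddCommGroup G] [NormedSpace ℝ G]

/-- The primitive of `f` vanishing at `0`. -/
def prim (f : ℝ → E) (t : ℝ) : E := ∫ s in Ioc 0 t, f s

theorem prim_zero (f : ℝ → E) : prim f 0 = 0 := by simp [prim]

theorem prim_congr {f g : ℝ → E} {T t : ℝ} (h : f =ᵐ[volume.restrict (Ioo 0 T)] g) (ht : t ≤ T) :
    prim f t = prim g t := by
  rw [prim, prim, ← restrict_Ioo_eq_restrict_Ioc]
  exact integral_congr_ae (ae_mono (Measure.restrict_mono (Ioo_subset_Ioo_right ht) le_rfl) h)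

/-- Puts the inner integrals on a fixed domain, as Fubini requires below. -/
theorem prim_eq_integral_indicator {f : ℝ → E} {s t : ℝ} (hs : s ≤ t) :
    prim f s = ∫ r in Ioc 0 t, (Iic s).indicator f r := by
  rw [prim, setIntegral_indicator measurableSet_Iic]
  congr 2
  ext x
  simp only [mem_Ioc, mem_inter_iff, mem_Iic]
  grind

theorem continuousOn_prim {f : ℝ → E} {T : ℝ} (hf : IntegrableOn f (Ioc 0 T)) :
    ContinuousOn (prim f) (Icc 0 T) :=
  intervalIntegral.continuousOn_primitive ((integrableOn_Icc_iff_integrableOn_Ioc (by simp)).2 hf)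

theorem clm_prim [CompleteSpace E] [CompleteSpace F] (L : E →L[ℝ] F) {f : ℝ → E} {t : ℝ}
    (hf : IntegrableOn f (Ioc 0 t)) :
    L (prim f t) = prim (fun s => L (f s)) t :=
  (L.integral_comp_comm hf).symm

variable [CompleteSpace E] [CompleteSpace F] [CompleteSpace G]

theorem integrableOn_bilin_prim_right (B : E →L[ℝ] F →L[ℝ] G) {f : ℝ → E} {g : ℝ → F} {t : ℝ}
    (hf : IntegrableOn f (Ioc 0 t)) (hg : IntegrableOn g (Ioc 0 t)) :
    IntegrableOn (fun s => B (f s) (prim g s)) (Ioc 0 t) := by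
  have hc := continuousOn_prim hg
  obtain ⟨C, hC⟩ := isCompact_Icc.exists_bound_of_continuousOn hc
  refine B.integrable_of_bilin_of_bdd_right C hf
    ((hc.mono Ioc_subset_Icc_self).aestronglyMeasurable measurableSet_Ioc) ?_
  filter_upwards [ae_restrict_mem measurableSet_Ioc] with s hs
  exact hC s (Ioc_subset_Icc_self hs)

theorem integrableOn_bilin_prim_left (B : E →L[ℝ] F →L[ℝ] G) {f : ℝ → E} {g : ℝ → F} {t : ℝ}
    (hf : IntegrableOn f (Ioc 0 t)) (hg : IntegrableOn g (Ioc 0 t)) :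
    IntegrableOn (fun s => B (prim f s) (g s)) (Ioc 0 t) :=
  integrableOn_bilin_prim_right B.flip hg hf

/-- Integration by parts for absolutely continuous functions vanishing at `0`. -/
theorem integral_bilin_prim_add (B : E →L[ℝ] F →L[ℝ] G) {f : ℝ → E} {g : ℝ → F} {t : ℝ}
    (hf : IntegrableOn f (Ioc 0 t)) (hg : IntegrableOn g (Ioc 0 t)) :
    (∫ s in Ioc 0 t, B (f s) (prim g s)) + ∫ s in Ioc 0 t, B (prim f s) (g s)
      = B (prim f t) (prim g t) := by
  set μ := volume.restrict (Ioc 0 t)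
  -- The two terms are the integrals of B (f p₁) (g p₂) over the two closed triangles into which the
  -- diagonal, a null set, cuts the square.
  have hfg : Integrable (fun p : ℝ × ℝ => B (f p.1) (g p.2)) (μ.prod μ) :=
    hf.op_fst_snd (by fun_prop) ⟨‖B‖, B.le_opNorm₂⟩ hg
  have hD : MeasurableSet {p : ℝ × ℝ | p.2 ≤ p.1} := measurableSet_le measurable_snd measurable_fst
  have hD' : MeasurableSet {p : ℝ × ℝ | p.1 ≤ p.2} := measurableSet_le measurable_fst measurable_snd
  have e1 : ∫ s in Ioc 0 t, B (f s) (prim g s)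
      = ∫ p, {p : ℝ × ℝ | p.2 ≤ p.1}.indicator (fun p => B (f p.1) (g p.2)) p ∂(μ.prod μ) := by
    rw [integral_prod _ (hfg.indicator hD)]
    refine setIntegral_congr_fun measurableSet_Ioc fun s hs => ?_
    rw [prim_eq_integral_indicator hs.2, ← (B (f s)).integral_comp_comm
      (hg.indicator measurableSet_Iic)]
    refine integral_congr_ae (.of_forall fun r => ?_)
    by_cases h : r ≤ s <;> simp [indicator, h]
  have e2 : ∫ s in Ioc 0 t, B (prim f s) (g s)
      = ∫ p, {p : ℝ × ℝ | p.1 ≤ p.2}.indicator (fun p => B (f p.1) (g p.2)) p ∂(μ.prod μ) := by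
    rw [integral_prod_symm _ (hfg.indicator hD')]
    refine setIntegral_congr_fun measurableSet_Ioc fun s hs => ?_
    rw [prim_eq_integral_indicator hs.2, ← B.flip_apply, ← (B.flip (g s)).integral_comp_comm
      (hf.indicator measurableSet_Iic)]
    refine integral_congr_ae (.of_forall fun r => ?_)
    by_cases h : r ≤ s <;> simp [indicator, h]
  have e3 : B (prim f t) (prim g t) = ∫ p, B (f p.1) (g p.2) ∂(μ.prod μ) :=
    (integral_prod_bilin B hf hg).symm
  rw [e1, e2, e3, ← integral_add (hfg.indicator hD) (hfg.indicator hD')]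
  refine integral_congr_ae ?_
  have hae : ∀ᵐ p ∂(μ.prod μ), p.1 ≠ p.2 := by
    refine (Measure.ae_prod_mem_iff_ae_ae_mem
      (measurableSet_eq_fun measurable_fst measurable_snd).compl).2 (.of_forall fun s => ?_)
    have : ∀ᵐ r ∂μ, r ≠ s := Measure.ae_ne μ s
    filter_upwards [this] with r hr
    exact fun h => hr h.symm
  filter_upwards [hae] with p hp
  rcases lt_or_gt_of_ne hp with h | h
  · simp [indicator, h.le, not_le.2 h]
  · simp [indicator, h.le, not_le.2 h]

end Prim

/-! ### The Volterra operator on `L²(0, T; E)` -/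

section Volterra

variable {T : ℝ} {E F : Type*} [NormedAddCommGroup E] [NormedSpace ℝ E]
  [NormedAddCommGroup F] [NormedSpace ℝ F]

theorem L2t.integrableOn (f : L2t T E) : IntegrableOn (f : ℝ → E) (Ioc 0 T) := by
  rw [IntegrableOn, ← restrict_Ioo_eq_restrict_Ioc]
  exact (Lp.memLp f).integrable (by norm_num)

theorem L2t.integrableOn_of_le (f : L2t T E) {t : ℝ} (ht : t ≤ T) :
    IntegrableOn (f : ℝ → E) (Ioc 0 t) :=
  (L2t.integrableOn f).mono_set (Ioc_subset_Ioc_right ht)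

/-- Cauchy–Schwarz on (s, t). The factor √(t - s) later provides the equicontinuity for
Arzelà–Ascoli. -/
theorem L2t.norm_setIntegral_le (f : L2t T E) {s t : ℝ} (hs : 0 ≤ s) (hst : s ≤ t) (ht : t ≤ T) :
    ‖∫ r in Ioc s t, f r‖ ≤ √(t - s) * ‖f‖ := by
  have hsub : volume.restrict (Ioo s t) ≤ volume.restrict (Ioo 0 T) :=
    Measure.restrict_mono (Ioo_subset_Ioo hs ht) le_rfl
  have hm : MemLp (f : ℝ → E) 2 (volume.restrict (Ioo s t)) := (Lp.memLp f).mono_measure hsub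
  rw [← restrict_Ioo_eq_restrict_Ioc]
  have h1 : (‖∫ r in Ioo s t, f r‖ₑ) ≤ eLpNorm f 1 (volume.restrict (Ioo s t)) := by
    rw [eLpNorm_one_eq_lintegral_enorm]
    exact enorm_integral_le_lintegral_enorm _
  have h2 := eLpNorm_le_eLpNorm_mul_rpow_measure_univ (p := 1) (q := 2) (by norm_num) hm.1
  have h3 : eLpNorm f 2 (volume.restrict (Ioo s t)) ≤ eLpNorm f 2 (volume.restrict (Ioo 0 T)) :=
    eLpNorm_mono_measure _ hsub
  have h4 : (‖∫ r in Ioo s t, f r‖ₑ) ≤ eLpNorm f 2 (volume.restrict (Ioo 0 T)) *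
      volume.restrict (Ioo s t) Set.univ ^ (1 / (1 : ℝ≥0∞).toReal - 1 / (2 : ℝ≥0∞).toReal) :=
    h1.trans (h2.trans (by gcongr))
  have h5 := ENNReal.toReal_mono (ENNReal.mul_ne_top (Lp.eLpNorm_ne_top f)
    (ENNReal.rpow_ne_top_of_nonneg (by norm_num) (measure_ne_top _ _))) h4
  rw [toReal_enorm, ENNReal.toReal_mul, ← ENNReal.toReal_rpow] at h5
  rw [mul_comm, Lp.norm_def, Real.sqrt_eq_rpow]
  refine h5.trans_eq ?_
  simp only [MeasurableSet.univ, Measure.restrict_apply, univ_inter, Real.volume_Ioo,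
    ENNReal.toReal_ofReal (sub_nonneg.2 hst)]
  norm_num

theorem L2t.norm_prim_sub_le (f : L2t T E) {s t : ℝ} (hs : 0 ≤ s) (hst : s ≤ t) (ht : t ≤ T) :
    ‖prim f t - prim f s‖ ≤ √(t - s) * ‖f‖ := by
  have : prim f t - prim f s = ∫ r in Ioc s t, f r := by
    have h := L2t.integrableOn_of_le f ht
    rw [prim, prim, sub_eq_iff_eq_add', ← setIntegral_union (Ioc_disjoint_Ioc_of_le le_rfl)
      measurableSet_Ioc (h.mono_set (Ioc_subset_Ioc_right hst)) (h.mono_set (Ioc_subset_Ioc_left hs)),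
      Ioc_union_Ioc_eq_Ioc hs hst]
  rw [this]
  exact L2t.norm_setIntegral_le f hs hst ht

theorem L2t.norm_prim_le (f : L2t T E) {t : ℝ} (h0 : 0 ≤ t) (ht : t ≤ T) :
    ‖prim f t‖ ≤ √T * ‖f‖ := by
  have h := L2t.norm_prim_sub_le f le_rfl h0 ht
  rw [prim_zero, sub_zero, sub_zero] at h
  exact h.trans (by gcongr)

/-- Extension of a function on `[0, T]` by zero. -/
def extend (f : C(Icc (0 : ℝ) T, E)) (t : ℝ) : E := if h : t ∈ Icc 0 T then f ⟨t, h⟩ else 0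

theorem extend_apply (f : C(Icc (0 : ℝ) T, E)) {t : ℝ} (ht : t ∈ Icc 0 T) :
    extend f t = f ⟨t, ht⟩ := dif_pos ht

theorem continuousOn_extend (f : C(Icc (0 : ℝ) T, E)) : ContinuousOn (extend f) (Icc 0 T) := by
  rw [continuousOn_iff_continuous_domRestrict]
  convert f.continuous using 1
  ext t
  exact extend_apply f t.2

theorem norm_extend_le (f : C(Icc (0 : ℝ) T, E)) (t : ℝ) : ‖extend f t‖ ≤ ‖f‖ := by
  rw [extend]
  split_ifs with h
  · exact f.norm_coe_le_norm _
  · simp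

theorem memLp_extend (f : C(Icc (0 : ℝ) T, E)) (p : ℝ≥0∞) :
    MemLp (extend f) p (volume.restrict (Ioo 0 T)) :=
  MemLp.of_bound (((continuousOn_extend f).mono Ioo_subset_Icc_self).aestronglyMeasurable
    measurableSet_Ioo) ‖f‖ (.of_forall (norm_extend_le f))

variable (T E) in
/-- The embedding of `C([0, T]; E)` in `L²(0, T; E)`. -/
def embed : C(Icc (0 : ℝ) T, E) →L[ℝ] L2t T E :=
  LinearMap.mkContinuous
    { toFun := fun f => (memLp_extend f 2).toLp
      map_add' := fun f g => by
        rw [← MemLp.toLp_add]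
        refine MemLp.toLp_congr _ _ (.of_forall fun t => ?_)
        by_cases h : t ∈ Icc 0 T <;> simp [extend, h]
      map_smul' := fun c f => by
        rw [RingHom.id_apply, ← MemLp.toLp_const_smul]
        refine MemLp.toLp_congr _ _ (.of_forall fun t => ?_)
        by_cases h : t ∈ Icc 0 T <;> simp [extend, h] }
    (√T) fun f => by
      refine (Lp.norm_le_of_ae_bound (norm_nonneg f) (C := ‖f‖) ?_).trans_eq ?_
      · filter_upwards [(memLp_extend f 2).coeFn_toLp] with t ht
        simp only [LinearMap.coe_mk, AddHom.coe_mk]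
        rw [ht]
        exact norm_extend_le f t
      · simp [measureUnivNNReal, Real.sqrt_eq_rpow]
        rcases le_or_gt 0 T with hT | hT
        · exact Or.inl (by rw [ENNReal.coe_toNNReal_eq_toReal, ENNReal.toReal_ofReal hT])
        -- For T < 0 the interval is empty, so f itself is zero.
        · right
          ext t
          exact absurd (t.2.1.trans t.2.2) hT.not_ge

theorem coeFn_embed (f : C(Icc (0 : ℝ) T, E)) :
    embed T E f =ᵐ[volume.restrict (Ioo 0 T)] extend f :=
  (memLp_extend f 2).coeFn_toLp

theorem norm_embed_le : ‖embed T E‖ ≤ √T := LinearMap.mkContinuous_norm_le _ (Real.sqrt_nonneg _) _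

theorem hasTrace_embed (f : C(Icc (0 : ℝ) T, E)) {t : ℝ} (ht : t ∈ Icc 0 T) :
    HasTrace 0 T (embed T E f : ℝ → E) t (f ⟨t, ht⟩) :=
  ⟨extend f, continuousOn_extend f, (coeFn_embed f).symm, extend_apply f ht⟩

/-- The primitive vanishing at `0` of `f ∈ L²(0, T; E)` as a continuous function. -/
def volterraFun (f : L2t T E) : C(Icc (0 : ℝ) T, E) where
  toFun t := prim f t
  continuous_toFun :=
    continuousOn_iff_continuous_domRestrict.1 (continuousOn_prim (L2t.integrableOn f))

theorem volterraFun_apply (f : L2t T E) (t : Icc (0 : ℝ) T) : volterraFun f t = prim f t := rfl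

variable (T E) in
/-- The Volterra operator `f ↦ ∫₀ᵗ f` from `L²(0, T; E)` to `C([0, T]; E)`. -/
def volterraC : L2t T E →L[ℝ] C(Icc (0 : ℝ) T, E) :=
  LinearMap.mkContinuous
    { toFun := volterraFun
      map_add' := fun f g => by
        ext t
        rw [ContinuousMap.add_apply, volterraFun_apply, volterraFun_apply, volterraFun_apply, prim_congr (Lp.coeFn_add f g) t.2.2]
        exact integral_add (L2t.integrableOn_of_le f t.2.2) (L2t.integrableOn_of_le g t.2.2)
      map_smul' := fun c f => by
        ext t
        rw [ContinuousMap.smul_apply, RingHom.id_apply, volterraFun_apply, volterraFun_apply, prim_congr (Lp.coeFn_smul c f) t.2.2]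
        exact integral_smul c _ }
    (√T) fun f => by
      rw [ContinuousMap.norm_le _ (by positivity)]
      exact fun t => L2t.norm_prim_le f t.2.1 t.2.2

theorem volterraC_apply (f : L2t T E) (t : Icc (0 : ℝ) T) : volterraC T E f t = prim f t := rfl

theorem norm_volterraC_le : ‖volterraC T E‖ ≤ √T :=
  LinearMap.mkContinuous_norm_le _ (Real.sqrt_nonneg _) _

variable (T E) in
/-- The Volterra operator on `L²(0, T; E)`. -/
def volterra : L2t T E →L[ℝ] L2t T E := embed T E ∘L volterraC T E

theorem coeFn_volterra (f : L2t T E) :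
    volterra T E f =ᵐ[volume.restrict (Ioo 0 T)] prim f := by
  filter_upwards [coeFn_embed (volterraC T E f), ae_restrict_mem measurableSet_Ioo] with t ht hm
  rw [volterra, ContinuousLinearMap.comp_apply, ht, extend_apply _ (Ioo_subset_Icc_self hm)]
  rfl

theorem norm_volterra_le (hT : 0 ≤ T) : ‖volterra T E‖ ≤ T := by
  refine (ContinuousLinearMap.opNorm_comp_le _ _).trans ?_
  calc _ ≤ √T * √T := mul_le_mul norm_embed_le norm_volterraC_le (ContinuousLinearMap.opNorm_nonneg _) (by positivity)
    _ = T := Real.mul_self_sqrt hT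

/-- A bounded operator passes through the Bochner integral. This commutation is what lets J be moved
freely in the abstract solvability argument. -/
theorem volterra_compLp [CompleteSpace E] [CompleteSpace F] (L : E →L[ℝ] F) (f : L2t T E) :
    volterra T F (L.compLp f) = L.compLp (volterra T E f) := by
  apply Lp.ext
  filter_upwards [coeFn_volterra (L.compLp f), L.coeFn_compLp (volterra T E f), coeFn_volterra f,
    ae_restrict_mem measurableSet_Ioo] with t h1 h2 h3 ht
  rw [h1, h2, h3, clm_prim L (L2t.integrableOn_of_le f ht.2.le), prim_congr (L.coeFn_compLp f) ht.2.le]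

end Volterra

end

section

/-! ### Weak derivatives -/

section WeakDeriv

variable {T : ℝ} {E F : Type*} [NormedAddCommGroup E] [NormedSpace ℝ E]
  [NormedAddCommGroup F] [NormedSpace ℝ F]

theorem HasWeakDeriv.congr {a b : ℝ} {f f' g g' : ℝ → E} (h : HasWeakDeriv a b f f')
    (hf : f =ᵐ[volume.restrict (Ioo a b)] g) (hf' : f' =ᵐ[volume.restrict (Ioo a b)] g') :
    HasWeakDeriv a b g g' := by
  intro φ h1 h2 h3
  rw [← integral_congr_ae (hf.mono fun s hs => by simp only [hs] :
      (fun s => deriv φ s • f s) =ᵐ[_] fun s => deriv φ s • g s),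
    ← integral_congr_ae (hf'.mono fun s hs => by simp only [hs] :
      (fun s => φ s • f' s) =ᵐ[_] fun s => φ s • g' s)]
  exact h φ h1 h2 h3

theorem integrable_smul_of_contDiff {a b : ℝ} {f : ℝ → E} (hf : IntegrableOn f (Ioo a b))
    {φ : ℝ → ℝ} (hφ : Continuous φ) (hc : HasCompactSupport φ) :
    IntegrableOn (fun s => φ s • f s) (Ioo a b) := by
  obtain ⟨C, hC⟩ := hc.exists_bound_of_continuous hφ
  exact Integrable.bdd_smul hf C hφ.aestronglyMeasurable (Eventually.of_forall hC)

theorem HasWeakDeriv.sub {a b : ℝ} {f f' g g' : ℝ → E} (h : HasWeakDeriv a b f f')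
    (k : HasWeakDeriv a b g g') (hf : IntegrableOn f (Ioo a b)) (hf' : IntegrableOn f' (Ioo a b))
    (hg : IntegrableOn g (Ioo a b)) (hg' : IntegrableOn g' (Ioo a b)) :
    HasWeakDeriv a b (f - g) (f' - g') := by
  intro φ h1 h2 h3
  have hd : Continuous (deriv φ) := h1.continuous_deriv (by simp)
  simp only [Pi.sub_apply, smul_sub]
  rw [integral_sub (integrable_smul_of_contDiff hf hd h2.deriv)
    (integrable_smul_of_contDiff hg hd h2.deriv),
    integral_sub (integrable_smul_of_contDiff hf' h1.continuous h2)
    (integrable_smul_of_contDiff hg' h1.continuous h2), h φ h1 h2 h3, k φ h1 h2 h3]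
  abel

theorem prim_deriv {φ : ℝ → ℝ} (hφ : ContDiff ℝ ∞ φ) {t : ℝ} (ht : 0 ≤ t) :
    prim (deriv φ) t = φ t - φ 0 := by
  rw [prim, ← intervalIntegral.integral_of_le ht]
  exact intervalIntegral.integral_deriv_eq_sub
    (fun x _ => (hφ.differentiable (by simp)).differentiableAt)
    ((hφ.continuous_deriv (by simp)).intervalIntegrable _ _)

theorem hasWeakDeriv_prim [CompleteSpace E] (hT : 0 ≤ T) {f : ℝ → E}
    (hf : IntegrableOn f (Ioc 0 T)) : HasWeakDeriv 0 T (prim f) f := by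
  intro φ h1 h2 h3
  have hz : ∀ x ∉ Ioo 0 T, φ x = 0 := fun x hx => image_eq_zero_of_notMem_tsupport fun h => hx (h3 h)
  have h0 : φ 0 = 0 := hz 0 (by simp)
  have hφT : φ T = 0 := hz T (by simp)
  have key := integral_bilin_prim_add (ContinuousLinearMap.lsmul ℝ ℝ)
    ((h1.continuous_deriv (by simp)).integrableOn_Ioc (a := 0) (b := T)) hf
  rw [prim_deriv h1 hT, h0, hφT] at key
  simp only [ContinuousLinearMap.lsmul_apply, sub_zero, zero_smul] at key
  rw [← integral_Ioc_eq_integral_Ioo, ← integral_Ioc_eq_integral_Ioo, eq_neg_of_add_eq_zero_left key]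
  congr 1
  refine setIntegral_congr_fun measurableSet_Ioc fun s hs => ?_
  rw [prim_deriv h1 hs.1.le, h0, sub_zero]

/-- A function with zero weak derivative is constant. -/
theorem HasWeakDeriv.ae_eq_const [CompleteSpace E] (hT : 0 < T) {f : ℝ → E}
    (hf : IntegrableOn f (Ioo 0 T)) (h : HasWeakDeriv 0 T f 0) :
    ∃ c : E, f =ᵐ[volume.restrict (Ioo 0 T)] fun _ => c := by
  -- Du Bois-Reymond: the constant is the mean of f against a bump η of mass one. Any test function
  -- θ is corrected to ψ = θ - (∫θ)η, whose primitive is again a test function.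
  let bump : ContDiffBump (T / 2) := ⟨T / 8, T / 4, by positivity, by linarith⟩
  set η := bump.normed volume with hη
  have ηc : ContDiff ℝ ∞ η := bump.contDiff_normed
  have ηs : HasCompactSupport η := bump.hasCompactSupport_normed
  have ηt : tsupport η ⊆ Ioo 0 T := by
    rw [hη, bump.tsupport_normed_eq, Real.closedBall_eq_Icc]
    intro x hx
    simp only [bump, mem_Icc, mem_Ioo] at hx ⊢
    constructor <;> linarith [hx.1, hx.2]
  have ηi : ∫ x, η x = 1 := bump.integral_normed
  refine ⟨∫ s in Ioo 0 T, η s • f s, ?_⟩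
  set c := ∫ s in Ioo 0 T, η s • f s
  have hloc : LocallyIntegrableOn (fun s => f s - c) (Ioo 0 T) (volume.restrict (Ioo 0 T)) := by
    have : Integrable (fun s => f s - c) (volume.restrict (Ioo 0 T)) :=
      hf.sub (integrable_const c)
    exact this.locallyIntegrable.locallyIntegrableOn _
  have main := isOpen_Ioo.ae_eq_zero_of_integral_contDiff_smul_eq_zero hloc ?_
  · filter_upwards [main, ae_restrict_mem measurableSet_Ioo] with t h1 h2
    exact sub_eq_zero.1 (h1 h2)
  intro θ θc θs θt
  set ψ : ℝ → ℝ := fun s => θ s - (∫ x, θ x) * η s with hψ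
  have ψc : ContDiff ℝ ∞ ψ := θc.sub (contDiff_const.mul ηc)
  have hK : IsCompact (tsupport θ ∪ tsupport η) := θs.isCompact.union ηs.isCompact
  have hKne : (tsupport θ ∪ tsupport η).Nonempty := by
    refine Nonempty.inr ?_
    rw [hη, bump.tsupport_normed_eq]
    exact ⟨T / 2, by simp [bump]; positivity⟩
  obtain ⟨a, haK, ha⟩ := hK.exists_isLeast hKne
  obtain ⟨b, hbK, hb⟩ := hK.exists_isGreatest hKne
  have hKsub : tsupport θ ∪ tsupport η ⊆ Ioo 0 T := union_subset θt ηt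
  have ψz : ∀ x, x ∉ Icc a b → ψ x = 0 := by
    intro x hx
    have h1 : x ∉ tsupport θ := fun h => hx ⟨ha (Or.inl h), hb (Or.inl h)⟩
    have h2 : x ∉ tsupport η := fun h => hx ⟨ha (Or.inr h), hb (Or.inr h)⟩
    simp [hψ, image_eq_zero_of_notMem_tsupport h1, image_eq_zero_of_notMem_tsupport h2]
  have θint : Integrable θ := θc.continuous.integrable_of_hasCompactSupport θs
  have ηint : Integrable η := ηc.continuous.integrable_of_hasCompactSupport ηs
  have ψint : ∫ x, ψ x = 0 := by
    rw [hψ, integral_sub θint (ηint.const_mul _), integral_const_mul, ηi, mul_one, sub_self]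
  set φ : ℝ → ℝ := fun t => ∫ s in a..t, ψ s with hφ
  have φd : ∀ t, HasDerivAt φ (ψ t) t := fun t =>
    ψc.continuous.integral_hasStrictDerivAt a t |>.hasDerivAt
  have φd' : deriv φ = ψ := funext fun t => (φd t).deriv
  have φc : ContDiff ℝ ∞ φ := contDiff_infty_iff_deriv.2 ⟨fun t => (φd t).differentiableAt, φd' ▸ ψc⟩
  have φz : ∀ x, x ∉ Icc a b → φ x = 0 := by
    intro x hx
    -- Left of a the integrand vanishes; right of b the primitive equals ∫ψ = 0.
    rcases lt_or_ge x a with hxa | hxa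
    · refine intervalIntegral.integral_zero_ae (Measure.ae_ne volume a |>.mono fun s hs hsx => ψz s ?_)
      rw [uIoc_of_ge hxa.le] at hsx
      exact fun h => hs (le_antisymm hsx.2 h.1)
    · have hbx : b < x := not_le.1 fun h => hx ⟨hxa, h⟩
      rw [hφ]
      simp only
      rw [intervalIntegral.integral_of_le hxa, ← integral_Icc_eq_integral_Ioc, ← ψint]
      refine setIntegral_eq_integral_of_forall_compl_eq_zero fun s hs => ψz s fun h => hs ?_
      exact ⟨h.1, h.2.trans hbx.le⟩
  have φt : tsupport φ ⊆ Icc a b := closure_minimal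
    (fun x hx => by_contra fun h => hx (φz x h)) isClosed_Icc
  have φs : HasCompactSupport φ := isCompact_Icc.of_isClosed_subset (isClosed_tsupport _) φt
  have hfin := h φ φc φs (φt.trans (Icc_subset_Ioo (hKsub haK).1 (hKsub hbK).2))
  rw [φd'] at hfin
  simp only [Pi.zero_apply, smul_zero, integral_zero, neg_zero] at hfin
  have h1 := integrable_smul_of_contDiff hf θc.continuous θs
  have h2 := integrable_smul_of_contDiff hf ηc.continuous ηs
  have e1 : ∫ s in Ioo 0 T, ψ s • f s = (∫ s in Ioo 0 T, θ s • f s) - (∫ x, θ x) • c := by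
    rw [← integral_smul]
    refine Eq.trans ?_ (integral_sub h1 (h2.smul (∫ x, θ x)))
    exact integral_congr_ae (.of_forall fun s => by simp only [hψ, sub_smul, mul_smul])
  have e2 : ∫ x, θ x = ∫ s in Ioo 0 T, θ s :=
    (setIntegral_eq_integral_of_forall_compl_eq_zero fun s hs =>
      image_eq_zero_of_notMem_tsupport fun h => hs (θt h)).symm
  simp only [smul_sub]
  rw [integral_sub h1 (θint.integrableOn.smul_const c), integral_smul_const, ← e2, ← e1, hfin]

theorem integrableOn_prim {f : ℝ → E} (hf : IntegrableOn f (Ioc 0 T)) :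
    IntegrableOn (prim f) (Ioo 0 T) :=
  ((continuousOn_prim hf).integrableOn_Icc).mono_set Ioo_subset_Icc_self

theorem HasWeakDeriv.ae_eq_const_add_prim [CompleteSpace E] (hT : 0 < T) {f f' : ℝ → E}
    (hf : IntegrableOn f (Ioo 0 T)) (hf' : IntegrableOn f' (Ioc 0 T)) (h : HasWeakDeriv 0 T f f') :
    ∃ c : E, f =ᵐ[volume.restrict (Ioo 0 T)] fun t => c + prim f' t := by
  have h0 := h.sub (hasWeakDeriv_prim hT.le hf') hf (hf'.mono_set Ioo_subset_Ioc_self)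
    (integrableOn_prim hf') (hf'.mono_set Ioo_subset_Ioc_self)
  rw [sub_self] at h0
  obtain ⟨c, hc⟩ := h0.ae_eq_const hT (hf.sub (integrableOn_prim hf'))
  refine ⟨c, hc.mono fun t ht => ?_⟩
  exact sub_eq_iff_eq_add.1 ht

theorem HasWeakDeriv.ae_eq_prim [CompleteSpace E] (hT : 0 < T) {f f' : ℝ → E}
    (hf : IntegrableOn f (Ioo 0 T)) (hf' : IntegrableOn f' (Ioc 0 T)) (h : HasWeakDeriv 0 T f f')
    (h0 : HasTrace 0 T f 0 0) : f =ᵐ[volume.restrict (Ioo 0 T)] prim f' := by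
  obtain ⟨c, hc⟩ := h.ae_eq_const_add_prim hT hf hf'
  have : HasTrace 0 T f 0 c := ⟨_, continuousOn_const.add (continuousOn_prim hf'), hc.symm,
    by simp [prim_zero]⟩
  obtain rfl := this.unique hT (left_mem_Icc.2 hT.le) h0
  simpa using hc

/-- A constant plus a primitive is continuous up to the endpoints. This supplies the continuous
representatives of r and κ. -/
theorem HasWeakDeriv.exists_embed_eq [CompleteSpace E] (hT : 0 < T) {f f' : L2t T E}
    (h : HasWeakDeriv 0 T f f') : ∃ F : C(Icc (0 : ℝ) T, E), embed T E F = f := by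
  obtain ⟨c, hc⟩ := h.ae_eq_const_add_prim hT
    ((L2t.integrableOn f).mono_set Ioo_subset_Ioc_self) (L2t.integrableOn f')
  refine ⟨ContinuousMap.const _ c + volterraC T E f', Lp.ext ?_⟩
  filter_upwards [hc, coeFn_embed (ContinuousMap.const _ c + volterraC T E f'),
    ae_restrict_mem measurableSet_Ioo] with t h1 h2 ht
  rw [h1, h2, extend_apply _ (Ioo_subset_Icc_self ht)]
  rfl

theorem HasWeakDeriv.eq_volterra [CompleteSpace E] (hT : 0 < T) {f f' : L2t T E}
    (h : HasWeakDeriv 0 T f f') (h0 : HasTrace 0 T f 0 0) : f = volterra T E f' := by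
  apply Lp.ext
  exact (h.ae_eq_prim hT ((L2t.integrableOn f).mono_set Ioo_subset_Ioc_self)
    (L2t.integrableOn f') h0).trans (coeFn_volterra f').symm

theorem hasWeakDeriv_volterra [CompleteSpace E] (hT : 0 ≤ T) (f : L2t T E) :
    HasWeakDeriv 0 T (volterra T E f) f :=
  (hasWeakDeriv_prim hT (L2t.integrableOn f)).congr (coeFn_volterra f).symm (ae_eq_refl _)

theorem hasTrace_volterra (hT : 0 ≤ T) (f : L2t T E) : HasTrace 0 T (volterra T E f) 0 0 := by
  have := hasTrace_embed (volterraC T E f) (left_mem_Icc.2 hT)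
  rwa [volterraC_apply, prim_zero] at this

/-- Since f is the weak derivative of Jf, Jf = 0 makes f vanish against all test functions. -/
theorem volterra_injective [CompleteSpace E] (hT : 0 ≤ T) :
    Function.Injective (volterra T E) := by
  refine (injective_iff_map_eq_zero _).2 fun f hf => ?_
  have h := hasWeakDeriv_volterra hT f
  rw [hf] at h
  apply Lp.ext
  have h0 : ∀ᵐ t ∂(volume.restrict (Ioo 0 T)), t ∈ Ioo 0 T → f t = 0 := by
    refine isOpen_Ioo.ae_eq_zero_of_integral_contDiff_smul_eq_zero
      (((Lp.memLp f).integrable (by norm_num)).locallyIntegrable.locallyIntegrableOn _)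
      fun φ h1 h2 h3 => ?_
    rw [← neg_eq_zero, ← h φ h1 h2 h3]
    refine integral_eq_zero_of_ae ?_
    filter_upwards [Lp.coeFn_zero E 2 (volume.restrict (Ioo 0 T))] with t ht
    rw [ht, Pi.zero_apply, smul_zero]
  filter_upwards [h0, ae_restrict_mem measurableSet_Ioo,
    Lp.coeFn_zero E 2 (volume.restrict (Ioo 0 T))] with t h1 h2 h3
  rw [h1 h2, h3, Pi.zero_apply]

end WeakDeriv

theorem HasTrace.congr {E : Type*} [NormedAddCommGroup E] {a b x : ℝ} {f g : ℝ → E} {e : E} (h : HasTrace a b f x e)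
    (hfg : f =ᵐ[volume.restrict (Ioo a b)] g) : HasTrace a b g x e := by
  obtain ⟨G, h1, h2, h3⟩ := h
  exact ⟨G, h1, h2.trans hfg, h3⟩

end

section

/-! ### A range inclusion criterion -/

section Range

variable {X : Type*} [NormedAddCommGroup X] [InnerProductSpace ℝ X] [CompleteSpace X]

open ContinuousLinearMap in
/-- If `‖J† ψ‖ ≤ c ‖S† ψ‖` for all `ψ`, then the range of `J` is contained in that of `S`. -/
theorem exists_apply_eq_of_norm_adjoint_le (S J : X →L[ℝ] X) (c : ℝ)
    (h : ∀ ψ, ‖adjoint J ψ‖ ≤ c * ‖adjoint S ψ‖) (x : X) : ∃ f, S f = J x := by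
  set A : X →ₗ[ℝ] LinearMap.range (adjoint S : X →ₗ[ℝ] X) := (adjoint S : X →ₗ[ℝ] X).rangeRestrict
  -- σ is a merely linear section of S* over its range; the norm hypothesis makes the functional
  -- built from it bounded.
  obtain ⟨σ, hσ⟩ := A.exists_rightInverse_of_surjective
    (LinearMap.range_eq_top.2 (LinearMap.surjective_rangeRestrict _))
  have hσ' : ∀ p : LinearMap.range (adjoint S : X →ₗ[ℝ] X), adjoint S (σ p) = p := fun p =>
    congrArg Subtype.val (LinearMap.congr_fun hσ p)
  let l : LinearMap.range (adjoint S : X →ₗ[ℝ] X) →ₗ[ℝ] ℝ :=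
    (innerSL ℝ x : X →L[ℝ] ℝ).toLinearMap ∘ₗ (adjoint J : X →ₗ[ℝ] X) ∘ₗ σ
  have hl : ∀ p, ‖l p‖ ≤ (‖x‖ * c) * ‖p‖ := fun p => by
    calc ‖l p‖ = ‖inner ℝ x (adjoint J (σ p))‖ := rfl
      _ ≤ ‖x‖ * ‖adjoint J (σ p)‖ := norm_inner_le_norm _ _
      _ ≤ ‖x‖ * (c * ‖adjoint S (σ p)‖) := by gcongr; exact h _
      _ = (‖x‖ * c) * ‖p‖ := by rw [hσ', mul_assoc]; rfl
  obtain ⟨g, hg, -⟩ := exists_extension_norm_eq _ (l.mkContinuous _ hl)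
  -- The choice of σ is immaterial: two preimages under S* differ by an element of ker S*, where the
  -- hypothesis forces J* to vanish. Riesz then represents the extended functional by the required
  -- f.
  have key : ∀ ψ, g (adjoint S ψ) = inner ℝ x (adjoint J ψ) := by
    intro ψ
    have h1 : g (adjoint S ψ) = l (A ψ) := hg (A ψ)
    have h2 : adjoint J (σ (A ψ)) = adjoint J ψ := by
      rw [← sub_eq_zero, ← map_sub, ← norm_le_zero_iff]
      refine (h _).trans_eq ?_
      rw [map_sub, hσ']
      simp [A]
    rw [h1, ← h2]
    rfl
  refine ⟨(InnerProductSpace.toDual ℝ X).symm g, ext_inner_right ℝ fun ψ => ?_⟩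
  rw [← adjoint_inner_right, InnerProductSpace.toDual_symm_apply, key, adjoint_inner_right]

end Range

/-! ### Positivity of time-integrated forms and abstract solvability -/

section Hilbert

variable {T : ℝ} {H : Type*} [NormedAddCommGroup H] [InnerProductSpace ℝ H]

theorem L2t.inner_eq (f g : L2t T H) :
    inner ℝ f g = prim (fun s => inner ℝ (f s) (g s)) T := by
  rw [L2.inner_def, prim, integral_Ioc_eq_integral_Ioo]

theorem L2t.norm_sq_eq (f : L2t T H) : ‖f‖ ^ 2 = prim (fun s => ‖f s‖ ^ 2) T := by
  rw [← real_inner_self_eq_norm_sq, L2t.inner_eq]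
  simp only [real_inner_self_eq_norm_sq]

/-- The bilinear form `(x, y) ↦ ⟪A x, y⟫`. -/
def form (A : H →L[ℝ] H) : H →L[ℝ] H →L[ℝ] ℝ := (innerSL ℝ : H →L[ℝ] H →L[ℝ] ℝ) ∘L A

theorem form_apply (A : H →L[ℝ] H) (x y : H) : form A x y = inner ℝ (A x) y := rfl

variable [CompleteSpace H]

/-- For symmetric A, ⟨A F', F⟩ is half the derivative of ⟨A F, F⟩. -/
theorem prim_form_self {A : H →L[ℝ] H} (hA : A.IsSymmetric) {f : ℝ → H} {t : ℝ}
    (hf : IntegrableOn f (Ioc 0 t)) :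
    prim (fun s => inner ℝ (A (f s)) (prim f s)) t
      = inner ℝ (A (prim f t)) (prim f t) / 2 := by
  have h := integral_bilin_prim_add (form A) hf hf
  simp only [form_apply] at h
  have h2 : ∀ s, inner ℝ (A (prim f s)) (f s) = inner ℝ (A (f s)) (prim f s) := fun s => by
    rw [real_inner_comm]
    exact (hA _ _).symm
  simp only [h2] at h
  rw [prim]
  linarith

/-- The pairing equals ½⟨A F(T), F(T)⟩ with F the primitive of f. This gives the inertia and elastic
terms their sign. -/
theorem inner_compLp_volterra_nonneg {A : H →L[ℝ] H} (hA : A.IsPositive) (f : L2t T H) :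
    0 ≤ inner ℝ (A.compLp f) (volterra T H f) := by
  have h : inner ℝ (A.compLp f) (volterra T H f)
      = prim (fun s => inner ℝ (A (f s)) (prim f s)) T := by
    rw [L2t.inner_eq]
    refine prim_congr ?_ le_rfl
    filter_upwards [A.coeFn_compLp f, coeFn_volterra f] with t h1 h2
    rw [h1, h2]
  rw [h, prim_form_self hA.isSymmetric (L2t.integrableOn f)]
  have := hA.inner_nonneg_left (prim f T)
  positivity

theorem inner_volterra_compLp_nonneg {A : H →L[ℝ] H} (hA : A.IsPositive) (f : L2t T H) :
    0 ≤ inner ℝ (A.compLp (volterra T H f)) f := by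
  have h : inner ℝ (A.compLp (volterra T H f)) f
      = inner ℝ (A.compLp f) (volterra T H f) := by
    rw [L2.inner_def, L2.inner_def]
    refine integral_congr_ae ?_
    filter_upwards [A.coeFn_compLp f, A.coeFn_compLp (volterra T H f)] with t h1 h2
    rw [h1, h2]
    exact (hA.isSymmetric _ _).trans (real_inner_comm _ _)
  rw [h]
  exact inner_compLp_volterra_nonneg hA f

theorem inner_compLp_self_ge {A : H →L[ℝ] H} {c : ℝ} (hA : ∀ x, c * ‖x‖ ^ 2 ≤ inner ℝ (A x) x)
    (f : L2t T H) : c * ‖f‖ ^ 2 ≤ inner ℝ (A.compLp f) f := by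
  rw [← real_inner_self_eq_norm_sq, L2.inner_def, L2.inner_def, ← integral_const_mul]
  refine integral_mono_ae ((L2.integrable_inner f f).const_mul c) (L2.integrable_inner _ _) ?_
  filter_upwards [A.coeFn_compLp f] with t h1
  rw [h1, real_inner_self_eq_norm_sq]
  exact hA _

theorem inner_compLp_right {A : H →L[ℝ] H} (hA : A.IsSymmetric) (f g : L2t T H) :
    inner ℝ (A.compLp f) g = inner ℝ f (A.compLp g) := by
  rw [L2.inner_def, L2.inner_def]
  refine integral_congr_ae ?_
  filter_upwards [A.coeFn_compLp f, A.coeFn_compLp g] with t h1 h2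
  rw [h1, h2]
  exact hA _ _

/-- Solvability of the time-integrated second order evolution equation
`M w' + K w + R ∫ w = ∫ h`, with `w = ∫ f`. -/
theorem exists_evolution {M K R : H →L[ℝ] H} (hM : M.IsPositive) (hR : R.IsPositive) {k : ℝ}
    (hk : 0 < k) (hK : ∀ x, k * ‖x‖ ^ 2 ≤ inner ℝ (K x) x) (h : L2t T H) :
    ∃ f : L2t T H, M.compLp f + K.compLp (volterra T H f)
      + R.compLp (volterra T H (volterra T H f)) = volterra T H h := by
  set J := volterra T H with hJ
  set S : L2t T H →L[ℝ] L2t T H :=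
    M.compLpL 2 _ + (K.compLpL 2 _) ∘L J + (R.compLpL 2 _) ∘L J ∘L J with hS
  have hSa : ∀ f, S f = M.compLp f + K.compLp (J f) + R.compLp (J (J f)) := fun f => rfl
  have hcomm : ∀ (A : H →L[ℝ] H) f, J (A.compLp f) = A.compLp (J f) := volterra_compLp
  -- By the range criterion it remains to compare the adjoints; with φ = J*ψ, the pairing ⟨φ, S*ψ⟩ =
  -- ⟨Sφ, ψ⟩ splits into three terms.
  suffices hb : ∀ ψ, ‖ContinuousLinearMap.adjoint J ψ‖
      ≤ k⁻¹ * ‖ContinuousLinearMap.adjoint S ψ‖ by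
    obtain ⟨f, hf⟩ := exists_apply_eq_of_norm_adjoint_le S J _ hb h
    exact ⟨f, hf⟩
  intro ψ
  set φ := ContinuousLinearMap.adjoint J ψ with hφ
  -- Symmetry and commutation with J rewrite this term as ⟨Mψ, Jψ⟩. In the other two, one J moves
  -- onto ψ and turns it into φ.
  have h1 : 0 ≤ inner ℝ (M.compLp φ) ψ := by
    rw [inner_compLp_right hM.isSymmetric, hφ, ContinuousLinearMap.adjoint_inner_left, hcomm,
      ← inner_compLp_right hM.isSymmetric]
    exact inner_compLp_volterra_nonneg hM ψ
  have h2 : k * ‖φ‖ ^ 2 ≤ inner ℝ (K.compLp (J φ)) ψ := by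
    rw [← hcomm, ← ContinuousLinearMap.adjoint_inner_right]
    exact inner_compLp_self_ge hK φ
  have h3 : 0 ≤ inner ℝ (R.compLp (J (J φ))) ψ := by
    rw [← hcomm, ← ContinuousLinearMap.adjoint_inner_right]
    exact inner_volterra_compLp_nonneg hR φ
  have h4 : k * ‖φ‖ ^ 2 ≤ ‖φ‖ * ‖ContinuousLinearMap.adjoint S ψ‖ := by
    refine le_trans ?_ (real_inner_le_norm φ (ContinuousLinearMap.adjoint S ψ))
    rw [ContinuousLinearMap.adjoint_inner_right, hSa, inner_add_left, inner_add_left]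
    linarith
  rcases (norm_nonneg φ).eq_or_lt with h0 | h0
  · rw [← h0]; positivity
  · rw [inv_mul_eq_div, le_div_iff₀ hk]
    nlinarith

end Hilbert

/-! ### Energy estimates -/

section Energy

theorem prim_mono {f g : ℝ → ℝ} {T t : ℝ} (ht : t ≤ T) (hf : IntegrableOn f (Ioc 0 t))
    (hg : IntegrableOn g (Ioc 0 t)) (h : ∀ s ∈ Icc 0 T, f s ≤ g s) : prim f t ≤ prim g t :=
  setIntegral_mono_on hf hg measurableSet_Ioc fun s hs => h s ⟨hs.1.le, hs.2.trans ht⟩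

theorem prim_nonneg {f : ℝ → ℝ} {t : ℝ} (h : ∀ s, 0 ≤ f s) : 0 ≤ prim f t :=
  integral_nonneg h

theorem prim_le_of_nonneg {f : ℝ → ℝ} {T t : ℝ} (ht : t ≤ T) (hf : IntegrableOn f (Ioc 0 T))
    (h : ∀ s, 0 ≤ f s) : prim f t ≤ prim f T :=
  setIntegral_mono_set hf (.of_forall h) (Ioc_subset_Ioc_right ht).eventuallyLE

theorem hasDerivAt_prim {T t : ℝ} {z : ℝ → ℝ} (hz : ContinuousOn z (Icc 0 T)) (ht : t ∈ Ioo 0 T) :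
    HasDerivAt (prim z) (z t) t := by
  have h1 : ContinuousAt z t := hz.continuousAt (Icc_mem_nhds ht.1 ht.2)
  have h2 : IntervalIntegrable z volume 0 t :=
    (hz.mono (by rw [uIcc_of_le ht.1.le]; exact Icc_subset_Icc_right ht.2.le)).intervalIntegrable
  have h3 : StronglyMeasurableAtFilter z (nhds t) :=
    (hz.mono Ioo_subset_Icc_self).stronglyMeasurableAtFilter isOpen_Ioo t ht
  refine (intervalIntegral.integral_hasDerivAt_right h2 h3 h1).congr_of_eventuallyEq ?_
  filter_upwards [Ioi_mem_nhds ht.1] with s hs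
  rw [prim, intervalIntegral.integral_of_le (le_of_lt hs)]

/-- Grönwall's inequality in integral form. -/
theorem prim_add_le_mul_exp {T A t : ℝ} {z : ℝ → ℝ} (hz : ContinuousOn z (Icc 0 T))
    (h : ∀ s ∈ Icc 0 T, z s ≤ prim z s + A) (ht : t ∈ Icc 0 T) :
    prim z t + A ≤ A * Real.exp t := by
  -- The hypothesis says exactly that (∫z + A)e^{-s} has nonpositive derivative.
  have hanti : AntitoneOn (fun s => (prim z s + A) * Real.exp (-s)) (Icc 0 T) := by
    have hd : ∀ s ∈ Ioo 0 T, HasDerivAt (fun s => (prim z s + A) * Real.exp (-s))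
        (z s * Real.exp (-s) + (prim z s + A) * (Real.exp (-s) * -1)) s := fun s hs =>
      ((hasDerivAt_prim hz hs).add_const A).mul ((hasDerivAt_neg s).exp)
    refine antitoneOn_of_deriv_nonpos (convex_Icc 0 T) ?_ ?_ ?_
    · exact ((continuousOn_prim (hz.integrableOn_Icc.mono_set Ioc_subset_Icc_self)).add
        continuousOn_const).mul (by fun_prop)
    · rw [interior_Icc]
      exact fun s hs => (hd s hs).differentiableAt.differentiableWithinAt
    · rw [interior_Icc]
      intro s hs
      rw [(hd s hs).deriv]
      have := h s (Ioo_subset_Icc_self hs)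
      nlinarith [Real.exp_pos (-s)]
  have h1 := hanti (left_mem_Icc.2 (ht.1.trans ht.2)) ht ht.1
  simp only [prim_zero, zero_add, neg_zero, Real.exp_zero, mul_one, Real.exp_neg] at h1
  rwa [← div_eq_mul_inv, div_le_iff₀ (Real.exp_pos t)] at h1

end Energy

end

section

/-! ### Energy identities for the abstract evolution equation -/

section EnergyIdentity

variable {T : ℝ} {H : Type*} [NormedAddCommGroup H] [InnerProductSpace ℝ H] [CompleteSpace H]

theorem prim_add {f g : ℝ → ℝ} {t : ℝ} (hf : IntegrableOn f (Ioc 0 t))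
    (hg : IntegrableOn g (Ioc 0 t)) : prim (fun s => f s + g s) t = prim f t + prim g t :=
  integral_add hf hg

theorem prim_add_three {f g h : ℝ → ℝ} {t : ℝ} (hf : IntegrableOn f (Ioc 0 t))
    (hg : IntegrableOn g (Ioc 0 t)) (hh : IntegrableOn h (Ioc 0 t)) :
    prim (fun s => f s + g s + h s) t = prim f t + prim g t + prim h t :=
  (prim_add (hf.add hg) hh).trans (congrArg (· + prim h t) (prim_add hf hg))

theorem prim_const_mul (c : ℝ) (f : ℝ → ℝ) (t : ℝ) :
    prim (fun s => c * f s) t = c * prim f t :=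
  integral_const_mul c f

theorem integrableOn_of_continuousOn {E : Type*} [NormedAddCommGroup E] {f : ℝ → E} {t : ℝ}
    (ht : t ≤ T) (hf : ContinuousOn f (Icc 0 T)) : IntegrableOn f (Ioc 0 t) :=
  hf.integrableOn_Icc.mono_set (Ioc_subset_Icc_self.trans (Icc_subset_Icc_right ht))

/-- The bilinear map `(c, x) ↦ c ⟪b, x⟫`. -/
def mulInner (b : H) : ℝ →L[ℝ] H →L[ℝ] ℝ :=
  (ContinuousLinearMap.mul ℝ ℝ).bilinearComp (.id ℝ ℝ) (innerSL ℝ b)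

theorem mulInner_apply (b : H) (c : ℝ) (x : H) : mulInner b c x = c * inner ℝ b x := rfl

theorem prim_form_prim {A : H →L[ℝ] H} (hA : A.IsSymmetric) {f : ℝ → H} {t : ℝ}
    (hf : IntegrableOn f (Ioc 0 t)) :
    prim (fun s => inner ℝ (A (prim f s)) (f s)) t
      = inner ℝ (A (prim f t)) (prim f t) / 2 := by
  rw [← prim_form_self hA hf]
  congr 1
  funext s
  exact (hA _ _).trans (real_inner_comm _ _)

variable {M L R : H →L[ℝ] H} {b : H} {f : L2t T H} {h : L2t T ℝ}

theorem continuousOn_velocity (f : L2t T H) : ContinuousOn (prim f) (Icc 0 T) :=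
  continuousOn_prim (L2t.integrableOn f)

theorem continuousOn_position (f : L2t T H) : ContinuousOn (prim (prim f)) (Icc 0 T) :=
  continuousOn_prim (integrableOn_of_continuousOn le_rfl (continuousOn_velocity f))

/-- The energy identity obtained by testing with the velocity. -/
theorem energy_velocity (hM : M.IsSymmetric) (hR : R.IsSymmetric)
    (heq : ∀ᵐ t ∂(volume.restrict (Ioo 0 T)),
      M (f t) + L (prim f t) + R (prim (prim f) t) = prim h t • b) {t : ℝ} (ht : t ∈ Icc 0 T) :
    inner ℝ (M (prim f t)) (prim f t) / 2 + prim (fun s => inner ℝ (L (prim f s)) (prim f s)) t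
      + inner ℝ (R (prim (prim f) t)) (prim (prim f) t) / 2
    = prim h t * inner ℝ b (prim (prim f) t)
      - prim (fun s => h s * inner ℝ b (prim (prim f) s)) t := by
  have hf := L2t.integrableOn_of_le f ht.2
  have hh := L2t.integrableOn_of_le h ht.2
  have hw := integrableOn_of_continuousOn ht.2 (continuousOn_velocity f)
  have i1 := integrableOn_bilin_prim_right (form M) hf hf
  have i2 : IntegrableOn (fun s => inner ℝ (L (prim f s)) (prim f s)) (Ioc 0 t) :=
    integrableOn_of_continuousOn ht.2
      ((L.continuous.comp_continuousOn (continuousOn_velocity f)).inner (continuousOn_velocity f))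
  have i3 := integrableOn_bilin_prim_left (form R) hw hw
  have e : prim (fun s => inner ℝ (M (f s)) (prim f s) + inner ℝ (L (prim f s)) (prim f s)
      + inner ℝ (R (prim (prim f) s)) (prim f s)) t
      = prim (fun s => prim h s * inner ℝ b (prim f s)) t := by
    refine prim_congr ?_ ht.2
    filter_upwards [heq] with s hs
    rw [← inner_add_left, ← inner_add_left, hs, real_inner_smul_left]
  -- Moves the time derivative onto the force, so that h meets only the position, which the elastic
  -- energy controls.
  have e2 := integral_bilin_prim_add (mulInner b) hh hw
  simp only [mulInner_apply] at e2
  simp only [form_apply] at i1 i3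
  rw [prim_add_three i1 i2 i3, prim_form_self hM hf, prim_form_prim hR hw] at e
  rw [e, ← e2]
  simp only [prim]
  ring

/-- The energy identity obtained by testing with the acceleration. -/
theorem energy_acceleration (hL : L.IsSymmetric)
    (heq : ∀ᵐ t ∂(volume.restrict (Ioo 0 T)),
      M (f t) + L (prim f t) + R (prim (prim f) t) = prim h t • b) :
    prim (fun s => inner ℝ (M (f s)) (f s)) T + inner ℝ (L (prim f T)) (prim f T) / 2
      + inner ℝ (R (prim (prim f) T)) (prim f T)
      - prim (fun s => inner ℝ (R (prim f s)) (prim f s)) T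
    = prim h T * inner ℝ b (prim f T) - prim (fun s => h s * inner ℝ b (prim f s)) T := by
  have hf := L2t.integrableOn f
  have hh := L2t.integrableOn h
  have hw := integrableOn_of_continuousOn le_rfl (continuousOn_velocity f)
  have i1 : IntegrableOn (fun s => inner ℝ (M (f s)) (f s)) (Ioc 0 T) := by
    have := (L2.integrable_inner (𝕜 := ℝ) (M.compLp f) f)
    rw [IntegrableOn, ← restrict_Ioo_eq_restrict_Ioc]
    refine this.congr ?_
    filter_upwards [M.coeFn_compLp f] with s hs
    rw [hs]
  have i2 := integrableOn_bilin_prim_left (form L) hf hf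
  have i3 := integrableOn_bilin_prim_left (form R) hw hf
  have e : prim (fun s => inner ℝ (M (f s)) (f s) + inner ℝ (L (prim f s)) (f s)
      + inner ℝ (R (prim (prim f) s)) (f s)) T
      = prim (fun s => prim h s * inner ℝ b (f s)) T := by
    refine prim_congr ?_ le_rfl
    filter_upwards [heq] with s hs
    rw [← inner_add_left, ← inner_add_left, hs, real_inner_smul_left]
  have e2 := integral_bilin_prim_add (mulInner b) hh hf
  -- The elastic term paired with the acceleration has no sign; by parts it becomes a product at the
  -- final time and an integral of the velocity only.
  have e3 := integral_bilin_prim_add (form R) hw hf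
  simp only [mulInner_apply] at e2
  simp only [form_apply] at i1 i2 i3 e3
  rw [prim_add_three i1 i2 i3, prim_form_prim hL hf] at e
  rw [← e2, ← e3]
  simp only [prim] at e ⊢
  linarith

end EnergyIdentity

/-! ### A priori bounds from the energy identities -/

section EnergyEstimate

variable {T : ℝ} {H : Type*} [NormedAddCommGroup H] [InnerProductSpace ℝ H] [CompleteSpace H]
  {M L R : H →L[ℝ] H} {b : H} {f : L2t T H} {h : L2t T ℝ} {β r0 r1 k : ℝ}

theorem inner_sq_le (hb : ‖b‖ ^ 2 ≤ β) (x : H) : inner ℝ b x ^ 2 ≤ β * ‖x‖ ^ 2 := by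
  have h1 := abs_real_inner_le_norm b x
  calc inner ℝ b x ^ 2 = |inner ℝ b x| ^ 2 := (sq_abs _).symm
    _ ≤ (‖b‖ * ‖x‖) ^ 2 := by gcongr
    _ = ‖b‖ ^ 2 * ‖x‖ ^ 2 := by ring
    _ ≤ β * ‖x‖ ^ 2 := by gcongr

theorem L2t.prim_sq_le (hT : 0 ≤ T) (h : L2t T ℝ) {t : ℝ} (ht : t ∈ Icc 0 T) :
    prim h t ^ 2 ≤ T * ‖h‖ ^ 2 := by
  have h1 := L2t.norm_prim_le h ht.1 ht.2
  calc prim h t ^ 2 = ‖prim h t‖ ^ 2 := (sq_abs _).symm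
    _ ≤ (√T * ‖h‖) ^ 2 := by gcongr
    _ = T * ‖h‖ ^ 2 := by rw [mul_pow, Real.sq_sqrt hT]

theorem L2t.integrableOn_norm_sq {E : Type*} [NormedAddCommGroup E] (h : L2t T E) :
    IntegrableOn (fun s => ‖h s‖ ^ 2) (Ioc 0 T) := by
  rw [IntegrableOn, ← restrict_Ioo_eq_restrict_Ioc]
  exact (Lp.memLp h).integrable_norm_pow (by norm_num)

/-- Any solution of the evolution equation has velocity and potential energy controlled by the
derivative `h` of the force. -/
theorem energy_le (hT : 0 ≤ T) (hM : M.IsPositive) (hR : R.IsSymmetric) (hr0 : 0 < r0)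
    (hRr : ∀ x, r0 * ‖x‖ ^ 2 ≤ inner ℝ (R x) x) (hLk : ∀ x, k * ‖x‖ ^ 2 ≤ inner ℝ (L x) x)
    (hβ : 0 < β) (hb : ‖b‖ ^ 2 ≤ β)
    (heq : ∀ᵐ t ∂(volume.restrict (Ioo 0 T)),
      M (f t) + L (prim f t) + R (prim (prim f) t) = prim h t • b) {t : ℝ} (ht : t ∈ Icc 0 T) :
    inner ℝ (R (prim (prim f) t)) (prim (prim f) t) + 4 * k * prim (fun s => ‖prim f s‖ ^ 2) t
      ≤ prim (fun s => inner ℝ (R (prim (prim f) s)) (prim (prim f) s)) t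
        + 4 * β / r0 * (1 + T) * ‖h‖ ^ 2 := by
  set γ := β / r0 with hγ
  have hγ0 : 0 < γ := div_pos hβ hr0
  -- The weight 1/4 leaves a quarter of the elastic energy on the left; after multiplication by 4
  -- the Grönwall rate is one, which produces e^T.
  have young : ∀ (c : ℝ) (x : H), c * inner ℝ b x ≤ inner ℝ (R x) x / 4 + γ * c ^ 2 := by
    intro c x
    have h1 : inner ℝ b x ^ 2 ≤ γ * inner ℝ (R x) x := by
      refine (inner_sq_le hb x).trans ?_
      rw [hγ, div_mul_eq_mul_div, le_div_iff₀ hr0]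
      nlinarith [hRr x]
    have h2 : 0 ≤ γ * (inner ℝ (R x) x / 4 + γ * c ^ 2 - c * inner ℝ b x) := by
      nlinarith [sq_nonneg (inner ℝ b x / 2 - γ * c)]
    linarith [nonneg_of_mul_nonneg_right h2 hγ0]
  have e := energy_velocity hM.isSymmetric hR heq ht
  have hw := continuousOn_velocity f
  have hy := continuousOn_position f
  have iw := integrableOn_of_continuousOn ht.2 hw
  have iz : IntegrableOn (fun s => inner ℝ (R (prim (prim f) s)) (prim (prim f) s)) (Ioc 0 t) :=
    integrableOn_of_continuousOn ht.2 ((R.continuous.comp_continuousOn hy).inner hy)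
  have ih : IntegrableOn (fun s => ‖h s‖ ^ 2) (Ioc 0 t) :=
    (L2t.integrableOn_norm_sq h).mono_set (Ioc_subset_Ioc_right ht.2)
  have b1 : 0 ≤ inner ℝ (M (prim f t)) (prim f t) := hM.inner_nonneg_left _
  have b2 : k * prim (fun s => ‖prim f s‖ ^ 2) t
      ≤ prim (fun s => inner ℝ (L (prim f s)) (prim f s)) t := by
    rw [← prim_const_mul]
    exact prim_mono ht.2
      ((integrableOn_of_continuousOn ht.2 (hw.norm.pow 2)).const_mul k)
      (integrableOn_of_continuousOn ht.2 ((L.continuous.comp_continuousOn hw).inner hw))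
      fun s _ => hLk _
  have b3 := young (prim h t) (prim (prim f) t)
  have b4 : - prim (fun s => h s * inner ℝ b (prim (prim f) s)) t
      ≤ prim (fun s => inner ℝ (R (prim (prim f) s)) (prim (prim f) s)) t / 4 + γ * ‖h‖ ^ 2 := by
    have h1 : prim (fun s => (-1) * (h s * inner ℝ b (prim (prim f) s))) t
        ≤ prim (fun s => 4⁻¹ * inner ℝ (R (prim (prim f) s)) (prim (prim f) s)
          + γ * ‖h s‖ ^ 2) t := by
      refine prim_mono ht.2 ?_ ((iz.const_mul _).add (ih.const_mul _)) fun s _ => ?_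
      · exact (integrableOn_bilin_prim_right (mulInner b) (L2t.integrableOn_of_le h ht.2)
          iw).const_mul _
      · have := young (-h s) (prim (prim f) s)
        rw [Real.norm_eq_abs, sq_abs]
        linarith
    rw [prim_add (iz.const_mul _) (ih.const_mul _), prim_const_mul, prim_const_mul,
      prim_const_mul] at h1
    have h2 : prim (fun s => ‖h s‖ ^ 2) t ≤ ‖h‖ ^ 2 := by
      rw [L2t.norm_sq_eq]
      exact prim_le_of_nonneg ht.2 (L2t.integrableOn_norm_sq h) fun s => by positivity
    have h3 := mul_le_mul_of_nonneg_left h2 hγ0.le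
    linarith
  have b5 := mul_le_mul_of_nonneg_left (L2t.prim_sq_le hT h ht) hγ0.le
  have b6 : 4 * β / r0 * (1 + T) * ‖h‖ ^ 2 = 4 * (γ * (T * ‖h‖ ^ 2) + γ * ‖h‖ ^ 2) := by
    rw [hγ]; ring
  rw [b6]
  linarith

/-- Grönwall applied to the elastic energy, the damping term of `energy_le` being dropped. The
constant stays on the left, so that the integrated energy is bounded with e^t - 1. -/
theorem prim_potential_le (hT : 0 ≤ T) (hM : M.IsPositive) (hR : R.IsSymmetric) (hr0 : 0 < r0)
    (hRr : ∀ x, r0 * ‖x‖ ^ 2 ≤ inner ℝ (R x) x) (hk : 0 ≤ k)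
    (hLk : ∀ x, k * ‖x‖ ^ 2 ≤ inner ℝ (L x) x)
    (hβ : 0 < β) (hb : ‖b‖ ^ 2 ≤ β)
    (heq : ∀ᵐ t ∂(volume.restrict (Ioo 0 T)),
      M (f t) + L (prim f t) + R (prim (prim f) t) = prim h t • b) {t : ℝ} (ht : t ∈ Icc 0 T) :
    prim (fun s => inner ℝ (R (prim (prim f) s)) (prim (prim f) s)) t
        + 4 * β / r0 * (1 + T) * ‖h‖ ^ 2 ≤ 4 * β / r0 * (1 + T) * ‖h‖ ^ 2 * Real.exp t := by
  have hy := continuousOn_position f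
  refine prim_add_le_mul_exp ((R.continuous.comp_continuousOn hy).inner hy) (fun s hs => ?_) ht
  have h1 := energy_le hT hM hR hr0 hRr hLk hβ hb heq hs
  have h2 : 0 ≤ prim (fun s => ‖prim f s‖ ^ 2) s := prim_nonneg fun s => by positivity
  have : 0 ≤ 4 * k * prim (fun s => ‖prim f s‖ ^ 2) s := by positivity
  linarith

/-- The kinetic energy of the acceleration is controlled by the derivative `h` of the force. -/
theorem prim_acceleration_le (hT : 0 ≤ T) (hM : M.IsPositive) (hL : L.IsSymmetric)
    (hR : R.IsSymmetric) (hr0 : 0 < r0)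
    (hRr : ∀ x, r0 * ‖x‖ ^ 2 ≤ inner ℝ (R x) x) (hr1 : 0 ≤ r1) (hRr1 : ∀ x, ‖R x‖ ≤ r1 * ‖x‖)
    (hk : 0 < k) (hLk : ∀ x, k * ‖x‖ ^ 2 ≤ inner ℝ (L x) x)
    (hβ : 0 < β) (hb : ‖b‖ ^ 2 ≤ β)
    (heq : ∀ᵐ t ∂(volume.restrict (Ioo 0 T)),
      M (f t) + L (prim f t) + R (prim (prim f) t) = prim h t • b) {ε : ℝ} (hε : 0 < ε) :
    prim (fun s => inner ℝ (M (f s)) (f s)) T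
      ≤ 4 * β / r0 * (1 + T) * ‖h‖ ^ 2 * Real.exp T
          * (r1 ^ 2 / (r0 * k) + r1 / (4 * k) + ε * β / (8 * k))
        + (β * T / k + 1 / (2 * ε)) * ‖h‖ ^ 2 := by
  have hTm : T ∈ Icc 0 T := right_mem_Icc.2 hT
  have e := energy_acceleration hL heq
  have g1 := energy_le hT hM hR hr0 hRr hLk hβ hb heq hTm
  have g2 := prim_potential_le hT hM hR hr0 hRr hk.le hLk hβ hb heq hTm
  set A := 4 * β / r0 * (1 + T) * ‖h‖ ^ 2 * Real.exp T
  set W := prim (fun s => ‖prim f s‖ ^ 2) T with hW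
  have hW0 : 0 ≤ W := prim_nonneg fun s => by positivity
  set z := inner ℝ (R (prim (prim f) T)) (prim (prim f) T) with hz
  have hz1 := hRr (prim (prim f) T)
  have hw := continuousOn_velocity f
  have iw : IntegrableOn (fun s => ‖prim f s‖ ^ 2) (Ioc 0 T) :=
    integrableOn_of_continuousOn le_rfl (hw.norm.pow 2)
  have hzA : z + 4 * k * W ≤ A := g1.trans g2
  have hyA : r0 * ‖prim (prim f) T‖ ^ 2 ≤ A := by nlinarith
  have hWA : W ≤ A / (4 * k) := by
    rw [le_div_iff₀ (by positivity)]
    nlinarith [mul_nonneg hr0.le (sq_nonneg ‖prim (prim f) T‖)]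
  have c1 := hLk (prim f T)
  -- The damping energy at the final time is at least (k/2)‖w(T)‖² for w the velocity; `c2` and `c3`
  -- each consume half of that.
  have c2 : - inner ℝ (R (prim (prim f) T)) (prim f T)
      ≤ k / 4 * ‖prim f T‖ ^ 2 + r1 ^ 2 / (r0 * k) * A := by
    have h1 : - inner ℝ (R (prim (prim f) T)) (prim f T)
        ≤ r1 * ‖prim (prim f) T‖ * ‖prim f T‖ :=
      (neg_le_abs _).trans ((abs_real_inner_le_norm _ _).trans
        (mul_le_mul_of_nonneg_right (hRr1 _) (norm_nonneg _)))
    have h2 : r1 * ‖prim (prim f) T‖ * ‖prim f T‖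
        ≤ k / 4 * ‖prim f T‖ ^ 2 + r1 ^ 2 / k * ‖prim (prim f) T‖ ^ 2 := by
      have : k / 4 * ‖prim f T‖ ^ 2 + r1 ^ 2 / k * ‖prim (prim f) T‖ ^ 2
          - r1 * ‖prim (prim f) T‖ * ‖prim f T‖
          = (k / 2 * ‖prim f T‖ - r1 * ‖prim (prim f) T‖) ^ 2 / k := by
        field_simp
        ring
      have h3 : 0 ≤ (k / 2 * ‖prim f T‖ - r1 * ‖prim (prim f) T‖) ^ 2 / k := by positivity
      linarith
    have h4 : r1 ^ 2 / k * ‖prim (prim f) T‖ ^ 2 ≤ r1 ^ 2 / (r0 * k) * A := by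
      have : r1 ^ 2 / k * ‖prim (prim f) T‖ ^ 2
          = r1 ^ 2 / (r0 * k) * (r0 * ‖prim (prim f) T‖ ^ 2) := by field_simp
      rw [this]
      gcongr
    linarith
  have c3 : prim h T * inner ℝ b (prim f T)
      ≤ k / 4 * ‖prim f T‖ ^ 2 + β * T / k * ‖h‖ ^ 2 := by
    have h1 := inner_sq_le hb (prim f T)
    have h2 := L2t.prim_sq_le hT h hTm
    have h3 : prim h T * inner ℝ b (prim f T)
        ≤ k / (4 * β) * inner ℝ b (prim f T) ^ 2 + β / k * prim h T ^ 2 := by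
      have : k / (4 * β) * inner ℝ b (prim f T) ^ 2 + β / k * prim h T ^ 2
          - prim h T * inner ℝ b (prim f T)
          = (k * inner ℝ b (prim f T) - 2 * β * prim h T) ^ 2 / (4 * β * k) := by
        field_simp
        ring
      have h3 : 0 ≤ (k * inner ℝ b (prim f T) - 2 * β * prim h T) ^ 2 / (4 * β * k) := by
        positivity
      linarith
    have h4 : k / (4 * β) * inner ℝ b (prim f T) ^ 2 ≤ k / (4 * β) * (β * ‖prim f T‖ ^ 2) := by
      gcongr
    have h5 : k / (4 * β) * (β * ‖prim f T‖ ^ 2) = k / 4 * ‖prim f T‖ ^ 2 := by field_simp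
    have h6 : β / k * prim h T ^ 2 ≤ β / k * (T * ‖h‖ ^ 2) := by gcongr
    have h7 : β / k * (T * ‖h‖ ^ 2) = β * T / k * ‖h‖ ^ 2 := by ring
    linarith
  have c4 : prim (fun s => inner ℝ (R (prim f s)) (prim f s)) T ≤ r1 * W := by
    rw [hW, ← prim_const_mul]
    refine prim_mono le_rfl (integrableOn_of_continuousOn le_rfl
      ((R.continuous.comp_continuousOn hw).inner hw)) (iw.const_mul r1) fun s _ => ?_
    refine (real_inner_le_norm _ _).trans ?_
    nlinarith [mul_le_mul_of_nonneg_right (hRr1 (prim f s)) (norm_nonneg (prim f s))]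
  -- Young's inequality with ε left free; it is tuned to the stated constants when the load is
  -- inserted.
  have c5 : - prim (fun s => h s * inner ℝ b (prim f s)) T
      ≤ ε * β / 2 * W + 1 / (2 * ε) * ‖h‖ ^ 2 := by
    have ih := L2t.integrableOn_norm_sq h
    have h1 : prim (fun s => (-1) * (h s * inner ℝ b (prim f s))) T
        ≤ prim (fun s => ε * β / 2 * ‖prim f s‖ ^ 2 + 1 / (2 * ε) * ‖h s‖ ^ 2) T := by
      refine prim_mono le_rfl ?_ ((iw.const_mul _).add (ih.const_mul _)) fun s _ => ?_
      · exact (integrableOn_bilin_prim_right (mulInner b) (L2t.integrableOn h)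
          (L2t.integrableOn f)).const_mul _
      · have h2 := inner_sq_le hb (prim f s)
        have h3 : ε / 2 * inner ℝ b (prim f s) ^ 2 ≤ ε / 2 * (β * ‖prim f s‖ ^ 2) := by gcongr
        rw [Real.norm_eq_abs, sq_abs]
        have h4 : ε / 2 * inner ℝ b (prim f s) ^ 2 + 1 / (2 * ε) * h s ^ 2
            + h s * inner ℝ b (prim f s) = (ε * inner ℝ b (prim f s) + h s) ^ 2 / (2 * ε) := by
          field_simp
          ring
        have h5 : 0 ≤ (ε * inner ℝ b (prim f s) + h s) ^ 2 / (2 * ε) := by positivity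
        linarith
    rw [prim_add (iw.const_mul _) (ih.const_mul _), prim_const_mul, prim_const_mul,
      prim_const_mul, ← L2t.norm_sq_eq] at h1
    linarith
  have c6 : (r1 + ε * β / 2) * W ≤ (r1 + ε * β / 2) * (A / (4 * k)) := by gcongr
  have c7 : A * (r1 ^ 2 / (r0 * k) + r1 / (4 * k) + ε * β / (8 * k))
      = r1 ^ 2 / (r0 * k) * A + (r1 + ε * β / 2) * (A / (4 * k)) := by
    field_simp
    ring
  rw [c7]
  linarith

end EnergyEstimate

end

section

variable {ℓ : ℝ}

/-! ### The Volterra operator in the space variable -/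

section Space

theorem L2.inner_eq (f g : L2 0 ℓ) : inner ℝ f g = ∫ x in Ioo 0 ℓ, f x * g x := by
  rw [MeasureTheory.L2.inner_def]
  exact integral_congr_ae (.of_forall fun x => by simp [mul_comm])

theorem L2.integrable_mul (f g : L2 0 ℓ) :
    Integrable (fun x => f x * g x) (volume.restrict (Ioo 0 ℓ)) :=
  (MeasureTheory.L2.integrable_inner (𝕜 := ℝ) f g).congr (.of_forall fun x => by simp [mul_comm])

variable (ℓ) in
/-- The operator `z ↦ ∫ₓ^ℓ z`, with values in the continuous functions. -/
def volterraStarC : L2 0 ℓ →L[ℝ] C(Icc (0 : ℝ) ℓ, ℝ) :=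
  (ContinuousLinearMap.toSpanSingleton ℝ (1 : C(Icc (0 : ℝ) ℓ, ℝ))) ∘L
    (innerSL ℝ (embed ℓ ℝ 1)) - volterraC ℓ ℝ

theorem inner_embed_one (z : L2 0 ℓ) : inner ℝ (embed ℓ ℝ 1) z = prim z ℓ := by
  rw [L2.inner_eq, prim, integral_Ioc_eq_integral_Ioo]
  refine integral_congr_ae ?_
  filter_upwards [coeFn_embed (1 : C(Icc (0 : ℝ) ℓ, ℝ)), ae_restrict_mem measurableSet_Ioo]
    with x h1 hx
  rw [h1, extend_apply _ (Ioo_subset_Icc_self hx)]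
  simp

theorem volterraStarC_apply (z : L2 0 ℓ) (x : Icc (0 : ℝ) ℓ) :
    volterraStarC ℓ z x = prim z ℓ - prim z x := by
  simp [volterraStarC, ← inner_embed_one, volterraC_apply]

/-- Integration by parts turns the forward primitive into the backward one, x ↦ ∫ₓ^ℓ z. It is routed
through C[0,ℓ] because the moment needs its value at a point. -/
theorem adjoint_volterra (z : L2 0 ℓ) :
    ContinuousLinearMap.adjoint (volterra ℓ ℝ) z = embed ℓ ℝ (volterraStarC ℓ z) := by
  refine ext_inner_left ℝ fun f => ?_
  rw [ContinuousLinearMap.adjoint_inner_right, L2.inner_eq, L2.inner_eq]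
  have h := integral_bilin_prim_add (ContinuousLinearMap.mul ℝ ℝ) (L2t.integrableOn f)
    (L2t.integrableOn z)
  have i1 := integrableOn_bilin_prim_right (ContinuousLinearMap.mul ℝ ℝ) (L2t.integrableOn f)
    (L2t.integrableOn z)
  simp only [ContinuousLinearMap.mul_apply'] at h i1
  rw [integral_Ioc_eq_integral_Ioo, integral_Ioc_eq_integral_Ioo] at h
  have e1 : ∫ x in Ioo 0 ℓ, volterra ℓ ℝ f x * z x = ∫ x in Ioo 0 ℓ, prim f x * z x :=
    integral_congr_ae ((coeFn_volterra f).mono fun x hx => by simp only [hx])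
  have e2 : ∫ x in Ioo 0 ℓ, f x * embed ℓ ℝ (volterraStarC ℓ z) x
      = ∫ x in Ioo 0 ℓ, (f x * prim z ℓ - f x * prim z x) := by
    refine integral_congr_ae ?_
    filter_upwards [coeFn_embed (volterraStarC ℓ z), ae_restrict_mem measurableSet_Ioo] with x h1 hx
    rw [h1, extend_apply _ (Ioo_subset_Icc_self hx), volterraStarC_apply, mul_sub]
  have e3 : ∫ x in Ioo 0 ℓ, (f x * prim z ℓ - f x * prim z x)
      = prim f ℓ * prim z ℓ - ∫ x in Ioo 0 ℓ, f x * prim z x := by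
    have hf : Integrable (f : ℝ → ℝ) (volume.restrict (Ioo 0 ℓ)) :=
      (Lp.memLp f).integrable (by norm_num)
    refine (integral_sub (hf.mul_const _) (i1.mono_set Ioo_subset_Ioc_self)).trans ?_
    rw [integral_mul_const, ← integral_Ioc_eq_integral_Ioo]
    rfl
  rw [e1, e2, e3]
  linarith

variable (ℓ) in
/-- The operator taking `w` to the function `v` with `v'' = w`, `v(0) = v'(0) = 0`. -/
def potential : L2 0 ℓ →L[ℝ] L2 0 ℓ := volterra ℓ ℝ ∘L volterra ℓ ℝ

theorem potential_injective (hℓ : 0 ≤ ℓ) : Function.Injective (potential ℓ) :=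
  (volterra_injective hℓ).comp (volterra_injective hℓ)

theorem norm_potential_le (hℓ : 0 ≤ ℓ) (w : L2 0 ℓ) : ‖potential ℓ w‖ ≤ ℓ ^ 2 * ‖w‖ := by
  have h : ∀ f : L2 0 ℓ, ‖volterra ℓ ℝ f‖ ≤ ℓ * ‖f‖ := fun f =>
    (ContinuousLinearMap.le_opNorm _ f).trans
      (mul_le_mul_of_nonneg_right (norm_volterra_le hℓ) (norm_nonneg f))
  calc ‖potential ℓ w‖ ≤ ℓ * ‖volterra ℓ ℝ w‖ := h _
    _ ≤ ℓ * (ℓ * ‖w‖) := by gcongr; exact h _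
    _ = ℓ ^ 2 * ‖w‖ := by ring

variable (ℓ) in
/-- The adjoint of `potential`, with values in the continuous functions. -/
def potentialStarC : L2 0 ℓ →L[ℝ] C(Icc (0 : ℝ) ℓ, ℝ) :=
  volterraStarC ℓ ∘L embed ℓ ℝ ∘L volterraStarC ℓ

theorem adjoint_potential (z : L2 0 ℓ) :
    ContinuousLinearMap.adjoint (potential ℓ) z = embed ℓ ℝ (potentialStarC ℓ z) := by
  rw [potential, ContinuousLinearMap.adjoint_comp, ContinuousLinearMap.comp_apply,
    adjoint_volterra, adjoint_volterra]
  rfl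

variable (ℓ) in
/-- The load of a unit shear force at the tip, `x ↦ ℓ - x`. -/
def loadC : C(Icc (0 : ℝ) ℓ, ℝ) := volterraStarC ℓ (embed ℓ ℝ 1)

theorem prim_embed_one {x : ℝ} (hx : x ∈ Icc 0 ℓ) : prim (embed ℓ ℝ 1) x = x := by
  rw [prim_congr (g := fun _ => (1 : ℝ)) (T := ℓ) _ hx.2]
  · simp [prim, hx.1]
  · filter_upwards [coeFn_embed (1 : C(Icc (0 : ℝ) ℓ, ℝ)), ae_restrict_mem measurableSet_Ioo]
      with x h1 hx
    rw [h1, extend_apply _ (Ioo_subset_Icc_self hx)]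
    rfl

theorem loadC_apply (hℓ : 0 ≤ ℓ) (x : Icc (0 : ℝ) ℓ) : loadC ℓ x = ℓ - x := by
  rw [loadC, volterraStarC_apply, prim_embed_one (right_mem_Icc.2 hℓ), prim_embed_one x.2]

variable (ℓ) in
/-- The load of a unit shear force at the tip as an element of `L²(0, ℓ)`. -/
def load : L2 0 ℓ := embed ℓ ℝ (loadC ℓ)

/-- This is v(ℓ) = ∫(ℓ - x)v'' for v with v(0) = v'(0) = 0 and v'' = w. -/
theorem inner_load (w : L2 0 ℓ) : inner ℝ (load ℓ) w = prim (volterra ℓ ℝ w) ℓ := by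
  rw [load, loadC, ← adjoint_volterra, ContinuousLinearMap.adjoint_inner_left, inner_embed_one]

theorem norm_embed_sq (F : C(Icc (0 : ℝ) ℓ, ℝ)) {G : ℝ → ℝ} (h : ∀ x, F x = G x) (hℓ : 0 ≤ ℓ) :
    ‖embed ℓ ℝ F‖ ^ 2 = ∫ x in (0 : ℝ)..ℓ, G x ^ 2 := by
  rw [intervalIntegral.integral_of_le hℓ, L2t.norm_sq_eq, prim_congr (g := fun x => G x ^ 2) _ le_rfl]
  · rfl
  · filter_upwards [coeFn_embed F, ae_restrict_mem measurableSet_Ioo] with x h1 hx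
    rw [h1, extend_apply _ (Ioo_subset_Icc_self hx), h, Real.norm_eq_abs, sq_abs]

/-- Source of the powers ℓ³/3 in the explicit constants. -/
theorem norm_load_sq (hℓ : 0 ≤ ℓ) : ‖load ℓ‖ ^ 2 = ℓ ^ 3 / 3 := by
  rw [load, norm_embed_sq (loadC ℓ) (G := fun x => ℓ - x) (loadC_apply hℓ) hℓ,
    intervalIntegral.integral_comp_sub_left (fun x => x ^ 2) ℓ, integral_pow]
  norm_num

theorem norm_volterra_one_sq (hℓ : 0 ≤ ℓ) : ‖volterra ℓ ℝ (embed ℓ ℝ 1)‖ ^ 2 = ℓ ^ 3 / 3 := by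
  rw [volterra, ContinuousLinearMap.comp_apply, norm_embed_sq _ (G := fun x => x) _ hℓ, integral_pow]
  · norm_num
  · exact fun x => by rw [volterraC_apply, prim_embed_one x.2]

/-- The value of P*z at the clamped end is the first moment ∫xz dx, `volterra` of 1 being the
function x. -/
theorem potentialStarC_zero (hℓ : 0 ≤ ℓ) (z : L2 0 ℓ) :
    potentialStarC ℓ z ⟨0, left_mem_Icc.2 hℓ⟩
      = inner ℝ (volterra ℓ ℝ (embed ℓ ℝ 1)) z := by
  rw [potentialStarC, ContinuousLinearMap.comp_apply, volterraStarC_apply, prim_zero, sub_zero,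
    ContinuousLinearMap.comp_apply, ← adjoint_volterra, ← inner_embed_one,
    ContinuousLinearMap.adjoint_inner_right]

end Space

/-! ### Multiplication operators -/

section Mul

/-- Multiplication by a bounded function on `L²(0, ℓ)`. -/
def mulOp (a : LInf 0 ℓ) : L2 0 ℓ →L[ℝ] L2 0 ℓ :=
  (ContinuousLinearMap.mul ℝ ℝ).holderL (volume.restrict (Ioo 0 ℓ)) ∞ 2 2 a

theorem coeFn_mulOp (a : LInf 0 ℓ) (f : L2 0 ℓ) :
    mulOp a f =ᵐ[volume.restrict (Ioo 0 ℓ)] fun x => a x * f x :=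
  (ContinuousLinearMap.mul ℝ ℝ).coeFn_holder a f

theorem inner_mulOp (a : LInf 0 ℓ) (f g : L2 0 ℓ) :
    inner ℝ (mulOp a f) g = ∫ x in Ioo 0 ℓ, a x * f x * g x := by
  rw [L2.inner_eq]
  exact integral_congr_ae ((coeFn_mulOp a f).mono fun x hx => by simp only [hx])

theorem mulOp_isSymmetric (a : LInf 0 ℓ) : (mulOp a).IsSymmetric := by
  intro f g
  refine (inner_mulOp a f g).trans (Eq.trans ?_ (real_inner_comm _ _))
  refine Eq.trans ?_ (inner_mulOp a g f).symm
  exact integral_congr_ae (.of_forall fun x => by ring)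

theorem le_inner_mulOp {a : LInf 0 ℓ} {c : ℝ}
    (ha : ∀ᵐ x ∂(volume.restrict (Ioo 0 ℓ)), c ≤ a x) (f : L2 0 ℓ) :
    c * ‖f‖ ^ 2 ≤ inner ℝ (mulOp a f) f := by
  rw [← real_inner_self_eq_norm_sq, L2.inner_eq, L2.inner_eq, ← integral_const_mul]
  refine integral_mono_ae ((L2.integrable_mul f f).const_mul c) (L2.integrable_mul _ _) ?_
  filter_upwards [ha, coeFn_mulOp a f] with x h1 h2
  rw [h2, mul_assoc]
  exact mul_le_mul_of_nonneg_right h1 (mul_self_nonneg _)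

theorem mulOp_isPositive {a : LInf 0 ℓ}
    (ha : ∀ᵐ x ∂(volume.restrict (Ioo 0 ℓ)), 0 ≤ a x) : (mulOp a).IsPositive := by
  refine ⟨mulOp_isSymmetric a, fun f => ?_⟩
  have := le_inner_mulOp ha f
  rw [zero_mul] at this
  exact this

theorem norm_mulOp_le {a : LInf 0 ℓ} {c : ℝ}
    (ha : ∀ᵐ x ∂(volume.restrict (Ioo 0 ℓ)), |a x| ≤ c) (f : L2 0 ℓ) :
    ‖mulOp a f‖ ≤ c * ‖f‖ := by
  refine Lp.norm_le_mul_norm_of_ae_le_mul ?_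
  filter_upwards [ha, coeFn_mulOp a f] with x h1 h2
  rw [h2, norm_mul]
  exact mul_le_mul_of_nonneg_right h1 (norm_nonneg _)

/-- A continuous function as an element of `L^∞(0, ℓ)`. -/
def toLInf (F : C(Icc (0 : ℝ) ℓ, ℝ)) : LInf 0 ℓ := (memLp_extend F ∞).toLp

theorem coeFn_toLInf (F : C(Icc (0 : ℝ) ℓ, ℝ)) :
    toLInf F =ᵐ[volume.restrict (Ioo 0 ℓ)] extend F := (memLp_extend F ∞).coeFn_toLp

/-- Multiplication by a continuous function on `L²(0, ℓ)`. -/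
def mulCLin : C(Icc (0 : ℝ) ℓ, ℝ) →ₗ[ℝ] L2 0 ℓ →ₗ[ℝ] L2 0 ℓ :=
  LinearMap.mk₂ ℝ (fun F f => mulOp (toLInf F) f)
    (fun F G f => by
      apply Lp.ext
      filter_upwards [coeFn_mulOp (toLInf (F + G)) f, coeFn_mulOp (toLInf F) f,
        coeFn_mulOp (toLInf G) f, Lp.coeFn_add (mulOp (toLInf F) f) (mulOp (toLInf G) f),
        coeFn_toLInf F, coeFn_toLInf G, coeFn_toLInf (F + G),
        ae_restrict_mem measurableSet_Ioo] with x h1 h2 h3 h4 h5 h6 h7 hx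
      have hx' := Ioo_subset_Icc_self hx
      rw [h1, h4, Pi.add_apply, h2, h3, h5, h6, h7, extend_apply _ hx', extend_apply _ hx',
        extend_apply _ hx', ContinuousMap.add_apply, add_mul])
    (fun c F f => by
      apply Lp.ext
      filter_upwards [coeFn_mulOp (toLInf (c • F)) f, coeFn_mulOp (toLInf F) f,
        Lp.coeFn_smul c (mulOp (toLInf F) f),
        coeFn_toLInf F, coeFn_toLInf (c • F),
        ae_restrict_mem measurableSet_Ioo] with x h1 h2 h3 h4 h5 hx
      have hx' := Ioo_subset_Icc_self hx
      rw [h1, h3, Pi.smul_apply, h2, h4, h5, extend_apply _ hx', extend_apply _ hx',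
        ContinuousMap.smul_apply, smul_eq_mul, smul_eq_mul, mul_assoc])
    (fun F f g => map_add _ f g) (fun c F f => map_smul _ c f)

/-- Multiplication by a continuous function on `L²(0, ℓ)`, as a continuous bilinear map. -/
def mulC : C(Icc (0 : ℝ) ℓ, ℝ) →L[ℝ] L2 0 ℓ →L[ℝ] L2 0 ℓ :=
  LinearMap.mkContinuous₂ mulCLin 1 fun F f => by
    rw [one_mul]
    refine norm_mulOp_le (c := ‖F‖) ?_ f
    filter_upwards [coeFn_toLInf F] with x h1
    rw [h1]
    exact norm_extend_le F x

theorem mulC_apply (F : C(Icc (0 : ℝ) ℓ, ℝ)) (f : L2 0 ℓ) : mulC F f = mulOp (toLInf F) f := rfl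

theorem coeFn_mulC (F : C(Icc (0 : ℝ) ℓ, ℝ)) (f : L2 0 ℓ) :
    mulC F f =ᵐ[volume.restrict (Ioo 0 ℓ)] fun x => extend F x * f x := by
  filter_upwards [coeFn_mulOp (toLInf F) f, coeFn_toLInf F] with x h1 h2
  rw [mulC_apply, h1, h2]

theorem extend_mul (F G : C(Icc (0 : ℝ) ℓ, ℝ)) (x : ℝ) :
    extend (F * G) x = extend F x * extend G x := by
  by_cases h : x ∈ Icc 0 ℓ <;> simp [extend, h]

theorem mulC_mul (F G : C(Icc (0 : ℝ) ℓ, ℝ)) (f : L2 0 ℓ) : mulC (F * G) f = mulC F (mulC G f) := by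
  apply Lp.ext
  filter_upwards [coeFn_mulC (F * G) f, coeFn_mulC F (mulC G f), coeFn_mulC G f] with x h1 h2 h3
  rw [h1, h2, h3, extend_mul, mul_assoc]

theorem mulC_embed (F G : C(Icc (0 : ℝ) ℓ, ℝ)) : mulC F (embed ℓ ℝ G) = embed ℓ ℝ (F * G) := by
  apply Lp.ext
  filter_upwards [coeFn_mulC F (embed ℓ ℝ G), coeFn_embed G, coeFn_embed (F * G)] with x h1 h2 h3
  rw [h1, h2, h3, extend_mul]

theorem mulC_one (f : L2 0 ℓ) : mulC 1 f = f := by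
  apply Lp.ext
  filter_upwards [coeFn_mulC 1 f, ae_restrict_mem measurableSet_Ioo] with x h1 hx
  rw [h1, extend_apply _ (Ioo_subset_Icc_self hx), ContinuousMap.one_apply, one_mul]

end Mul

/-! ### The energy space -/

section EnergySpace

theorem dx_eq_volterra (hℓ : 0 < ℓ) (v : V ℓ) :
    dx 0 v = volterra ℓ ℝ (dx 1 v) ∧ dx 1 v = volterra ℓ ℝ (dx 2 v) :=
  ⟨HasWeakDeriv.eq_volterra hℓ (v.1.2 0) v.2.1, HasWeakDeriv.eq_volterra hℓ (v.1.2 1) v.2.2⟩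

theorem dx_zero_eq_potential (hℓ : 0 < ℓ) (v : V ℓ) : dx 0 v = potential ℓ (dx 2 v) := by
  rw [(dx_eq_volterra hℓ v).1, (dx_eq_volterra hℓ v).2]
  rfl

variable (ℓ) in
/-- `w ↦ (v, v', v'')` where `v'' = w` and `v(0) = v'(0) = 0`. -/
def jetOfCurvature : L2 0 ℓ →L[ℝ] PiLp 2 fun _ : Fin (2 + 1) => L2 0 ℓ :=
  ((PiLp.continuousLinearEquiv 2 ℝ fun _ : Fin (2 + 1) => L2 0 ℓ).symm :
      (Fin (2 + 1) → L2 0 ℓ) →L[ℝ] PiLp 2 fun _ : Fin (2 + 1) => L2 0 ℓ) ∘L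
    ContinuousLinearMap.pi ![potential ℓ, volterra ℓ ℝ, .id ℝ _]

theorem jetOfCurvature_mem (hℓ : 0 ≤ ℓ) (w : L2 0 ℓ) : jetOfCurvature ℓ w ∈ Sobolev 2 0 ℓ := by
  intro i
  fin_cases i
  · exact hasWeakDeriv_volterra hℓ (volterra ℓ ℝ w)
  · exact hasWeakDeriv_volterra hℓ w

/-- The element of the energy space with given curvature. -/
def ofCurvature (hℓ : 0 ≤ ℓ) : L2 0 ℓ →L[ℝ] V ℓ :=
  ((jetOfCurvature ℓ).codRestrict (Sobolev 2 0 ℓ) (jetOfCurvature_mem hℓ)).codRestrict (V ℓ)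
    fun w => ⟨hasTrace_volterra hℓ (volterra ℓ ℝ w), hasTrace_volterra hℓ w⟩

/-- `dx` as a continuous linear map. -/
def dxL (i : Fin 3) : V ℓ →L[ℝ] L2 0 ℓ :=
  PiLp.proj 2 (fun _ : Fin (2 + 1) => L2 0 ℓ) i ∘L (Sobolev 2 0 ℓ).subtypeL ∘L (V ℓ).subtypeL

theorem dx_zero_ofCurvature (hℓ : 0 ≤ ℓ) (w : L2 0 ℓ) : dx 0 (ofCurvature hℓ w) = potential ℓ w := rfl

theorem dx_two_ofCurvature (hℓ : 0 ≤ ℓ) (w : L2 0 ℓ) : dx 2 (ofCurvature hℓ w) = w := rfl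

/-- The clamped conditions remove both integration constants; together with `dx_two_ofCurvature`
this identifies the energy space with L²(0,ℓ). -/
theorem ofCurvature_dx (hℓ : 0 < ℓ) (v : V ℓ) : ofCurvature hℓ.le (dx 2 v) = v := by
  apply Subtype.ext
  apply Subtype.ext
  refine PiLp.ext fun i => ?_
  fin_cases i
  · exact (dx_zero_eq_potential hℓ v).symm
  · exact (dx_eq_volterra hℓ v).2.symm
  · rfl

theorem hasTrace_dx_zero (hℓ : 0 < ℓ) (v : V ℓ) :
    HasTrace 0 ℓ (dx 0 v) ℓ (inner ℝ (load ℓ) (dx 2 v)) := by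
  have := hasTrace_embed (volterraC ℓ ℝ (dx 1 v)) (right_mem_Icc.2 hℓ.le)
  rw [volterraC_apply, (dx_eq_volterra hℓ v).2] at this
  rw [inner_load, dx_zero_eq_potential hℓ]
  exact this

end EnergySpace

end

section

variable {ℓ T : ℝ}

/-! ### The evolution equation for the curvature -/

section CompLp

variable {E F G : Type*} [NormedAddCommGroup E] [NormedSpace ℝ E] [NormedAddCommGroup F]
  [NormedSpace ℝ F] [NormedAddCommGroup G] [NormedSpace ℝ G]

theorem comp_compLp (A : F →L[ℝ] G) (B : E →L[ℝ] F) (f : L2t T E) :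
    (A ∘L B).compLp f = A.compLp (B.compLp f) := by
  apply Lp.ext
  filter_upwards [(A ∘L B).coeFn_compLp f, A.coeFn_compLp (B.compLp f), B.coeFn_compLp f]
    with t h1 h2 h3
  rw [h1, h2, h3]
  rfl

theorem compLp_injective {A : E →L[ℝ] F} (hA : Function.Injective A) :
    Function.Injective (A.compLp : L2t T E → L2t T F) := by
  intro f g h
  apply Lp.ext
  filter_upwards [A.coeFn_compLp f, A.coeFn_compLp g] with t h1 h2
  exact hA (by rw [← h1, ← h2, h])

theorem compLp_sub (A : E →L[ℝ] F) (f g : L2t T E) :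
    A.compLp (f - g) = A.compLp f - A.compLp g :=
  map_sub (A.compLpL 2 (volume.restrict (Ioo 0 T))) f g

theorem inner_adjoint_compLp {H : Type*} [NormedAddCommGroup H] [InnerProductSpace ℝ H]
    [CompleteSpace H] (A B : H →L[ℝ] H) (f g : L2t T H) :
    inner ℝ ((ContinuousLinearMap.adjoint A ∘L B).compLp f) g
      = inner ℝ (B.compLp f) (A.compLp g) := by
  rw [MeasureTheory.L2.inner_def, MeasureTheory.L2.inner_def]
  refine integral_congr_ae ?_
  filter_upwards [(ContinuousLinearMap.adjoint A ∘L B).coeFn_compLp f, B.coeFn_compLp f,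
    A.coeFn_compLp g] with t h1 h2 h3
  rw [h1, h2, h3, ContinuousLinearMap.comp_apply, ContinuousLinearMap.adjoint_inner_left]

end CompLp

/-! ### The beam equation as an operator equation in L²(0,ℓ) -/

section Reduced

variable (rho mu : LInf 0 ℓ) (r κ : C(Icc (0 : ℝ) ℓ, ℝ))

/-- The inertia operator, acting on the acceleration. -/
def inertia : L2 0 ℓ →L[ℝ] L2 0 ℓ := ContinuousLinearMap.adjoint (potential ℓ) ∘L mulOp rho

/-- The damping operator, acting on the curvature of the velocity. -/
def damping : L2 0 ℓ →L[ℝ] L2 0 ℓ :=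
  ContinuousLinearMap.adjoint (potential ℓ) ∘L mulOp mu ∘L potential ℓ + mulC κ

/-- The beam equation in terms of the acceleration `q = u_tt` and of the curvature `w = u_xxt` of the
velocity. -/
structure IsReduced (g : L2 0 T) (q w : L2t T (L2 0 ℓ)) : Prop where
  compat : (potential ℓ).compLp w = volterra T (L2 0 ℓ) q
  eqn : (inertia rho).compLp q + (damping mu κ).compLp w
      + (mulC r).compLp (volterra T (L2 0 ℓ) w)
    = (ContinuousLinearMap.toSpanSingleton ℝ (load ℓ)).compLp g

variable {rho mu r κ}

theorem IsReduced.sub {g g' : L2 0 T} {q w q' w' : L2t T (L2 0 ℓ)}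
    (h : IsReduced rho mu r κ g q w) (h' : IsReduced rho mu r κ g' q' w') :
    IsReduced rho mu r κ (g - g') (q - q') (w - w') where
  compat := by rw [compLp_sub, h.compat, h'.compat, map_sub]
  eqn := by
    rw [map_sub, compLp_sub, compLp_sub, compLp_sub, compLp_sub, ← h.eqn, ← h'.eqn]
    abel

/-- The coefficients do not depend on time, so J may be applied to the whole equation. -/
theorem IsReduced.integrate {g : L2 0 T} {q w : L2t T (L2 0 ℓ)}
    (h : IsReduced rho mu r κ g q w) :
    IsReduced rho mu r κ (volterra T ℝ g) (volterra T (L2 0 ℓ) q) (volterra T (L2 0 ℓ) w) where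
  compat := by rw [← volterra_compLp, h.compat]
  eqn := by
    have e := congrArg (volterra T (L2 0 ℓ)) h.eqn
    rwa [map_add, map_add, volterra_compLp, volterra_compLp, volterra_compLp,
      volterra_compLp] at e

variable {rho0 rho1 mu0 r0 k : ℝ}

/-- Coercivity comes from the Kelvin–Voigt term alone; external damping only adds a nonnegative
term. -/
theorem damping_ge (hmu : ∀ᵐ x ∂(volume.restrict (Ioo 0 ℓ)), 0 ≤ mu x)
    (hκ : ∀ᵐ x ∂(volume.restrict (Ioo 0 ℓ)), k ≤ embed ℓ ℝ κ x) (w : L2 0 ℓ) :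
    k * ‖w‖ ^ 2 ≤ inner ℝ (damping mu κ w) w := by
  have h1 : 0 ≤ inner ℝ (mulOp mu (potential ℓ w)) (potential ℓ w) :=
    (mulOp_isPositive hmu).inner_nonneg_left _
  have h2 : k * ‖w‖ ^ 2 ≤ inner ℝ (mulC κ w) w := by
    refine le_inner_mulOp ?_ w
    filter_upwards [hκ, coeFn_toLInf κ, coeFn_embed κ] with x h1 h2 h3
    rwa [h2, ← h3]
  rw [damping, add_apply, inner_add_left, ContinuousLinearMap.comp_apply,
    ContinuousLinearMap.comp_apply, ContinuousLinearMap.adjoint_inner_left]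
  linarith

theorem mulC_isPositive (hr : ∀ᵐ x ∂(volume.restrict (Ioo 0 ℓ)), 0 ≤ embed ℓ ℝ r x) :
    (mulC r).IsPositive := by
  refine mulOp_isPositive ?_
  filter_upwards [hr, coeFn_toLInf r, coeFn_embed r] with x h1 h2 h3
  rwa [h2, ← h3]

/-- Pair the equation with w. By compatibility the inertia term is ⟨ρq, Jq⟩ ≥ 0, the elastic term is
nonnegative too, and Kelvin–Voigt damping leaves k‖w‖² ≤ 0. Then Jq = Pw = 0. -/
theorem IsReduced.eq_zero (hT : 0 ≤ T) (hrho : ∀ᵐ x ∂(volume.restrict (Ioo 0 ℓ)), 0 ≤ rho x)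
    (hmu : ∀ᵐ x ∂(volume.restrict (Ioo 0 ℓ)), 0 ≤ mu x)
    (hr : ∀ᵐ x ∂(volume.restrict (Ioo 0 ℓ)), 0 ≤ embed ℓ ℝ r x)
    (hk : 0 < k) (hκ : ∀ᵐ x ∂(volume.restrict (Ioo 0 ℓ)), k ≤ embed ℓ ℝ κ x)
    {q w : L2t T (L2 0 ℓ)} (h : IsReduced rho mu r κ 0 q w) : q = 0 ∧ w = 0 := by
  have e := congrArg (fun z => inner ℝ z w) h.eqn
  have e0 : (ContinuousLinearMap.toSpanSingleton ℝ (load ℓ)).compLp (0 : L2 0 T) = 0 :=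
    map_zero ((ContinuousLinearMap.toSpanSingleton ℝ (load ℓ)).compLpL 2
      (volume.restrict (Ioo 0 T)))
  simp only [inner_add_left, inertia, inner_adjoint_compLp, e0, inner_zero_left] at e
  rw [h.compat] at e
  have h1 := inner_compLp_volterra_nonneg (mulOp_isPositive hrho) q
  have h2 := inner_compLp_self_ge (damping_ge hmu hκ) w
  have h3 := inner_volterra_compLp_nonneg (mulC_isPositive hr) w
  have h4 : ‖w‖ ^ 2 ≤ 0 := by
    by_contra! hc
    nlinarith [mul_pos hk hc]
  have hw : w = 0 := by
    rw [← norm_eq_zero]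
    exact pow_eq_zero_iff two_ne_zero |>.1 (le_antisymm h4 (sq_nonneg _))
  refine ⟨volterra_injective hT ?_, hw⟩
  rw [← h.compat, hw, map_zero]
  exact map_zero ((potential ℓ).compLpL 2 (volume.restrict (Ioo 0 T)))

theorem IsReduced.unique (hT : 0 ≤ T) (hrho : ∀ᵐ x ∂(volume.restrict (Ioo 0 ℓ)), 0 ≤ rho x)
    (hmu : ∀ᵐ x ∂(volume.restrict (Ioo 0 ℓ)), 0 ≤ mu x)
    (hr : ∀ᵐ x ∂(volume.restrict (Ioo 0 ℓ)), 0 ≤ embed ℓ ℝ r x)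
    (hk : 0 < k) (hκ : ∀ᵐ x ∂(volume.restrict (Ioo 0 ℓ)), k ≤ embed ℓ ℝ κ x)
    {g : L2 0 T} {q w q' w' : L2t T (L2 0 ℓ)} (h : IsReduced rho mu r κ g q w)
    (h' : IsReduced rho mu r κ g q' w') : q = q' ∧ w = w' := by
  have hs := h.sub h'
  rw [sub_self] at hs
  have := hs.eq_zero hT hrho hmu hr hk hκ
  exact ⟨sub_eq_zero.1 this.1, sub_eq_zero.1 this.2⟩

theorem inertia_comp_isPositive (hrho : ∀ᵐ x ∂(volume.restrict (Ioo 0 ℓ)), 0 ≤ rho x) :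
    (inertia rho ∘L potential ℓ).IsPositive := by
  rw [inertia, ContinuousLinearMap.comp_assoc]
  exact (mulOp_isPositive hrho).adjoint_conj (potential ℓ)

/-- Existence of a solution whose acceleration takes values in the energy space. -/
theorem exists_isReduced (hrho : ∀ᵐ x ∂(volume.restrict (Ioo 0 ℓ)), 0 ≤ rho x)
    (hmu : ∀ᵐ x ∂(volume.restrict (Ioo 0 ℓ)), 0 ≤ mu x)
    (hr : ∀ᵐ x ∂(volume.restrict (Ioo 0 ℓ)), 0 ≤ embed ℓ ℝ r x)
    (hk : 0 < k) (hκ : ∀ᵐ x ∂(volume.restrict (Ioo 0 ℓ)), k ≤ embed ℓ ℝ κ x) (h : L2 0 T) :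
    ∃ f : L2t T (L2 0 ℓ), IsReduced rho mu r κ (volterra T ℝ h) ((potential ℓ).compLp f)
      (volterra T (L2 0 ℓ) f) := by
  -- With q = Pf and w = Jf compatibility is automatic, and the inertia becomes the positive
  -- operator P*ρP.
  obtain ⟨f, hf⟩ := exists_evolution (T := T) (M := inertia rho ∘L potential ℓ)
    (K := damping mu κ) (R := mulC r)
    (inertia_comp_isPositive hrho) (mulC_isPositive hr) hk
    (damping_ge hmu hκ) ((ContinuousLinearMap.toSpanSingleton ℝ (load ℓ)).compLp h)
  refine ⟨f, (volterra_compLp _ _).symm, ?_⟩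
  rw [← comp_compLp, hf, volterra_compLp]

end Reduced

/-! ### Weak solutions and the reduced equation -/

section WeakSolution

set_option synthInstance.maxHeartbeats 200000 in
/-- `dx` applied to a function of time. -/
def dxt (i : Fin 3) (u : L2t T (V ℓ)) : L2t T (L2 0 ℓ) :=
  ContinuousLinearMap.compLp (E := V ℓ) (F := L2 0 ℓ) (𝕜 := ℝ) (𝕜' := ℝ) (σ := RingHom.id ℝ)
    (dxL i) u

set_option synthInstance.maxHeartbeats 200000 in
theorem coeFn_dxt (i : Fin 3) (u : L2t T (V ℓ)) :
    dxt i u =ᵐ[volume.restrict (Ioo 0 T)] fun t => dx i ((u : ℝ → V ℓ) t) :=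
  ContinuousLinearMap.coeFn_compLp' _ _

set_option synthInstance.maxHeartbeats 200000 in
/-- `ofCurvature` applied to a function of time. -/
def ofCurvatureT (hℓ : 0 ≤ ℓ) (w : L2t T (L2 0 ℓ)) : L2t T (V ℓ) :=
  ContinuousLinearMap.compLp (E := L2 0 ℓ) (F := V ℓ) (𝕜 := ℝ) (𝕜' := ℝ) (σ := RingHom.id ℝ)
    (ofCurvature hℓ) w

set_option synthInstance.maxHeartbeats 200000 in
theorem coeFn_ofCurvatureT (hℓ : 0 ≤ ℓ) (w : L2t T (L2 0 ℓ)) :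
    (ofCurvatureT hℓ w : ℝ → V ℓ) =ᵐ[volume.restrict (Ioo 0 T)] fun t => ofCurvature hℓ (w t) :=
  ContinuousLinearMap.coeFn_compLp' _ _

theorem HasTrace.comp_continuous {E F : Type*} [NormedAddCommGroup E] [NormedAddCommGroup F]
    {L : E → F} (hL : Continuous L) {a b x : ℝ} {f : ℝ → E} {e : E} (h : HasTrace a b f x e) :
    HasTrace a b (fun t => L (f t)) x (L e) := by
  obtain ⟨G, h1, h2, rfl⟩ := h
  exact ⟨fun t => L (G t), hL.comp_continuousOn h1, h2.mono fun t ht => by simp only [ht], rfl⟩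

variable {B : Coeffs ℓ} {r κ : C(Icc (0 : ℝ) ℓ, ℝ)}

theorem inner_mulC (F : C(Icc (0 : ℝ) ℓ, ℝ)) (f g : L2 0 ℓ) :
    inner ℝ (mulC F f) g = ∫ x in Ioo 0 ℓ, embed ℓ ℝ F x * f x * g x := by
  rw [mulC_apply, inner_mulOp]
  refine integral_congr_ae ?_
  filter_upwards [coeFn_toLInf F, coeFn_embed F] with x h1 h2
  rw [h1, h2]

/-- Each term is moved onto v_xx by P*, and the tip value is ⟨load, v_xx⟩. Since v_xx is arbitrary,
the weak form vanishes for all v exactly when the residual does. -/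
theorem weakForm_eq (hℓ : 0 < ℓ) (hr : embed ℓ ℝ r = wd B.r 0) (hκ : embed ℓ ℝ κ = wd B.kappa 0)
    (v : V ℓ) (q w y : L2 0 ℓ) (c : ℝ) :
    (∫ x in Ioo 0 ℓ, B.rho x * q x * dx 0 v x)
      + (∫ x in Ioo 0 ℓ, B.mu x * potential ℓ w x * dx 0 v x)
      + (∫ x in Ioo 0 ℓ, wd B.r 0 x * y x * dx 2 v x)
      + (∫ x in Ioo 0 ℓ, wd B.kappa 0 x * w x * dx 2 v x)
      - c * traceAt 0 ℓ (dx 0 v) ℓ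
    = inner ℝ (inertia B.rho q + damping B.mu κ w + mulC r y
        - ContinuousLinearMap.toSpanSingleton ℝ (load ℓ) c) (dx 2 v) := by
  rw [(hasTrace_dx_zero hℓ v).traceAt_eq hℓ (right_mem_Icc.2 hℓ.le), ← hr, ← hκ, ← inner_mulOp,
    ← inner_mulOp, ← inner_mulC, ← inner_mulC, dx_zero_eq_potential hℓ v, inner_sub_left,
    inner_add_left, inner_add_left, ContinuousLinearMap.toSpanSingleton_apply,
    real_inner_smul_left, inertia, damping, add_apply, inner_add_left,
    ContinuousLinearMap.comp_apply, ContinuousLinearMap.comp_apply, ContinuousLinearMap.comp_apply,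
    ContinuousLinearMap.adjoint_inner_left, ContinuousLinearMap.adjoint_inner_left]
  ring

theorem IsReduced.ae_eqn {rho mu : LInf 0 ℓ} {g : L2 0 T} {q w : L2t T (L2 0 ℓ)}
    (h : IsReduced rho mu r κ g q w) : ∀ᵐ t ∂(volume.restrict (Ioo 0 T)),
      inertia rho (q t) + damping mu κ (w t) + mulC r (volterra T (L2 0 ℓ) w t)
        = ContinuousLinearMap.toSpanSingleton ℝ (load ℓ) (g t) := by
  have h1 := h.eqn
  filter_upwards [Lp.coeFn_add ((inertia rho).compLp q + (damping mu κ).compLp w)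
      ((mulC r).compLp (volterra T (L2 0 ℓ) w)),
    Lp.coeFn_add ((inertia rho).compLp q) ((damping mu κ).compLp w),
    (inertia rho).coeFn_compLp q, (damping mu κ).coeFn_compLp w,
    (mulC r).coeFn_compLp (volterra T (L2 0 ℓ) w),
    (ContinuousLinearMap.toSpanSingleton ℝ (load ℓ)).coeFn_compLp g] with t e1 e2 e3 e4 e5 e6
  rw [← e6, ← h1, e1, Pi.add_apply, e2, Pi.add_apply, e3, e4, e5]

theorem isReduced_of_ae_eqn {rho mu : LInf 0 ℓ} {g : L2 0 T} {q w : L2t T (L2 0 ℓ)}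
    (hc : (potential ℓ).compLp w = volterra T (L2 0 ℓ) q)
    (h : ∀ᵐ t ∂(volume.restrict (Ioo 0 T)),
      inertia rho (q t) + damping mu κ (w t) + mulC r (volterra T (L2 0 ℓ) w t)
        = ContinuousLinearMap.toSpanSingleton ℝ (load ℓ) (g t)) :
    IsReduced rho mu r κ g q w := by
  refine ⟨hc, Lp.ext ?_⟩
  filter_upwards [h, Lp.coeFn_add ((inertia rho).compLp q + (damping mu κ).compLp w)
      ((mulC r).compLp (volterra T (L2 0 ℓ) w)),
    Lp.coeFn_add ((inertia rho).compLp q) ((damping mu κ).compLp w),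
    (inertia rho).coeFn_compLp q, (damping mu κ).coeFn_compLp w,
    (mulC r).coeFn_compLp (volterra T (L2 0 ℓ) w),
    (ContinuousLinearMap.toSpanSingleton ℝ (load ℓ)).coeFn_compLp g] with t e0 e1 e2 e3 e4 e5 e6
  rw [e6, ← e0, e1, Pi.add_apply, e2, Pi.add_apply, e3, e4, e5]

theorem IsWeakSolutionWith.isReduced (hℓ : 0 < ℓ) (hT : 0 < T) (hr : embed ℓ ℝ r = wd B.r 0)
    (hκ : embed ℓ ℝ κ = wd B.kappa 0) {g : L2 0 T} {u ut : L2t T (V ℓ)} {utt : L2t T (L2 0 ℓ)}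
    (h : IsWeakSolutionWith B g u ut utt) :
    IsReduced B.rho B.mu r κ g utt (dxt 2 ut) ∧
      dxt 2 u = volterra T (L2 0 ℓ) (dxt 2 ut) := by
  have hP : ∀ z : L2t T (V ℓ), (potential ℓ).compLp (dxt 2 z) = dxt 0 z := by
    intro z
    apply Lp.ext
    filter_upwards [(potential ℓ).coeFn_compLp (dxt 2 z), coeFn_dxt 0 z, coeFn_dxt 2 z]
      with t h1 h2 h3
    rw [h1, h2, h3, dx_zero_eq_potential hℓ]
  have c1 : (potential ℓ).compLp (dxt 2 ut) = volterra T (L2 0 ℓ) utt := by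
    rw [hP]
    exact HasWeakDeriv.eq_volterra hT
      (h.deriv_ut.congr (coeFn_dxt 0 ut).symm (ae_eq_refl _))
      (h.init_ut.congr (coeFn_dxt 0 ut).symm)
  -- The time derivative is given only for u itself; injectivity of P lifts the relation to the
  -- curvature.
  have c2 : dxt 2 u = volterra T (L2 0 ℓ) (dxt 2 ut) := by
    apply compLp_injective (potential_injective hℓ.le)
    rw [hP, ← volterra_compLp, hP]
    refine HasWeakDeriv.eq_volterra hT
      (h.deriv_u.congr (coeFn_dxt 0 u).symm (coeFn_dxt 0 ut).symm)
      (HasTrace.congr ?_ (coeFn_dxt 0 u).symm)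
    have := h.init_u.comp_continuous (dxL 0).continuous
    rwa [map_zero] at this
  refine ⟨isReduced_of_ae_eqn c1 ?_, c2⟩
  -- The exceptional null set of times depends on the test function. A finite exponent makes L²(0,ℓ)
  -- separable, so countably many test functions suffice.
  have : Fact ((2 : ℝ≥0∞) ≠ ⊤) := ⟨by norm_num⟩
  set N : ℝ → L2 0 ℓ := fun t => inertia B.rho (utt t) + damping B.mu κ (dxt 2 ut t)
    + mulC r (volterra T (L2 0 ℓ) (dxt 2 ut) t)
    - ContinuousLinearMap.toSpanSingleton ℝ (load ℓ) (g t) with hN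
  have hN0 : N =ᵐ[volume.restrict (Ioo 0 T)] 0 := by
    refine ae_eq_zero_of_forall_inner (𝕜 := ℝ) fun c => ?_
    filter_upwards [h.equation (ofCurvature hℓ.le c), coeFn_dxt 2 ut,
      coeFn_dxt 2 u] with t e1 e2 e3
    rw [Pi.zero_apply, real_inner_comm, ← dx_two_ofCurvature hℓ.le c, hN]
    simp only
    rw [← weakForm_eq hℓ hr hκ, ← c2, e2, e3, ← dx_zero_eq_potential hℓ, e1,
      sub_self]
  filter_upwards [hN0] with t ht
  exact sub_eq_zero.1 ht

theorem IsReduced.isWeakSolutionWith (hℓ : 0 < ℓ) (hT : 0 < T) (hr : embed ℓ ℝ r = wd B.r 0)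
    (hκ : embed ℓ ℝ κ = wd B.kappa 0) {g : L2 0 T} {q w : L2t T (L2 0 ℓ)}
    (h : IsReduced B.rho B.mu r κ g q w) :
    IsWeakSolutionWith B g (ofCurvatureT hℓ.le (volterra T (L2 0 ℓ) w))
      (ofCurvatureT hℓ.le w) q := by
  have hP : ∀ z : L2t T (L2 0 ℓ), (potential ℓ).compLp z =ᵐ[volume.restrict (Ioo 0 T)]
      fun t => dx 0 ((ofCurvatureT hℓ.le z : ℝ → V ℓ) t) := by
    intro z
    filter_upwards [(potential ℓ).coeFn_compLp z, coeFn_ofCurvatureT hℓ.le z] with t h1 h2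
    rw [h1, h2, dx_zero_ofCurvature]
  refine ⟨?_, ?_, fun v => ?_, ?_, ?_⟩
  · refine HasWeakDeriv.congr ?_ (hP _) (hP _)
    rw [← volterra_compLp]
    exact hasWeakDeriv_volterra hT.le _
  · refine HasWeakDeriv.congr ?_ (hP _) (ae_eq_refl _)
    rw [h.compat]
    exact hasWeakDeriv_volterra hT.le _
  · filter_upwards [h.ae_eqn, coeFn_ofCurvatureT hℓ.le (volterra T (L2 0 ℓ) w),
      coeFn_ofCurvatureT hℓ.le w] with t e1 e2 e3
    rw [← sub_eq_zero, e2, e3, dx_two_ofCurvature, dx_two_ofCurvature, dx_zero_ofCurvature,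
      weakForm_eq hℓ hr hκ, e1, sub_self, inner_zero_left]
  · have := (hasTrace_volterra hT.le w).comp_continuous (ofCurvature hℓ.le).continuous
    rw [show ofCurvature hℓ.le 0 = 0 from ofCurvature_dx hℓ 0] at this
    exact this.congr (coeFn_ofCurvatureT hℓ.le _).symm
  · refine HasTrace.congr ?_ (hP w)
    rw [h.compat]
    exact hasTrace_volterra hT.le q

end WeakSolution

end

section

variable {ℓ T : ℝ}

/-! ### Continuity in space of the curvature -/

section Representative

/-- max k F and F are continuous and agree a.e., hence everywhere on the interval. -/
theorem le_of_ae_le_embed (hℓ : 0 < ℓ) {F : C(Icc (0 : ℝ) ℓ, ℝ)} {k : ℝ}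
    (h : ∀ᵐ x ∂(volume.restrict (Ioo 0 ℓ)), k ≤ embed ℓ ℝ F x) (x : Icc (0 : ℝ) ℓ) : k ≤ F x := by
  have hae : (fun x => max k (extend F x)) =ᵐ[volume.restrict (Icc 0 ℓ)] extend F := by
    rw [← restrict_Ioo_eq_restrict_Icc]
    filter_upwards [h, coeFn_embed F] with x h1 h2
    rw [← h2, max_eq_right h1]
  have := Measure.eqOn_Icc_of_ae_eq volume hℓ.ne hae
    (continuousOn_const.sup (continuousOn_extend F)) (continuousOn_extend F) x.2
  simp only [extend_apply F x.2] at this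
  exact max_eq_right_iff.1 this

/-- The integrating factor minus one is a primitive vanishing at 0, the form that integration by
parts accepts. -/
theorem prim_exp_smul (c : C(Icc (0 : ℝ) ℓ, ℝ)) {t : ℝ} (ht : 0 ≤ t) :
    prim (fun s => NormedSpace.exp (s • c) * c) t = NormedSpace.exp (t • c) - 1 := by
  have hd : ∀ s : ℝ, HasDerivAt (fun s : ℝ => NormedSpace.exp (s • c))
      (NormedSpace.exp (s • c) * c) s := fun s => hasDerivAt_exp_smul_const c s
  have hc : Continuous fun s : ℝ => NormedSpace.exp (s • c) * c :=
    (continuous_iff_continuousAt.2 fun s => (hd s).continuousAt).mul continuous_const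
  rw [prim, ← intervalIntegral.integral_of_le ht,
    intervalIntegral.integral_eq_sub_of_hasDerivAt (fun s _ => hd s) (hc.intervalIntegrable _ _),
    zero_smul, NormedSpace.exp_zero]

/-- A linear ordinary differential equation with continuous data has a continuous solution. -/
theorem exists_embed_eq_prim {c : C(Icc (0 : ℝ) ℓ, ℝ)} {n : L2t T C(Icc (0 : ℝ) ℓ, ℝ)}
    {w : L2t T (L2 0 ℓ)} (h : ∀ᵐ t ∂(volume.restrict (Ioo 0 T)),
      w t + mulC c (prim w t) = embed ℓ ℝ (n t)) {t : ℝ} (ht : t ∈ Icc 0 T) :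
    ∃ y : C(Icc (0 : ℝ) ℓ, ℝ), prim w t = embed ℓ ℝ y := by
  set e : ℝ → C(Icc (0 : ℝ) ℓ, ℝ) := fun s => NormedSpace.exp (s • c) with he
  have hec : Continuous e :=
    continuous_iff_continuousAt.2 fun s => (hasDerivAt_exp_smul_const c s).continuousAt
  have hf : IntegrableOn (fun s => e s * c) (Ioc 0 t) :=
    ((hec.mul continuous_const).integrableOn_Icc).mono_set Ioc_subset_Icc_self
  have hw := L2t.integrableOn_of_le w ht.2
  have hn := L2t.integrableOn_of_le n ht.2
  have hew : IntegrableOn (fun s => mulC (e s - 1) (w s)) (Ioc 0 t) := by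
    refine (integrableOn_bilin_prim_left mulC hf hw).congr_fun (fun s hs => ?_) measurableSet_Ioc
    simp only [he]
    rw [prim_exp_smul c hs.1.le]
  have hen : IntegrableOn (fun s => e s * n s) (Ioc 0 t) := by
    obtain ⟨C, hC⟩ := (isCompact_Icc (a := 0) (b := t)).exists_bound_of_continuousOn
      hec.continuousOn
    exact (ContinuousLinearMap.mul ℝ C(Icc (0 : ℝ) ℓ, ℝ)).integrable_of_bilin_of_bdd_left C
      hec.aestronglyMeasurable ((ae_restrict_mem measurableSet_Ioc).mono fun s hs =>
        hC s (Ioc_subset_Icc_self hs)) hn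
  have hp := integral_bilin_prim_add mulC hf hw
  rw [prim_exp_smul c ht.1] at hp
  -- Integrating factor: (e^{tc}y)' = e^{tc}n for y = ∫w. The right side is Bochner integrable with
  -- values in C[0,ℓ], so its integral is continuous in x; the exponential is then inverted.
  have h1 : mulC (e t) (prim w t) = embed ℓ ℝ (prim (fun s => e s * n s) t) := by
    rw [clm_prim _ hen, ← sub_add_cancel (e t) 1, map_add, add_apply, mulC_one, ← hp, prim, prim,
      ← integral_add (integrableOn_bilin_prim_right mulC hf hw)
        (integrableOn_bilin_prim_left mulC hf hw), ← integral_add _ hw]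
    · refine setIntegral_congr_ae measurableSet_Ioc ?_
      rw [← ae_restrict_iff' measurableSet_Ioc]
      have h' : ∀ᵐ s ∂(volume.restrict (Ioc 0 t)),
          w s + mulC c (prim w s) = embed ℓ ℝ (n s) := by
        rw [← restrict_Ioo_eq_restrict_Ioc]
        exact ae_mono (Measure.restrict_mono (Ioo_subset_Ioo_right ht.2) le_rfl) h
      filter_upwards [h', ae_restrict_mem measurableSet_Ioc] with s h1 hs
      rw [prim_exp_smul c hs.1.le, ← mulC_embed, ← h1, map_add, mulC_mul]
      simp only [he, map_sub, sub_apply, mulC_one]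
      abel
    · exact (integrableOn_bilin_prim_right mulC hf hw).add
        (integrableOn_bilin_prim_left mulC hf hw)
  refine ⟨NormedSpace.exp (-(t • c)) * prim (fun s => e s * n s) t, ?_⟩
  rw [← mulC_embed, ← h1, ← mulC_mul, ← NormedSpace.exp_add,
    neg_add_cancel, NormedSpace.exp_zero, mulC_one]

end Representative

/-! ### The bending moment at the clamped end -/

section Moment

variable {rho mu : LInf 0 ℓ} {r κ : C(Icc (0 : ℝ) ℓ, ℝ)}

variable (rho mu) in
/-- The body force `ρ u_tt + μ u_t` in terms of the acceleration and of the curvature of the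
velocity. -/
def bodyForce (q w : L2t T (L2 0 ℓ)) : L2t T (L2 0 ℓ) :=
  (mulOp rho).compLp q + (mulOp mu ∘L potential ℓ).compLp w

theorem coeFn_bodyForce (q w : L2t T (L2 0 ℓ)) :
    bodyForce rho mu q w =ᵐ[volume.restrict (Ioo 0 T)]
      fun t => mulOp rho (q t) + mulOp mu (potential ℓ (w t)) := by
  filter_upwards [Lp.coeFn_add ((mulOp rho).compLp q) ((mulOp mu ∘L potential ℓ).compLp w),
    (mulOp rho).coeFn_compLp q, (mulOp mu ∘L potential ℓ).coeFn_compLp w] with t h1 h2 h3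
  rw [bodyForce, h1, Pi.add_apply, h2, h3]
  rfl

/-- The bending moment at the clamped end. -/
def moment (g : L2 0 T) (z : L2t T (L2 0 ℓ)) : L2 0 T :=
  (innerSL ℝ (volterra ℓ ℝ (embed ℓ ℝ 1))).compLp z - ℓ • g

theorem coeFn_moment (g : L2 0 T) (z : L2t T (L2 0 ℓ)) :
    moment g z =ᵐ[volume.restrict (Ioo 0 T)]
      fun t => inner ℝ (volterra ℓ ℝ (embed ℓ ℝ 1)) (z t) - ℓ * g t := by
  filter_upwards [Lp.coeFn_sub ((innerSL ℝ (volterra ℓ ℝ (embed ℓ ℝ 1))).compLp z) (ℓ • g),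
    (innerSL ℝ (volterra ℓ ℝ (embed ℓ ℝ 1))).coeFn_compLp z, Lp.coeFn_smul ℓ g] with t h1 h2 h3
  rw [moment, h1, Pi.sub_apply, h2, h3, Pi.smul_apply, smul_eq_mul, innerSL_apply_apply]

/-- P* has values in C[0,ℓ], so κw + r∫w is continuous in x. Dividing by κ gives a linear ODE in t
with continuous data, to which `exists_embed_eq_prim` applies. -/
theorem IsReduced.exists_embed_eq (hκ : ∀ x, 0 < κ x) {g : L2 0 T} {q w : L2t T (L2 0 ℓ)}
    (h : IsReduced rho mu r κ g q w) : ∀ᵐ t ∂(volume.restrict (Ioo 0 T)),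
      ∃ y v : C(Icc (0 : ℝ) ℓ, ℝ), volterra T (L2 0 ℓ) w t = embed ℓ ℝ y ∧ w t = embed ℓ ℝ v ∧
        r * y + κ * v = g t • loadC ℓ - potentialStarC ℓ (bodyForce rho mu q w t) := by
  set κi : C(Icc (0 : ℝ) ℓ, ℝ) := ⟨fun x => (κ x)⁻¹, κ.continuous.inv₀ fun x => (hκ x).ne'⟩
  have hi : κi * κ = 1 := by
    ext x
    exact inv_mul_cancel₀ (hκ x).ne'
  set N : L2t T C(Icc (0 : ℝ) ℓ, ℝ) :=
    (ContinuousLinearMap.toSpanSingleton ℝ (loadC ℓ)).compLp g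
      - (potentialStarC ℓ).compLp (bodyForce rho mu q w) with hN
  have hNt : ∀ᵐ t ∂(volume.restrict (Ioo 0 T)),
      N t = g t • loadC ℓ - potentialStarC ℓ (bodyForce rho mu q w t) := by
    filter_upwards [Lp.coeFn_sub ((ContinuousLinearMap.toSpanSingleton ℝ (loadC ℓ)).compLp g)
        ((potentialStarC ℓ).compLp (bodyForce rho mu q w)),
      (ContinuousLinearMap.toSpanSingleton ℝ (loadC ℓ)).coeFn_compLp g,
      (potentialStarC ℓ).coeFn_compLp (bodyForce rho mu q w)] with t h1 h2 h3
    rw [h1, Pi.sub_apply, h2, h3]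
    rfl
  set n : L2t T C(Icc (0 : ℝ) ℓ, ℝ) :=
    (ContinuousLinearMap.mul ℝ C(Icc (0 : ℝ) ℓ, ℝ) κi).compLp N
  have hn : ∀ᵐ t ∂(volume.restrict (Ioo 0 T)), n t = κi * N t :=
    (ContinuousLinearMap.mul ℝ C(Icc (0 : ℝ) ℓ, ℝ) κi).coeFn_compLp N
  have hode : ∀ᵐ t ∂(volume.restrict (Ioo 0 T)),
      w t + mulC (κi * r) (prim w t) = embed ℓ ℝ (n t) := by
    filter_upwards [h.ae_eqn, coeFn_bodyForce (rho := rho) (mu := mu) q w, hn, hNt,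
      coeFn_volterra w] with t e1 e2 e3 e4 e5
    have : mulC κ (w t) + mulC r (prim w t) = embed ℓ ℝ (N t) := by
      rw [e4, map_sub, map_smul, ← adjoint_potential, e2, map_add, eq_sub_iff_add_eq, ← load,
        ← ContinuousLinearMap.toSpanSingleton_apply, ← e1, e5, inertia, damping]
      simp only [add_apply, ContinuousLinearMap.comp_apply]
      abel
    rw [e3, ← mulC_embed, ← this, map_add, ← mulC_mul, ← mulC_mul, hi, mulC_one]
  filter_upwards [hode, hNt, hn, coeFn_volterra w, ae_restrict_mem measurableSet_Ioo]
    with t e1 e2 e3 e4 ht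
  -- The ODE yields continuity of u_xx; that of u_xxt then follows from the equation.
  obtain ⟨y, hy⟩ := exists_embed_eq_prim hode (Ioo_subset_Icc_self ht)
  refine ⟨y, n t - κi * r * y, by rw [e4, hy], ?_, ?_⟩
  · rw [map_sub, ← e1, hy, mulC_embed, add_sub_cancel_right]
  · rw [← e2, e3]
    linear_combination (N t - r * y) * hi

/-- Evaluate the continuous identity at x = 0, where the load is ℓ and P*z is ∫xz dx. -/
theorem IsReduced.ae_moment (hℓ : 0 ≤ ℓ) (hκ : ∀ x, 0 < κ x) {g : L2 0 T} {q w : L2t T (L2 0 ℓ)}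
    (h : IsReduced rho mu r κ g q w) : ∀ᵐ t ∂(volume.restrict (Ioo 0 T)), ∃ a b : ℝ,
      HasTrace 0 ℓ (volterra T (L2 0 ℓ) w t) 0 a ∧ HasTrace 0 ℓ (w t) 0 b ∧
      moment g (bodyForce rho mu q w) t
        = -(r ⟨0, left_mem_Icc.2 hℓ⟩ * a + κ ⟨0, left_mem_Icc.2 hℓ⟩ * b) := by
  filter_upwards [h.exists_embed_eq hκ, coeFn_moment g (bodyForce rho mu q w)] with t ht hm
  obtain ⟨y, v, h1, h2, h3⟩ := ht
  refine ⟨_, _, h1 ▸ hasTrace_embed y (left_mem_Icc.2 hℓ),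
    h2 ▸ hasTrace_embed v (left_mem_Icc.2 hℓ), ?_⟩
  have h4 := DFunLike.congr_fun h3 ⟨0, left_mem_Icc.2 hℓ⟩
  simp only [ContinuousMap.add_apply, ContinuousMap.mul_apply, ContinuousMap.sub_apply,
    ContinuousMap.smul_apply, smul_eq_mul, loadC_apply hℓ, potentialStarC_zero hℓ] at h4
  rw [hm, h4]
  ring

end Moment

end

section

variable {ℓ T : ℝ}

/-! ### Well-posedness of the direct problem -/

section WellPosed

/-- The coefficients satisfy the sign conditions under which the direct problem is well posed; `r`
and `κ` are the continuous representatives of the stiffness and of the Kelvin–Voigt damping. -/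
structure IsDissipative (B : Coeffs ℓ) (r κ : C(Icc (0 : ℝ) ℓ, ℝ)) (k : ℝ) : Prop where
  embed_r : embed ℓ ℝ r = wd B.r 0
  embed_kappa : embed ℓ ℝ κ = wd B.kappa 0
  rho_nonneg : ∀ᵐ x ∂(volume.restrict (Ioo 0 ℓ)), 0 ≤ B.rho x
  mu_nonneg : ∀ᵐ x ∂(volume.restrict (Ioo 0 ℓ)), 0 ≤ B.mu x
  r_nonneg : ∀ᵐ x ∂(volume.restrict (Ioo 0 ℓ)), 0 ≤ embed ℓ ℝ r x
  pos : 0 < k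
  le_kappa : ∀ᵐ x ∂(volume.restrict (Ioo 0 ℓ)), k ≤ embed ℓ ℝ κ x

variable {B : Coeffs ℓ} {r κ : C(Icc (0 : ℝ) ℓ, ℝ)} {k : ℝ} {g : L2 0 T} {q w : L2t T (L2 0 ℓ)}

theorem IsReduced.eq (hT : 0 ≤ T) (hB : IsDissipative B r κ k)
    (h : IsReduced B.rho B.mu r κ g q w) {q' w' : L2t T (L2 0 ℓ)}
    (h' : IsReduced B.rho B.mu r κ g q' w') : q' = q ∧ w' = w :=
  h'.unique hT hB.rho_nonneg hB.mu_nonneg hB.r_nonneg hB.pos hB.le_kappa h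

theorem ofCurvatureT_dxt (hℓ : 0 < ℓ) (u : L2t T (V ℓ)) : ofCurvatureT hℓ.le (dxt 2 u) = u := by
  apply Lp.ext
  filter_upwards [coeFn_ofCurvatureT hℓ.le (dxt 2 u), coeFn_dxt 2 u] with t h1 h2
  rw [h1, h2, ofCurvature_dx hℓ]

/-- Weak and reduced solutions correspond through the curvature, so uniqueness for the reduced
problem is inherited. -/
theorem IsReduced.isWeakSolution_iff (hℓ : 0 < ℓ) (hT : 0 < T) (hB : IsDissipative B r κ k)
    (h : IsReduced B.rho B.mu r κ g q w) (u : L2t T (V ℓ)) :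
    IsWeakSolution B g u ↔ u = ofCurvatureT hℓ.le (volterra T (L2 0 ℓ) w) := by
  constructor
  · rintro ⟨ut, utt, hu⟩
    obtain ⟨h1, h2⟩ := hu.isReduced hℓ hT hB.embed_r hB.embed_kappa
    rw [← (h.eq hT.le hB h1).2, ← h2, ofCurvatureT_dxt hℓ]
  · rintro rfl
    exact ⟨_, _, h.isWeakSolutionWith hℓ hT hB.embed_r hB.embed_kappa⟩

/-- The deflection of the tip in terms of the curvature of the velocity. -/
def deflection (w : L2t T (L2 0 ℓ)) : L2 0 T :=
  (innerSL ℝ (load ℓ)).compLp (volterra T (L2 0 ℓ) w)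

theorem coeFn_deflection (w : L2t T (L2 0 ℓ)) :
    deflection w =ᵐ[volume.restrict (Ioo 0 T)]
      fun t => inner ℝ (load ℓ) (volterra T (L2 0 ℓ) w t) :=
  (innerSL ℝ (load ℓ)).coeFn_compLp (volterra T (L2 0 ℓ) w)

theorem IsReduced.isDeflection_iff (hℓ : 0 < ℓ) (hT : 0 < T) (hB : IsDissipative B r κ k)
    (h : IsReduced B.rho B.mu r κ g q w) (ν : L2 0 T) :
    IsDeflection B g ν ↔ ν = deflection w := by
  have key : ∀ᵐ t ∂(volume.restrict (Ioo 0 T)), HasTrace 0 ℓ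
      (dx 0 ((ofCurvatureT hℓ.le (volterra T (L2 0 ℓ) w) : ℝ → V ℓ) t)) ℓ (deflection w t) := by
    filter_upwards [coeFn_ofCurvatureT hℓ.le (volterra T (L2 0 ℓ) w), coeFn_deflection w]
      with t h1 h2
    rw [h1, h2]
    exact hasTrace_dx_zero hℓ (ofCurvature hℓ.le (volterra T (L2 0 ℓ) w t))
  constructor
  · rintro ⟨u, hu, hν⟩
    rw [h.isWeakSolution_iff hℓ hT hB] at hu
    rw [hu] at hν
    apply Lp.ext
    filter_upwards [hν, key] with t h1 h2
    exact h1.unique hℓ (right_mem_Icc.2 hℓ.le) h2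
  · rintro rfl
    exact ⟨_, (h.isWeakSolution_iff hℓ hT hB _).2 rfl, key⟩

theorem IsReduced.isMoment_iff (hℓ : 0 < ℓ) (hT : 0 < T) (hB : IsDissipative B r κ k)
    (h : IsReduced B.rho B.mu r κ g q w) (m : L2 0 T) :
    IsMoment B g m ↔ m = moment g (bodyForce B.rho B.mu q w) := by
  have hκ : ∀ x, 0 < κ x := fun x => hB.pos.trans_le (le_of_ae_le_embed hℓ hB.le_kappa x)
  have h0 : (0 : ℝ) ∈ Icc 0 ℓ := left_mem_Icc.2 hℓ.le
  have er : traceAt 0 ℓ (wd B.r 0) 0 = r ⟨0, h0⟩ := by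
    rw [← hB.embed_r]
    exact (hasTrace_embed r h0).traceAt_eq hℓ h0
  have eκ : traceAt 0 ℓ (wd B.kappa 0) 0 = κ ⟨0, h0⟩ := by
    rw [← hB.embed_kappa]
    exact (hasTrace_embed κ h0).traceAt_eq hℓ h0
  unfold IsMoment
  rw [er, eκ]
  constructor
  · rintro ⟨u, ut, utt, hu, hm⟩
    obtain ⟨h1, h2⟩ := hu.isReduced hℓ hT hB.embed_r hB.embed_kappa
    have h3 := (h.eq hT.le hB h1).2
    apply Lp.ext
    filter_upwards [hm, h.ae_moment hℓ.le hκ, coeFn_dxt 2 u, coeFn_dxt 2 ut] with t e1 e2 e3 e4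
    obtain ⟨a, b, ha, hb, e⟩ := e1
    obtain ⟨a', b', ha', hb', e'⟩ := e2
    rw [← e3, h2, h3] at ha
    rw [← e4, h3] at hb
    rw [e, e', ha.unique hℓ h0 ha', hb.unique hℓ h0 hb']
  · rintro rfl
    refine ⟨_, _, q, h.isWeakSolutionWith hℓ hT hB.embed_r hB.embed_kappa, ?_⟩
    filter_upwards [h.ae_moment hℓ.le hκ, coeFn_ofCurvatureT hℓ.le (volterra T (L2 0 ℓ) w),
      coeFn_ofCurvatureT hℓ.le w] with t e2 e3 e4
    obtain ⟨a, b, ha, hb, e⟩ := e2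
    exact ⟨a, b, by rwa [e3, dx_two_ofCurvature], by rwa [e4, dx_two_ofCurvature], e⟩

/-- Exactly one deflection exists, so the arbitrary choice in `Phi` is forced. -/
theorem IsReduced.Phi_eq (hℓ : 0 < ℓ) (hT : 0 < T) (hB : IsDissipative B r κ k)
    (h : IsReduced B.rho B.mu r κ g q w) : Phi B g = deflection w :=
  (h.isDeflection_iff hℓ hT hB _).1
    (Classical.epsilon_spec ⟨_, (h.isDeflection_iff hℓ hT hB _).2 rfl⟩)

theorem IsReduced.Psi_eq (hℓ : 0 < ℓ) (hT : 0 < T) (hB : IsDissipative B r κ k)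
    (h : IsReduced B.rho B.mu r κ g q w) : Psi B g = moment g (bodyForce B.rho B.mu q w) :=
  (h.isMoment_iff hℓ hT hB _).1
    (Classical.epsilon_spec ⟨_, (h.isMoment_iff hℓ hT hB _).2 rfl⟩)

theorem IsDissipative.exists_isReduced (hB : IsDissipative B r κ k) (h : L2 0 T) :
    ∃ f : L2t T (L2 0 ℓ), IsReduced B.rho B.mu r κ (volterra T ℝ h) ((potential ℓ).compLp f)
      (volterra T (L2 0 ℓ) f) :=
  Beam.exists_isReduced hB.rho_nonneg hB.mu_nonneg hB.r_nonneg hB.pos hB.le_kappa h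

theorem IsReduced.existsUnique (hℓ : 0 < ℓ) (hT : 0 < T) (hB : IsDissipative B r κ k)
    (h : IsReduced B.rho B.mu r κ g q w) :
    (∃! u : L2t T (V ℓ), IsWeakSolution B g u) ∧ (∃! ν : L2 0 T, IsDeflection B g ν) ∧
      ∃! m : L2 0 T, IsMoment B g m := by
  simp only [h.isWeakSolution_iff hℓ hT hB, h.isDeflection_iff hℓ hT hB,
    h.isMoment_iff hℓ hT hB, existsUnique_eq, and_self]

end WellPosed

end

section

variable {ℓ T : ℝ}

/-! ### A priori estimates -/

section Estimates

theorem norm_sq_volterra {H : Type*} [NormedAddCommGroup H] [InnerProductSpace ℝ H]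
    [CompleteSpace H] (f : L2t T H) :
    ‖volterra T H f‖ ^ 2 = prim (fun s => ‖prim f s‖ ^ 2) T := by
  rw [L2t.norm_sq_eq]
  exact prim_congr ((coeFn_volterra f).mono fun s hs => by simp only [hs]) le_rfl

theorem inner_compLp_self {H : Type*} [NormedAddCommGroup H] [InnerProductSpace ℝ H]
    [CompleteSpace H] (A : H →L[ℝ] H) (f : L2t T H) :
    inner ℝ (A.compLp f) f = prim (fun s => inner ℝ (A (f s)) (f s)) T := by
  rw [L2t.inner_eq]
  exact prim_congr ((A.coeFn_compLp f).mono fun s hs => by simp only [hs]) le_rfl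

/-- The coefficients satisfy the bounds of the direct problem. -/
structure IsBounded (B : Coeffs ℓ) (r κ : C(Icc (0 : ℝ) ℓ, ℝ)) (rho0 rho1 mu1 r0 r1 k : ℝ) : Prop
    extends IsDissipative B r κ k where
  rho0_pos : 0 < rho0
  r0_pos : 0 < r0
  r1_nonneg : 0 ≤ r1
  rho_bound : ∀ᵐ x ∂(volume.restrict (Ioo 0 ℓ)), rho0 ≤ B.rho x ∧ B.rho x ≤ rho1
  mu_le : ∀ᵐ x ∂(volume.restrict (Ioo 0 ℓ)), B.mu x ≤ mu1
  r_bound : ∀ᵐ x ∂(volume.restrict (Ioo 0 ℓ)), r0 ≤ embed ℓ ℝ r x ∧ embed ℓ ℝ r x ≤ r1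

variable {B : Coeffs ℓ} {r κ : C(Icc (0 : ℝ) ℓ, ℝ)} {rho0 rho1 mu1 r0 r1 k : ℝ}
  {h : L2 0 T} {f : L2t T (L2 0 ℓ)}

theorem IsReduced.ae_prim {rho mu : LInf 0 ℓ} (hf : IsReduced rho mu r κ (volterra T ℝ h)
    ((potential ℓ).compLp f) (volterra T (L2 0 ℓ) f)) : ∀ᵐ t ∂(volume.restrict (Ioo 0 T)),
    (inertia rho ∘L potential ℓ) (f t) + damping mu κ (prim f t) + mulC r (prim (prim f) t)
      = prim h t • load ℓ := by
  filter_upwards [hf.ae_eqn, (potential ℓ).coeFn_compLp f, coeFn_volterra f,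
    coeFn_volterra (volterra T (L2 0 ℓ) f), coeFn_volterra h, ae_restrict_mem measurableSet_Ioo]
    with t h1 h2 h3 h4 h5 ht
  rw [h2, h3, h4, h5, prim_congr (coeFn_volterra f) ht.2.le] at h1
  exact h1

theorem IsBounded.le_inner_mulC (hB : IsBounded B r κ rho0 rho1 mu1 r0 r1 k) (x : L2 0 ℓ) :
    r0 * ‖x‖ ^ 2 ≤ inner ℝ (mulC r x) x := by
  refine le_inner_mulOp ?_ x
  filter_upwards [hB.r_bound, coeFn_toLInf r, coeFn_embed r] with x h1 h2 h3
  rw [h2, ← h3]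
  exact h1.1

theorem IsBounded.norm_mulC_le (hB : IsBounded B r κ rho0 rho1 mu1 r0 r1 k) (x : L2 0 ℓ) :
    ‖mulC r x‖ ≤ r1 * ‖x‖ := by
  refine norm_mulOp_le ?_ x
  filter_upwards [hB.r_bound, coeFn_toLInf r, coeFn_embed r] with x h1 h2 h3
  rw [h2, ← h3]
  exact abs_le.2 ⟨by linarith [h1.1, h1.2, hB.r0_pos], h1.2⟩

theorem damping_isSymmetric (mu : LInf 0 ℓ) (κ : C(Icc (0 : ℝ) ℓ, ℝ)) :
    (damping mu κ).IsSymmetric := by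
  intro x y
  have h1 := mulOp_isSymmetric mu (potential ℓ x) (potential ℓ y)
  have h2 := mulOp_isSymmetric (toLInf κ) x y
  simp only [ContinuousLinearMap.coe_coe] at h1 h2 ⊢
  simp only [damping, add_apply, inner_add_left, inner_add_right, ContinuousLinearMap.comp_apply,
    ContinuousLinearMap.adjoint_inner_left, ContinuousLinearMap.adjoint_inner_right, mulC_apply,
    h1, h2]

/-- `prim_potential_le` at t = T with the load of squared norm ℓ³/3, combined with r ≥ r₀. -/
theorem norm_sq_curvature_le (hT : 0 ≤ T) (hℓ : 0 < ℓ)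
    (hB : IsBounded B r κ rho0 rho1 mu1 r0 r1 k)
    (hf : IsReduced B.rho B.mu r κ (volterra T ℝ h) ((potential ℓ).compLp f)
      (volterra T (L2 0 ℓ) f)) :
    r0 * ‖volterra T (L2 0 ℓ) (volterra T (L2 0 ℓ) f)‖ ^ 2
      ≤ 4 * (ℓ ^ 3 / 3) / r0 * (1 + T) * ‖h‖ ^ 2 * C0sq T := by
  have h1 := prim_potential_le hT (R := mulC r) (inertia_comp_isPositive hB.rho_nonneg)

    (mulOp_isSymmetric (toLInf r)) hB.r0_pos hB.le_inner_mulC hB.pos.le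
    (damping_ge hB.mu_nonneg hB.le_kappa) (by positivity) (norm_load_sq hℓ.le).le hf.ae_prim
    (right_mem_Icc.2 hT)
  have hy := continuousOn_position f
  have h2 : r0 * ‖volterra T (L2 0 ℓ) (volterra T (L2 0 ℓ) f)‖ ^ 2
      ≤ prim (fun s => inner ℝ (mulC r (prim (prim f) s)) (prim (prim f) s)) T := by
    rw [norm_sq_volterra, ← prim_const_mul]
    refine (prim_congr ?_ le_rfl).trans_le (prim_mono le_rfl (integrableOn_of_continuousOn le_rfl
        (continuousOn_const.mul (hy.norm.pow 2)))
      (integrableOn_of_continuousOn le_rfl (((mulC r).continuous.comp_continuousOn hy).inner hy)) fun s _ => hB.le_inner_mulC _)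
    filter_upwards [ae_restrict_mem measurableSet_Ioo] with s hs
    rw [prim_congr (coeFn_volterra f) hs.2.le]
    rfl
  rw [C0sq]
  linarith

theorem norm_sq_velocity_le (hT : 0 ≤ T) (hℓ : 0 < ℓ)
    (hB : IsBounded B r κ rho0 rho1 mu1 r0 r1 k)
    (hf : IsReduced B.rho B.mu r κ (volterra T ℝ h) ((potential ℓ).compLp f)
      (volterra T (L2 0 ℓ) f)) :
    4 * k * ‖volterra T (L2 0 ℓ) f‖ ^ 2
      ≤ 4 * (ℓ ^ 3 / 3) / r0 * (1 + T) * ‖h‖ ^ 2 * (C0sq T + 1) := by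
  have h0 := energy_le hT (R := mulC r) (inertia_comp_isPositive hB.rho_nonneg)

    (mulOp_isSymmetric (toLInf r)) hB.r0_pos hB.le_inner_mulC
    (damping_ge hB.mu_nonneg hB.le_kappa) (by positivity) (norm_load_sq hℓ.le).le hf.ae_prim
    (right_mem_Icc.2 hT)
  have h1 := prim_potential_le hT (R := mulC r) (inertia_comp_isPositive hB.rho_nonneg)

    (mulOp_isSymmetric (toLInf r)) hB.r0_pos hB.le_inner_mulC hB.pos.le
    (damping_ge hB.mu_nonneg hB.le_kappa) (by positivity) (norm_load_sq hℓ.le).le hf.ae_prim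
    (right_mem_Icc.2 hT)
  have h2 := (mulC_isPositive hB.r_nonneg).inner_nonneg_left (prim (prim f) T)
  rw [norm_sq_volterra, C0sq, sub_add_cancel]
  exact (le_trans (le_add_of_nonneg_left h2) h0).trans h1

theorem norm_sq_acceleration_le (hT : 0 ≤ T) (hℓ : 0 < ℓ)
    (hB : IsBounded B r κ rho0 rho1 mu1 r0 r1 k)
    (hf : IsReduced B.rho B.mu r κ (volterra T ℝ h) ((potential ℓ).compLp f)
      (volterra T (L2 0 ℓ) f)) (rho1' mu1' k1 : ℝ) :
    rho0 * ‖(potential ℓ).compLp f‖ ^ 2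
      ≤ C1sq ℓ T rho1' mu1' r0 r1 k k1 / 2 * ((1 + T) * ℓ ^ 3) * ‖h‖ ^ 2 := by
  have hk := hB.pos
  have hr0 := hB.r0_pos
  -- ε is chosen so that εβ/(8k) = ℓ³/(16(ℓ³ + 3)) with β = ℓ³/3, and 1/(2ε) = (ℓ³ + 3)/(3k), as in
  -- R₁ and R₂.
  have h1 := prim_acceleration_le hT (R := mulC r) (inertia_comp_isPositive hB.rho_nonneg)
    (damping_isSymmetric B.mu κ) (mulOp_isSymmetric (toLInf r)) hB.r0_pos hB.le_inner_mulC
    hB.r1_nonneg hB.norm_mulC_le hk (damping_ge hB.mu_nonneg hB.le_kappa) (by positivity)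
    (norm_load_sq hℓ.le).le hf.ae_prim (ε := 3 * k / (2 * (ℓ ^ 3 + 3))) (by positivity)
  have h2 : rho0 * ‖(potential ℓ).compLp f‖ ^ 2
      ≤ prim (fun s => inner ℝ ((inertia B.rho ∘L potential ℓ) (f s)) (f s)) T := by
    rw [← inner_compLp_self, inertia, ContinuousLinearMap.comp_assoc, inner_adjoint_compLp,
      comp_compLp]
    exact inner_compLp_self_ge (fun x => le_inner_mulOp (hB.rho_bound.mono fun x hx => hx.1) x) _
  -- Of the maximum defining C₁², the entry R₂ already suffices.
  have h3 : R2 ℓ T r0 r1 k ≤ C1sq ℓ T rho1' mu1' r0 r1 k k1 :=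
    (le_max_left _ _).trans (le_max_left _ _)
  refine h2.trans (h1.trans ?_)
  -- R₂ exceeds the constant just derived by the nonnegative remainder in the last summand.
  have h4 : R2 ℓ T r0 r1 k / 2 * ((1 + T) * ℓ ^ 3)
      = 4 * (ℓ ^ 3 / 3) / r0 * (1 + T) * Real.exp T
          * (r1 ^ 2 / (r0 * k) + r1 / (4 * k)
            + 3 * k / (2 * (ℓ ^ 3 + 3)) * (ℓ ^ 3 / 3) / (8 * k))
        + (ℓ ^ 3 / 3 * T / k + 1 / (2 * (3 * k / (2 * (ℓ ^ 3 + 3)))))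
        + (Real.exp T * (1 + T) * ℓ ^ 6 * (4 * r1 ^ 2) / (9 * r0 ^ 2 * k) + T / k) := by
    rw [R2, R1, C0sq]
    field_simp
    ring
  calc _ = (4 * (ℓ ^ 3 / 3) / r0 * (1 + T) * Real.exp T
          * (r1 ^ 2 / (r0 * k) + r1 / (4 * k)
            + 3 * k / (2 * (ℓ ^ 3 + 3)) * (ℓ ^ 3 / 3) / (8 * k))
        + (ℓ ^ 3 / 3 * T / k + 1 / (2 * (3 * k / (2 * (ℓ ^ 3 + 3)))))) * ‖h‖ ^ 2 := by ring
    _ ≤ R2 ℓ T r0 r1 k / 2 * ((1 + T) * ℓ ^ 3) * ‖h‖ ^ 2 := by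
      rw [h4]
      refine mul_le_mul_of_nonneg_right (le_add_of_nonneg_right ?_) (sq_nonneg _)
      positivity
    _ ≤ _ := by gcongr

/-- Cauchy–Schwarz in u(ℓ) = ⟨ℓ - x, u_xx⟩ and the curvature bound. -/
theorem norm_deflection_le (hT : 0 ≤ T) (hℓ : 0 < ℓ)
    (hB : IsBounded B r κ rho0 rho1 mu1 r0 r1 k)
    (hf : IsReduced B.rho B.mu r κ (volterra T ℝ h) ((potential ℓ).compLp f)
      (volterra T (L2 0 ℓ) f)) :
    ‖deflection (volterra T (L2 0 ℓ) f)‖ ≤ L0 ℓ T r0 * ‖h‖ := by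
  have hr0 := hB.r0_pos
  have h1 := norm_sq_curvature_le hT hℓ hB hf
  have h2 : ‖deflection (volterra T (L2 0 ℓ) f)‖ ≤
      ‖load ℓ‖ * ‖volterra T (L2 0 ℓ) (volterra T (L2 0 ℓ) f)‖ := by
    have := (innerSL ℝ (load ℓ)).norm_compLp_le (volterra T (L2 0 ℓ) (volterra T (L2 0 ℓ) f))
    rwa [innerSL_apply_norm] at this
  have hC : 0 ≤ C0sq T := by
    rw [C0sq, sub_nonneg]
    exact Real.one_le_exp hT
  refine abs_le_of_sq_le_sq' ?_ (by rw [L0]; positivity) |>.2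
  rw [mul_pow, L0, Real.sq_sqrt (by positivity)]
  calc _ ≤ (‖load ℓ‖ * ‖volterra T (L2 0 ℓ) (volterra T (L2 0 ℓ) f)‖) ^ 2 := by gcongr
    _ = ℓ ^ 3 / 3 / r0 * (r0 * ‖volterra T (L2 0 ℓ) (volterra T (L2 0 ℓ) f)‖ ^ 2) := by
      rw [mul_pow, norm_load_sq hℓ.le]
      field_simp
    _ ≤ ℓ ^ 3 / 3 / r0 * (4 * (ℓ ^ 3 / 3) / r0 * (1 + T) * ‖h‖ ^ 2 * C0sq T) := by gcongr
    _ = _ := by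
      field_simp
      ring

/-- The moment ∫x(ρu_tt + μu_t)dx - ℓg involves no trace of u_xx, so the bounds on u_tt and on u_t =
Pw are enough. -/
theorem norm_moment_le (hT : 0 ≤ T) (hℓ : 0 < ℓ)
    (hB : IsBounded B r κ rho0 rho1 mu1 r0 r1 k)
    (hf : IsReduced B.rho B.mu r κ (volterra T ℝ h) ((potential ℓ).compLp f)
      (volterra T (L2 0 ℓ) f)) (k1 : ℝ) :
    ‖moment (volterra T ℝ h) (bodyForce B.rho B.mu ((potential ℓ).compLp f)
        (volterra T (L2 0 ℓ) f))‖
      ≤ L1 ℓ T rho0 rho1 mu1 r0 r1 k k1 * √(‖volterra T ℝ h‖ ^ 2 + ‖h‖ ^ 2) := by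
  have hk := hB.pos
  have hr0 := hB.r0_pos
  have hrho0 := hB.rho0_pos
  set g := volterra T ℝ h
  set w := volterra T (L2 0 ℓ) f
  set q := (potential ℓ).compLp f
  have hw := norm_sq_velocity_le hT hℓ hB hf
  have hq := norm_sq_acceleration_le hT hℓ hB hf rho1 mu1 k1
  set C1 := C1sq ℓ T rho1 mu1 r0 r1 k k1
  have hC1 : 0 ≤ C1 := by
    refine le_trans ?_ ((le_max_left _ _).trans (le_max_left _ _))
    have : 0 ≤ C0sq T + 1 := by
      rw [C0sq, sub_add_cancel]
      positivity
    have := hB.r1_nonneg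
    rw [R2, R1]
    positivity
  have hE : 0 ≤ C0sq T + 1 := by
    rw [C0sq, sub_add_cancel]
    positivity
  -- ‖Pw‖ ≤ ℓ²‖w‖ requires only the factor ℓ⁴, well below C*.
  have hCs : ℓ ^ 4 ≤ Cstar ℓ := by
    rw [Cstar]
    nlinarith [pow_pos hℓ 2, pow_pos hℓ 4]
  have hCs0 : 0 ≤ Cstar ℓ := le_trans (by positivity) hCs
  have hmaxone : 1 ≤ max 1 (2 * ℓ / 3 * (rho1 ^ 2 + mu1 ^ 2)) := le_max_left _ _
  set m := max 1 (2 * ℓ / 3 * (rho1 ^ 2 + mu1 ^ 2)) with hm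
  have hmax : 2 * ℓ / 3 * (rho1 ^ 2 + mu1 ^ 2) ≤ m := le_max_right _ _
  have hPw : ‖(potential ℓ).compLp w‖ ≤ ℓ ^ 2 * ‖w‖ := by
    refine Lp.norm_le_mul_norm_of_ae_le_mul ?_
    filter_upwards [(potential ℓ).coeFn_compLp w] with t h1
    rw [h1]
    exact norm_potential_le hℓ.le _
  have hz : ‖bodyForce B.rho B.mu q w‖ ≤ rho1 * ‖q‖ + mu1 * ‖(potential ℓ).compLp w‖ := by
    have n1 : ‖(mulOp B.rho).compLp q‖ ≤ rho1 * ‖q‖ := by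
      refine Lp.norm_le_mul_norm_of_ae_le_mul ?_
      filter_upwards [(mulOp B.rho).coeFn_compLp q] with t h1
      rw [h1]
      exact norm_mulOp_le (hB.rho_bound.mono fun x hx =>
        abs_le.2 ⟨by linarith [hx.1, hx.2], hx.2⟩) _
    have n2 : ‖(mulOp B.mu ∘L potential ℓ).compLp w‖ ≤ mu1 * ‖(potential ℓ).compLp w‖ := by
      rw [comp_compLp]
      refine Lp.norm_le_mul_norm_of_ae_le_mul ?_
      filter_upwards [(mulOp B.mu).coeFn_compLp ((potential ℓ).compLp w)] with t h1
      rw [h1]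
      refine norm_mulOp_le ?_ _
      filter_upwards [hB.mu_nonneg, hB.mu_le] with x h1 h2
      exact abs_le.2 ⟨by linarith, h2⟩
    exact (norm_add_le _ _).trans (add_le_add n1 n2)
  have hM : ‖moment g (bodyForce B.rho B.mu q w)‖
      ≤ ‖volterra ℓ ℝ (embed ℓ ℝ 1)‖ * ‖bodyForce B.rho B.mu q w‖ + ℓ * ‖g‖ := by
    refine (norm_sub_le _ _).trans (add_le_add ?_ ?_)
    · have := (innerSL ℝ (volterra ℓ ℝ (embed ℓ ℝ 1))).norm_compLp_le (bodyForce B.rho B.mu q w)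
      rwa [innerSL_apply_norm] at this
    · rw [norm_smul, Real.norm_of_nonneg hℓ.le]
  have add_sq : ∀ a b : ℝ, (a + b) ^ 2 ≤ 2 * (a ^ 2 + b ^ 2) := fun a b => by
    nlinarith [sq_nonneg (a - b)]
  have hz2 : ‖bodyForce B.rho B.mu q w‖ ^ 2
      ≤ 2 * ((rho1 ^ 2 + mu1 ^ 2) * (‖q‖ ^ 2 + ‖(potential ℓ).compLp w‖ ^ 2)) := by
    refine ((pow_le_pow_left₀ (norm_nonneg _) hz 2).trans (add_sq _ _)).trans ?_
    have : 0 ≤ (rho1 * ‖(potential ℓ).compLp w‖) ^ 2 + (mu1 * ‖q‖) ^ 2 := by positivity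
    linarith
  have hM2 : ‖moment g (bodyForce B.rho B.mu q w)‖ ^ 2
      ≤ C7sq ℓ rho1 mu1 * (‖g‖ ^ 2 + (‖q‖ ^ 2 + ‖(potential ℓ).compLp w‖ ^ 2)) := by
    refine ((pow_le_pow_left₀ (norm_nonneg _) hM 2).trans (add_sq _ _)).trans ?_
    rw [mul_pow, norm_volterra_one_sq hℓ.le, mul_pow, C7sq, ← hm]
    calc _ ≤ 2 * (ℓ ^ 3 / 3 * (2 * ((rho1 ^ 2 + mu1 ^ 2)
            * (‖q‖ ^ 2 + ‖(potential ℓ).compLp w‖ ^ 2))) + ℓ ^ 2 * ‖g‖ ^ 2) := by gcongr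
      _ = 2 * ℓ ^ 2 * (2 * ℓ / 3 * (rho1 ^ 2 + mu1 ^ 2)
          * (‖q‖ ^ 2 + ‖(potential ℓ).compLp w‖ ^ 2) + 1 * ‖g‖ ^ 2) := by ring
      _ ≤ 2 * ℓ ^ 2 * (m * (‖q‖ ^ 2 + ‖(potential ℓ).compLp w‖ ^ 2) + m * ‖g‖ ^ 2) := by gcongr
      _ = _ := by ring
  have hw2 : ‖(potential ℓ).compLp w‖ ^ 2
      ≤ Cstar ℓ * (C0sq T + 1) / (3 * k * r0) * (1 + T) * ℓ ^ 3 * ‖h‖ ^ 2 := by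
    calc _ ≤ (ℓ ^ 2 * ‖w‖) ^ 2 := by gcongr
      _ = ℓ ^ 4 * (4 * k * ‖w‖ ^ 2) / (4 * k) := by
        field_simp
      _ ≤ Cstar ℓ * (4 * (ℓ ^ 3 / 3) / r0 * (1 + T) * ‖h‖ ^ 2 * (C0sq T + 1)) / (4 * k) := by
        gcongr
      _ = _ := by
        field_simp
  have hq2 : ‖q‖ ^ 2 ≤ C1 / (2 * rho0) * (1 + T) * ℓ ^ 3 * ‖h‖ ^ 2 := by
    calc _ = rho0 * ‖q‖ ^ 2 / rho0 := by field_simp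
      _ ≤ C1 / 2 * ((1 + T) * ℓ ^ 3) * ‖h‖ ^ 2 / rho0 := by gcongr
      _ = _ := by field_simp
  have hC7 : 0 ≤ C7sq ℓ rho1 mu1 := by
    rw [C7sq]
    positivity
  have hK : 0 ≤ (Cstar ℓ * (C0sq T + 1) / (3 * k * r0) + C1 / (2 * rho0)) * (1 + T) * ℓ ^ 3 := by
    positivity
  set K := (Cstar ℓ * (C0sq T + 1) / (3 * k * r0) + C1 / (2 * rho0)) * (1 + T) * ℓ ^ 3 with hKdef
  refine abs_le_of_sq_le_sq' ?_ (by rw [L1]; positivity) |>.2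
  rw [mul_pow, L1, Real.sq_sqrt (by positivity), Real.sq_sqrt (by positivity)]
  refine hM2.trans ?_
  rw [mul_assoc]
  refine mul_le_mul_of_nonneg_left ?_ hC7
  have : 0 ≤ K * ‖g‖ ^ 2 := by positivity
  have h5 : ‖q‖ ^ 2 + ‖(potential ℓ).compLp w‖ ^ 2 ≤ K * ‖h‖ ^ 2 := by
    rw [hKdef]
    linarith
  change _ ≤ (1 + K) * _
  linarith [sq_nonneg ‖h‖]

end Estimates

end

section

variable {ℓ T : ℝ}

/-! ### Compactness of the Volterra operator -/

section Compact

/-- Primitives of a bounded set are uniformly bounded and 1/2-Hölder with a common constant: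
Arzelà–Ascoli in C[0,T], followed by the continuous embedding into L². -/
theorem isCompact_closure_volterra_image {S : Set (L2t T ℝ)} (hS : Bornology.IsBounded S) :
    IsCompact (closure (volterra T ℝ '' S)) := by
  obtain ⟨C, hC⟩ := hS.exists_norm_le
  set j : L2t T ℝ → BoundedContinuousFunction (Icc (0 : ℝ) T) ℝ :=
    fun f => BoundedContinuousFunction.mkOfCompact (volterraC T ℝ f)
  have hj : IsCompact (closure (j '' S)) := by
    refine BoundedContinuousFunction.arzela_ascoli (Metric.closedBall 0 (√T * C))
      (isCompact_closedBall _ _) _ ?_ ?_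
    · rintro _ x ⟨f, hf, rfl⟩
      rw [mem_closedBall_zero_iff]
      exact (L2t.norm_prim_le f x.2.1 x.2.2).trans (by gcongr; exact hC f hf)
    · refine Metric.equicontinuous_of_continuity_modulus (fun d => √d * C) ?_ _ ?_
      · have : Continuous fun d => √d * C := Real.continuous_sqrt.mul continuous_const
        simpa using this.tendsto 0
      · rintro x y ⟨_, f, hf, rfl⟩
        have key : ∀ s t : Icc (0 : ℝ) T, s ≤ t → dist (prim f s) (prim f t) ≤ √(dist s t) * C := by
          intro s t hst
          rw [dist_comm, dist_comm s, dist_eq_norm, Subtype.dist_eq, Real.dist_eq,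
            abs_of_nonneg (sub_nonneg.2 (Subtype.coe_le_coe.2 hst))]
          exact (L2t.norm_prim_sub_le f s.2.1 hst t.2.2).trans (by gcongr; exact hC f hf)
        rcases le_total x y with h | h
        · exact key x y h
        · have := key y x h
          rwa [dist_comm, dist_comm y x] at this
  set e : BoundedContinuousFunction (Icc (0 : ℝ) T) ℝ → L2t T ℝ :=
    fun F => embed T ℝ F.toContinuousMap
  have he : Continuous e :=
    (embed T ℝ).continuous.comp (ContinuousMap.isometryEquivBoundedOfCompact _ _).symm.continuous
  refine (hj.image he).closure_of_subset ?_
  rintro _ ⟨f, hf, rfl⟩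
  exact ⟨j f, subset_closure (mem_image_of_mem j hf), rfl⟩

end Compact

/-! ### The input-output operators -/

section Operators

variable {B : Coeffs ℓ} {r κ : C(Icc (0 : ℝ) ℓ, ℝ)} {rho0 rho1 mu1 r0 r1 k : ℝ}

theorem deflection_sub (w w' : L2t T (L2 0 ℓ)) :
    deflection (w - w') = deflection w - deflection w' := by
  rw [deflection, map_sub, compLp_sub]
  rfl

theorem moment_bodyForce_sub (rho mu : LInf 0 ℓ) (g g' : L2 0 T) (q w q' w' : L2t T (L2 0 ℓ)) :
    moment (g - g') (bodyForce rho mu (q - q') (w - w'))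
      = moment g (bodyForce rho mu q w) - moment g' (bodyForce rho mu q' w') := by
  have h : bodyForce rho mu (q - q') (w - w') = bodyForce rho mu q w - bodyForce rho mu q' w' := by
    rw [bodyForce, compLp_sub, compLp_sub, bodyForce, bodyForce]
    abel
  rw [h, moment, compLp_sub, moment, moment, smul_sub]
  abel

theorem moment_bodyForce_volterra (rho mu : LInf 0 ℓ) (g : L2 0 T) (q w : L2t T (L2 0 ℓ)) :
    moment (volterra T ℝ g) (bodyForce rho mu (volterra T (L2 0 ℓ) q) (volterra T (L2 0 ℓ) w))
      = volterra T ℝ (moment g (bodyForce rho mu q w)) := by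
  rw [moment, moment, bodyForce, bodyForce, ← volterra_compLp, ← volterra_compLp, ← map_add,
    map_sub, map_smul, volterra_compLp]

/-- By linearity and uniqueness the difference of the two solutions is the solution with data h -
h'. -/
theorem norm_Phi_sub_le (hℓ : 0 < ℓ) (hT : 0 < T) (hB : IsBounded B r κ rho0 rho1 mu1 r0 r1 k)
    (h h' : L2 0 T) :
    ‖Phi B (volterra T ℝ h) - Phi B (volterra T ℝ h')‖ ≤ L0 ℓ T r0 * ‖h - h'‖ := by
  obtain ⟨f, hf⟩ := hB.exists_isReduced h
  obtain ⟨f', hf'⟩ := hB.exists_isReduced h'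
  obtain ⟨d, hd⟩ := hB.exists_isReduced (h - h')
  have hs := hf.sub hf'
  rw [← map_sub] at hs
  rw [hf.Phi_eq hℓ hT hB.toIsDissipative, hf'.Phi_eq hℓ hT hB.toIsDissipative, ← deflection_sub,
    (hd.eq hT.le hB.toIsDissipative hs).2]
  exact norm_deflection_le hT.le hℓ hB hd

theorem norm_Psi_sub_le (hℓ : 0 < ℓ) (hT : 0 < T) (hB : IsBounded B r κ rho0 rho1 mu1 r0 r1 k)
    (k1 : ℝ) (h h' : L2 0 T) :
    ‖Psi B (volterra T ℝ h) - Psi B (volterra T ℝ h')‖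
      ≤ L1 ℓ T rho0 rho1 mu1 r0 r1 k k1
        * √(‖volterra T ℝ h - volterra T ℝ h'‖ ^ 2 + ‖h - h'‖ ^ 2) := by
  obtain ⟨f, hf⟩ := hB.exists_isReduced h
  obtain ⟨f', hf'⟩ := hB.exists_isReduced h'
  obtain ⟨d, hd⟩ := hB.exists_isReduced (h - h')
  have hs := hf.sub hf'
  rw [← map_sub] at hs
  have he := hd.eq hT.le hB.toIsDissipative hs
  rw [hf.Psi_eq hℓ hT hB.toIsDissipative, hf'.Psi_eq hℓ hT hB.toIsDissipative,
    ← moment_bodyForce_sub, he.1, he.2, ← map_sub]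
  exact norm_moment_le hT.le hℓ hB hd k1

/-- The time derivative of the deflection is ⟨load, u_xxt⟩, bounded by the velocity estimate. -/
theorem exists_norm_le_Phi_eq (hℓ : 0 < ℓ) (hT : 0 < T)
    (hB : IsBounded B r κ rho0 rho1 mu1 r0 r1 k) :
    ∃ c : ℝ, ∀ h : L2 0 T, ∃ η : L2 0 T, ‖η‖ ≤ c * ‖h‖ ∧ Phi B (volterra T ℝ h) = volterra T ℝ η := by
  have hk := hB.pos
  have hr0 := hB.r0_pos
  refine ⟨‖load ℓ‖ * √(ℓ ^ 3 / 3 / (r0 * k) * (1 + T) * (C0sq T + 1)), fun h => ?_⟩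
  obtain ⟨f, hf⟩ := hB.exists_isReduced h
  refine ⟨(innerSL ℝ (load ℓ)).compLp (volterra T (L2 0 ℓ) f), ?_, ?_⟩
  · have h1 := (innerSL ℝ (load ℓ)).norm_compLp_le (volterra T (L2 0 ℓ) f)
    rw [innerSL_apply_norm] at h1
    refine h1.trans ?_
    rw [mul_assoc]
    gcongr
    have h2 := norm_sq_velocity_le hT.le hℓ hB hf
    have hE : 0 ≤ C0sq T + 1 := by
      rw [C0sq, sub_add_cancel]
      positivity
    refine (abs_le_of_sq_le_sq' ?_ (by positivity)).2
    rw [mul_pow, Real.sq_sqrt (by positivity)]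
    calc _ = 4 * k * ‖volterra T (L2 0 ℓ) f‖ ^ 2 / (4 * k) := by field_simp
      _ ≤ 4 * (ℓ ^ 3 / 3) / r0 * (1 + T) * ‖h‖ ^ 2 * (C0sq T + 1) / (4 * k) := by gcongr
      _ = _ := by field_simp
  · rw [hf.Phi_eq hℓ hT hB.toIsDissipative, deflection, volterra_compLp]

/-- Integrating a solution in time solves the problem with integrated force. Hence Ψ gains a
derivative from that of g, which is why it is compact on H². -/
theorem Psi_volterra (hℓ : 0 < ℓ) (hT : 0 < T) (hB : IsDissipative B r κ k) (h : L2 0 T) :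
    Psi B (volterra T ℝ (volterra T ℝ h)) = volterra T ℝ (Psi B (volterra T ℝ h)) := by
  obtain ⟨f, hf⟩ := hB.exists_isReduced h
  rw [hf.integrate.Psi_eq hℓ hT hB, hf.Psi_eq hℓ hT hB, moment_bodyForce_volterra]

theorem norm_Psi_le (hℓ : 0 < ℓ) (hT : 0 < T) (hB : IsBounded B r κ rho0 rho1 mu1 r0 r1 k)
    (k1 : ℝ) (h : L2 0 T) :
    ‖Psi B (volterra T ℝ h)‖
      ≤ L1 ℓ T rho0 rho1 mu1 r0 r1 k k1 * √(‖volterra T ℝ h‖ ^ 2 + ‖h‖ ^ 2) := by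
  obtain ⟨f, hf⟩ := hB.exists_isReduced h
  rw [hf.Psi_eq hℓ hT hB.toIsDissipative]
  exact norm_moment_le hT.le hℓ hB hf k1

end Operators

/-! ### Sobolev inputs as primitives; the compactness criterion -/

section Sobolev

theorem wd_sub {n : ℕ} {a b : ℝ} (g g' : Sobolev n a b) (i : Fin (n + 1)) :
    wd (g - g') i = wd g i - wd g' i := rfl

theorem Sobolev.norm_sq_eq {n : ℕ} {a b : ℝ} (g : Sobolev n a b) :
    ‖g‖ ^ 2 = ∑ i, ‖wd g i‖ ^ 2 := PiLp.norm_sq_eq_of_L2 _ _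

theorem Sobolev.norm_wd_le {n : ℕ} {a b : ℝ} (g : Sobolev n a b) (i : Fin (n + 1)) :
    ‖wd g i‖ ≤ ‖g‖ := PiLp.norm_apply_le _ _

theorem G1.wd_zero {C : ℝ} (hT : 0 < T) {g : Sobolev 1 0 T} (hg : g ∈ G1 T C) :
    wd g 0 = volterra T ℝ (wd g 1) := HasWeakDeriv.eq_volterra hT (g.2 0) hg.1

theorem G2.wd_zero {C : ℝ} (hT : 0 < T) {g : Sobolev 2 0 T} (hg : g ∈ G2 T C) :
    wd g 0 = volterra T ℝ (wd g 1) := HasWeakDeriv.eq_volterra hT (g.2 0) hg.1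

theorem G2.wd_one {C : ℝ} (hT : 0 < T) {g : Sobolev 2 0 T} (hg : g ∈ G2 T C) :
    wd g 1 = volterra T ℝ (wd g 2) := HasWeakDeriv.eq_volterra hT (g.2 1) hg.2.1

/-- Values on a bounded set are primitives of a bounded set of L², which J maps into a relatively
compact set. -/
theorem isCompactMapOn_of_lipschitz {X : Type*} [NormedAddCommGroup X] {F : X → L2 0 T}
    {D : Set X} {K c : ℝ} (hK : 0 ≤ K) (hF : ∀ g ∈ D, ∀ g' ∈ D, ‖F g - F g'‖ ≤ K * ‖g - g'‖)
    (hc : ∀ g ∈ D, ∃ η : L2 0 T, ‖η‖ ≤ c * ‖g‖ ∧ F g = volterra T ℝ η) : IsCompactMapOn F D := by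
  constructor
  · refine (LipschitzOnWith.of_dist_le_mul (K := ⟨K, hK⟩) fun g hg g' hg' => ?_).continuousOn
    rw [dist_eq_norm, dist_eq_norm]
    exact hF g hg g' hg'
  · intro S hS hb
    obtain ⟨R, hR⟩ := hb.exists_norm_le
    refine (isCompact_closure_volterra_image
      (Metric.isBounded_closedBall (x := (0 : L2 0 T)) (r := |c| * R))).closure_of_subset ?_
    rintro _ ⟨g, hg, rfl⟩
    obtain ⟨η, h1, h2⟩ := hc g (hS hg)
    refine subset_closure ⟨η, ?_, h2.symm⟩
    rw [mem_closedBall_zero_iff]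
    calc ‖η‖ ≤ c * ‖g‖ := h1
      _ ≤ |c| * ‖g‖ := by gcongr; exact le_abs_self c
      _ ≤ |c| * R := by gcongr; exact hR g hg

end Sobolev

end

end Beam

end

/-! ### The main theorem -/

theorem proposition3p1
    (ℓ T : ℝ) (hℓ : 0 < ℓ) (hT : 0 < T) (B : Beam.Coeffs ℓ)
    (rho0 rho1 mu0 mu1 r0 r1 kappa0 kappa1 : ℝ)
    (hrho0 : 0 < rho0) (hmu0 : 0 ≤ mu0) (hr0 : 0 < r0) (hkappa0 : 0 < kappa0)
    (hrho : ∀ᵐ x ∂(volume.restrict (Ioo 0 ℓ)), rho0 ≤ B.rho x ∧ B.rho x ≤ rho1)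
    (hmu : ∀ᵐ x ∂(volume.restrict (Ioo 0 ℓ)), mu0 ≤ B.mu x ∧ B.mu x ≤ mu1)
    (hr : ∀ᵐ x ∂(volume.restrict (Ioo 0 ℓ)),
      r0 ≤ Beam.wd B.r 0 x ∧ Beam.wd B.r 0 x ≤ r1)
    (hkappa : ∀ᵐ x ∂(volume.restrict (Ioo 0 ℓ)),
      kappa0 ≤ Beam.wd B.kappa 0 x ∧ Beam.wd B.kappa 0 x ≤ kappa1)
    (C C' : ℝ) (hC : 0 < C) (hC' : 0 < C') :
    -- the direct problem is uniquely solvable and both outputs are well defined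
    (∀ g ∈ Beam.G1 T C,
      (∃! u : Beam.L2t T (Beam.V ℓ), Beam.IsWeakSolution B (Beam.wd g 0) u) ∧
      (∃! ν : Beam.L2 0 T, Beam.IsDeflection B (Beam.wd g 0) ν) ∧
      (∃! m : Beam.L2 0 T, Beam.IsMoment B (Beam.wd g 0) m)) ∧
    -- the same for inputs in the second admissible set
    (∀ g ∈ Beam.G2 T C',
      (∃! u : Beam.L2t T (Beam.V ℓ), Beam.IsWeakSolution B (Beam.wd g 0) u) ∧
      (∃! ν : Beam.L2 0 T, Beam.IsDeflection B (Beam.wd g 0) ν) ∧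
      (∃! m : Beam.L2 0 T, Beam.IsMoment B (Beam.wd g 0) m)) ∧
    -- compactness
    Beam.IsCompactMapOn (fun g : Beam.Sobolev 1 0 T => Beam.Phi B (Beam.wd g 0))
      (Beam.G1 T C) ∧
    Beam.IsCompactMapOn (fun g : Beam.Sobolev 2 0 T => Beam.Psi B (Beam.wd g 0))
      (Beam.G2 T C') ∧
    -- Lipschitz continuity with explicit constants
    (∀ g₁ ∈ Beam.G1 T C, ∀ g₂ ∈ Beam.G1 T C,
      ‖Beam.Phi B (Beam.wd g₁ 0) - Beam.Phi B (Beam.wd g₂ 0)‖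
        ≤ Beam.L0 ℓ T r0 * ‖g₁ - g₂‖) ∧
    (∀ g₁ ∈ Beam.G1 T C, ∀ g₂ ∈ Beam.G1 T C,
      ‖Beam.Psi B (Beam.wd g₁ 0) - Beam.Psi B (Beam.wd g₂ 0)‖
        ≤ Beam.L1 ℓ T rho0 rho1 mu1 r0 r1 kappa0 kappa1 * ‖g₁ - g₂‖) := by
  obtain ⟨r, er⟩ := Beam.HasWeakDeriv.exists_embed_eq hℓ (B.r.2 0)
  obtain ⟨κ, eκ⟩ := Beam.HasWeakDeriv.exists_embed_eq hℓ (B.kappa.2 0)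
  change Beam.embed ℓ ℝ r = Beam.wd B.r 0 at er
  change Beam.embed ℓ ℝ κ = Beam.wd B.kappa 0 at eκ
  -- The interval has positive measure, so the a.e. bounds hold at some point; this gives r₁ ≥ 0.
  have hr1 : r0 ≤ r1 := by
    have : NeBot (ae (volume.restrict (Ioo 0 ℓ))) := by
      rw [ae_neBot, Ne, Measure.restrict_eq_zero, Real.volume_Ioo]
      simpa using hℓ
    obtain ⟨x, hx⟩ := hr.exists
    exact hx.1.trans hx.2
  have hB : Beam.IsBounded B r κ rho0 rho1 mu1 r0 r1 kappa0 :=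
    { embed_r := er
      embed_kappa := eκ
      rho_nonneg := hrho.mono fun x hx => hrho0.le.trans hx.1
      mu_nonneg := hmu.mono fun x hx => hmu0.trans hx.1
      r_nonneg := by rw [er]; exact hr.mono fun x hx => hr0.le.trans hx.1
      pos := hkappa0
      le_kappa := by rw [eκ]; exact hkappa.mono fun x hx => hx.1
      rho0_pos := hrho0
      r0_pos := hr0
      r1_nonneg := hr0.le.trans hr1
      rho_bound := hrho
      mu_le := hmu.mono fun x hx => hx.2
      r_bound := by rw [er]; exact hr }
  have hL0 : 0 ≤ Beam.L0 ℓ T r0 := Real.sqrt_nonneg _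
  have hL1 : 0 ≤ Beam.L1 ℓ T rho0 rho1 mu1 r0 r1 kappa0 kappa1 := Real.sqrt_nonneg _
  have hPhi : ∀ g₁ ∈ Beam.G1 T C, ∀ g₂ ∈ Beam.G1 T C,
      ‖Beam.Phi B (Beam.wd g₁ 0) - Beam.Phi B (Beam.wd g₂ 0)‖
        ≤ Beam.L0 ℓ T r0 * ‖g₁ - g₂‖ := by
    intro g₁ h₁ g₂ h₂
    rw [Beam.G1.wd_zero hT h₁, Beam.G1.wd_zero hT h₂]
    refine (Beam.norm_Phi_sub_le hℓ hT hB _ _).trans ?_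
    rw [← Beam.wd_sub]
    gcongr
    exact Beam.Sobolev.norm_wd_le _ 1
  -- Every input in either admissible set is the primitive of its L² derivative, so one solvability
  -- statement covers both.
  have hsolve : ∀ h : Beam.L2 0 T, _ := fun h =>
    (hB.exists_isReduced h).choose_spec.existsUnique hℓ hT hB.toIsDissipative
  refine ⟨fun g hg => ?_, fun g hg => ?_, ?_, ?_, hPhi, fun g₁ h₁ g₂ h₂ => ?_⟩
  · rw [Beam.G1.wd_zero hT hg]
    exact hsolve _
  · rw [Beam.G2.wd_zero hT hg]
    exact hsolve _
  · obtain ⟨c, hc⟩ := Beam.exists_norm_le_Phi_eq hℓ hT hB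
    refine Beam.isCompactMapOn_of_lipschitz (c := |c|) hL0 hPhi fun g hg => ?_
    obtain ⟨η, h1, h2⟩ := hc (Beam.wd g 1)
    refine ⟨η, h1.trans ?_, by rw [← h2, ← Beam.G1.wd_zero hT hg]⟩
    exact mul_le_mul (le_abs_self c) (Beam.Sobolev.norm_wd_le g 1) (norm_nonneg _) (abs_nonneg c)
  · refine Beam.isCompactMapOn_of_lipschitz (c := Beam.L1 ℓ T rho0 rho1 mu1 r0 r1 kappa0 kappa1)
      hL1 (fun g hg g' hg' => ?_) fun g hg => ?_
    · rw [Beam.G2.wd_zero hT hg, Beam.G2.wd_zero hT hg']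
      refine (Beam.norm_Psi_sub_le hℓ hT hB kappa1 _ _).trans ?_
      rw [← Beam.G2.wd_zero hT hg, ← Beam.G2.wd_zero hT hg', ← Beam.wd_sub, ← Beam.wd_sub]
      gcongr
      refine Real.sqrt_le_iff.2 ⟨norm_nonneg _, ?_⟩
      rw [Beam.Sobolev.norm_sq_eq, Fin.sum_univ_three]
      exact le_add_of_nonneg_right (sq_nonneg _)
    -- Here Ψg = JΨ(g'), and Ψ(g') is bounded by L₁ times the H¹ norm of g', a part of the H² norm
    -- of g.
    · refine ⟨Beam.Psi B (Beam.wd g 1), ?_, ?_⟩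
      · rw [Beam.G2.wd_one hT hg]
        refine (Beam.norm_Psi_le hℓ hT hB kappa1 _).trans ?_
        rw [← Beam.G2.wd_one hT hg]
        gcongr
        refine Real.sqrt_le_iff.2 ⟨norm_nonneg _, ?_⟩
        rw [Beam.Sobolev.norm_sq_eq, Fin.sum_univ_three, add_assoc]
        exact le_add_of_nonneg_left (sq_nonneg _)
      · rw [Beam.G2.wd_zero hT hg, Beam.G2.wd_one hT hg,
          Beam.Psi_volterra hℓ hT hB.toIsDissipative]
  · rw [Beam.G1.wd_zero hT h₁, Beam.G1.wd_zero hT h₂]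
    refine (Beam.norm_Psi_sub_le hℓ hT hB kappa1 _ _).trans ?_
    rw [← Beam.G1.wd_zero hT h₁, ← Beam.G1.wd_zero hT h₂, ← Beam.wd_sub, ← Beam.wd_sub]
    gcongr
    refine Real.sqrt_le_iff.2 ⟨norm_nonneg _, ?_⟩
    rw [Beam.Sobolev.norm_sq_eq, Fin.sum_univ_two]
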